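/- Let $\tau_1,\tau_2,\dots$ be i.i.d. positive random variables with finite mean $\mathbb E\tau_1=1/\lambda$, and let $Y_1,Y_2,\dots$ be i.i.d. real random variables with finite mean $b=\mathbb E Y_1$, the sequence $(Y_n)$ being independent of the sequence $(\tau_n)$. Put $T_0=0$, $T_n=\tau_1+\dots+\tau_n$, let $N_t=\#\{n\ge1:T_n\le t\}$, and for a real constant $c$ let $X_t=\sum_{i=1}^{N_t}Y_i+ct$ and $M_t=\sup_{u\in[0,t]}X_u$. Suppose that $a:=c/\lambda+b<0$. Let $B$ be the distribution of $Y_1^+=\max(Y_1,0)$, with tail $\overline B(x)=B(x,\infty)$, and suppose that $B$ is strong subexponential, that is, $\overline B(x)>0$ for all $x$, $B$ has finite mean, and $\int_0^x\overline B(x-y)\overline B(y)\,dy\sim2\overline B(x)\int_0^\infty\overline B(y)\,dy$ as $x\to\infty$. Suppose finally that one of the following holds: (i) $c\le0$; (ii) $c>0$ and $\mathbb P\{c\tau_1>x\}=o(\overline B(x))$ as $x\to\infty$. Then, uniformly for all $t>0$, $$\mathbb P\{M_t>x\}\sim\frac1{|a|}\int_x^{x+|a|\,\mathbb E N_t}\overline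 B(v)\,dv\qquad\text{as }x\to\infty,$$ that is, for every $\varepsilon>0$ there is $x_0$ such that for all $x\ge x_0$ and all $t>0$ the difference of the two sides is at most $\varepsilon$ times the right-hand side in absolute value. In particular, $$\mathbb P\{M_t>x\}\sim\frac1{|a|}\int_x^{x+|a|\lambda t}\overline B(v)\,dv\qquad\text{as }x,t\to\infty.$$ -/

import Mathlib

open MeasureTheory ProbabilityTheory Filter Asymptotics

/-- The (right) tail `F(x, ∞)` of a distribution `F` on the real line. -/
noncomputable def tail (F : Measure ℝ) (x : ℝ) : ℝ := F.real (Set.Ioi x)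

/-- Strong subexponential distributions on the real line (the class `S^*`): right unbounded
support, finite mean, and
`∫_0^x tail F (x - y) * tail F y dy ∼ 2 * tail F x * ∫_0^∞ tail F y dy` as `x → ∞`. -/
structure StrongSubexponential (F : Measure ℝ) : Prop where
  isProbabilityMeasure : IsProbabilityMeasure F
  tail_pos : ∀ x : ℝ, 0 < tail F x
  integrable_id : Integrable (fun x : ℝ => x) F
  equiv : (fun x : ℝ => ∫ y in (0 : ℝ)..x, tail F (x - y) * tail F y) ~[atTop]
    (fun x : ℝ => 2 * tail F x * ∫ y in Set.Ioi (0 : ℝ), tail F y)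

namespace CompoundRenewal

variable {Ω : Type*}

/-- The standing assumptions on the interarrival times `τ` and the jumps `Y`
(`τ n` and `Y n` are the `(n + 1)`-st interarrival time and jump): the `τ`'s are positive and
i.i.d. with finite mean, the `Y`'s are i.i.d. with finite mean, and the sequence of the `Y`'s is
independent of the sequence of the `τ`'s. -/
structure IsInput [MeasurableSpace Ω] (μ : Measure Ω) (τ Y : ℕ → Ω → ℝ) : Prop where
  measurable_tau : ∀ n, Measurable (τ n)
  measurable_jump : ∀ n, Measurable (Y n)
  tau_pos : ∀ n, ∀ᵐ ω ∂μ, 0 < τ n ω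
  indep_tau : iIndepFun τ μ
  identDistrib_tau : ∀ n, IdentDistrib (τ n) (τ 0) μ μ
  integrable_tau : Integrable (τ 0) μ
  indep_jump : iIndepFun Y μ
  identDistrib_jump : ∀ n, IdentDistrib (Y n) (Y 0) μ μ
  integrable_jump : Integrable (Y 0) μ
  indep_tau_jump : IndepFun (fun ω n => τ n ω) (fun ω n => Y n ω) μ

/-- The jump epochs `T_n = τ_1 + ⋯ + τ_n`, with `T_0 = 0`. -/
noncomputable def epoch (τ : ℕ → Ω → ℝ) (n : ℕ) (ω : Ω) : ℝ :=
  ∑ i ∈ Finset.range n, τ i ω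

/-- The renewal process: `N_t` is the number of `n ≥ 1` with `T_n ≤ t`
(almost surely finite, because `T_n → ∞` almost surely). -/
noncomputable def count (τ : ℕ → Ω → ℝ) (t : ℝ) (ω : Ω) : ℕ :=
  Set.ncard {n : ℕ | 1 ≤ n ∧ epoch τ n ω ≤ t}

/-- The compound renewal process with linear drift, `X_t = ∑_{i ≤ N_t} Y_i + c t`. -/
noncomputable def process (τ Y : ℕ → Ω → ℝ) (c t : ℝ) (ω : Ω) : ℝ :=
  ∑ i ∈ Finset.range (count τ t ω), Y i ω + c * t

/-- The running maximum `M_t = sup_{u ∈ [0, t]} X_u` (the trajectories are almost surely bounded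
on bounded intervals). -/
noncomputable def runningMax (τ Y : ℕ → Ω → ℝ) (c t : ℝ) (ω : Ω) : ℝ :=
  sSup ((fun u : ℝ => process τ Y c u ω) '' Set.Icc 0 t)

/-- The distribution `B` of the positive part `Y_1^+` of a jump. -/
noncomputable def jumpLaw [MeasurableSpace Ω] (μ : Measure Ω) (Y : ℕ → Ω → ℝ) : Measure ℝ :=
  μ.map (fun ω => max (Y 0 ω) 0)

end CompoundRenewal

/-! Write `G` for the tail of `B`, `ξ = Y + cτ` for the increment over one jump and one interarrival
time (mean `-a` with `a > 0` from here on), and `m(t) = E N_t`. The target `window G a (m t) x` is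
the expected number of single jumps that carry a path drifting down at rate `a` per jump above `x`.
Upper and lower bounds are proved separately, each uniformly in `t`.

Upper bound: the path is sampled just before its jumps, giving a Markov chain (remaining time `s`,
distance `u` to the level), and `min 1 (window φ a (H s) u)` is shown to be a supermartingale that
also pays for crossings. Here `H` is the renewal function counting time zero, so `E H(s - τ) = H(s)
- 1` for `s ≥ 0`. Hence the upper endpoint `u + a H(s)` of the window keeps its mean, and concavity
of the primitive of `φ` helps there. The lower endpoint rises by `a` on average, so the potential
loses `φ u` up to a curvature error. Strong subexponentiality makes that error `o(G u)`, because two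
intermediate contributions are negligible in `∫ G z * G (u - z)`. The loss has to cover `P(Y + (cτ)⁺
> u - U)`, which is about `G u`; so `φ = (1 + 3ε) G` suffices far from the level, while a large
multiple of `G` is used near it (`IsStrongTail.exists_potential`). Telescoping bounds the crossing
probability by the initial potential, and Jensen together with `E H(t - τ) = m(t)` turns that into
`window G a (m t) x` (`exists_runningMax_le`).

Lower bound: the events that jump `n` is the first to exceed `x + d n`, and that the path before it
is at least `-d n`, are disjoint (`sum_le_measureReal_runningMax`). For bounded `t` finitely many
jumps carry almost all of `m(t)` and `d` is constant. For large `t` the law of large numbers allows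
`d n` of slope slightly above `a`, and the sum is compared with the window. The final asymptotics
add the elementary renewal theorem and the concavity of the window in its length. -/

set_option linter.unusedSectionVars false

/-! ### Analytic consequences of strong subexponentiality. -/

/-- The analytic properties of the tail of a strong subexponential distribution: it is long-tailed,
integrable, and the contribution of two large summands to `∫ G (x - y) G y` is negligible. -/
structure IsStrongTail (G : ℝ → ℝ) : Prop where
  antitone : Antitone G
  pos : ∀ x, 0 < G x
  le_one : ∀ x, G x ≤ 1
  integrableOn : IntegrableOn G (Set.Ioi 0)
  long_tailed : ∀ L ε : ℝ, 0 < ε → ∃ U, ∀ w, U ≤ w → G w ≤ (1 + ε) * G (w + L)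
  conv : ∀ ε : ℝ, 0 < ε → ∃ L₀ : ℝ, ∃ x₀ : ℝ, 0 ≤ L₀ ∧ ∀ L, L₀ ≤ L → ∀ x, x₀ ≤ x → L ≤ x - L →
    ∫ z in L..(x - L), G z * G (x - z) ≤ ε * G x

lemma tail_antitone (F : Measure ℝ) [IsFiniteMeasure F] : Antitone (tail F) := fun _ _ h =>
  measureReal_mono (Set.Ioi_subset_Ioi h)

lemma tail_nonneg (F : Measure ℝ) (x : ℝ) : 0 ≤ tail F x := measureReal_nonneg

lemma tail_le_one (F : Measure ℝ) [IsProbabilityMeasure F] (x : ℝ) : tail F x ≤ 1 :=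
  measureReal_le_one

lemma integrableOn_tail (F : Measure ℝ) [IsProbabilityMeasure F]
    (h : Integrable (fun x : ℝ => x) F) : IntegrableOn (tail F) (Set.Ioi 0) := by
  have h1 : Integrable (fun x : ℝ => max x 0) F := h.pos_part
  have h2 := lintegral_eq_lintegral_meas_lt F (f := fun x : ℝ => max x 0)
    (Eventually.of_forall fun x => le_max_right _ _) h1.aemeasurable
  have h3 : ∫⁻ x, ENNReal.ofReal (max x 0) ∂F < ⊤ := by
    exact (hasFiniteIntegral_iff_ofReal (f := fun x : ℝ => max x 0)
      (Eventually.of_forall fun x => le_max_right _ _)).1 h1.2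
  refine ⟨(tail_antitone F).measurable.aestronglyMeasurable, ?_⟩
  rw [hasFiniteIntegral_iff_ofReal (Eventually.of_forall fun x => tail_nonneg F x)]
  rw [h2] at h3
  refine lt_of_le_of_lt (le_of_eq ?_) h3
  refine setLIntegral_congr_fun measurableSet_Ioi fun t ht => ?_
  have ht' : (0 : ℝ) < t := ht
  have : {a : ℝ | t < max a 0} = Set.Ioi t := by
    ext a; simp [ht'.not_gt]
  simp only [this, tail]
  rw [ofReal_measureReal]

lemma antitone_intervalIntegrable_conv {G : ℝ → ℝ} (hG : Antitone G) (x a b : ℝ) :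
    IntervalIntegrable (fun z => G z * G (x - z)) volume a b := by
  have h1 : IntervalIntegrable G volume a b := hG.intervalIntegrable
  have hm : Measurable (fun z => G (x - z)) := hG.measurable.comp (by fun_prop)
  refine IntervalIntegrable.mono_fun
    (h1.abs.mul_const (max |G (x - min a b)| |G (x - max a b)|)) ?_ ?_
  · exact (hG.measurable.mul hm).aestronglyMeasurable
  · refine (ae_restrict_iff' measurableSet_uIoc).2 (Eventually.of_forall fun z hz => ?_)
    rw [Set.uIoc, Set.mem_Ioc] at hz
    have e1 : G (x - min a b) ≤ G (x - z) := hG (by linarith)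
    have e2 : G (x - z) ≤ G (x - max a b) := hG (by linarith)
    simp only [Real.norm_eq_abs, abs_mul, abs_abs]
    refine mul_le_mul_of_nonneg_left ?_ (abs_nonneg _)
    refine le_trans ?_ (le_abs_self _)
    exact abs_le_max_abs_abs e1 e2

lemma integral_conv_symm (G : ℝ → ℝ) (x a : ℝ) :
    ∫ z in (x / 2)..(x - a), G z * G (x - z) = ∫ z in a..(x / 2), G z * G (x - z) := by
  have := intervalIntegral.integral_comp_sub_left (fun z => G z * G (x - z)) x
    (a := a) (b := x / 2)
  rw [show x - x / 2 = x / 2 by ring] at this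
  rw [← this]
  refine intervalIntegral.integral_congr fun z _ => ?_
  simp [mul_comm]

lemma integral_conv_eq_two_mul {G : ℝ → ℝ} (hG : Antitone G) (x a : ℝ) :
    ∫ z in a..(x - a), G z * G (x - z) = 2 * ∫ z in a..(x / 2), G z * G (x - z) := by
  rw [← intervalIntegral.integral_add_adjacent_intervals
    (antitone_intervalIntegrable_conv hG x a (x / 2))
    (antitone_intervalIntegrable_conv hG x (x / 2) (x - a)), integral_conv_symm]
  ring

/-- By symmetry the convolution is twice its integral over `[0, x/2]`, so the hypothesis says that
`∫ G z * (G (x - z) - G x)` over `[0, x/2]` is `o(G x)`. The integrand is nonnegative, so the same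
holds on every subinterval. A fixed interval `[l, 2l]` yields long-tailedness, and `[L, x/2]` yields
the negligible middle part. -/
lemma StrongSubexponential.isStrongTail {F : Measure ℝ} (hF : StrongSubexponential F) :
    IsStrongTail (tail F) := by
  have := hF.isProbabilityMeasure
  have hanti := tail_antitone F
  have hint := integrableOn_tail F hF.integrable_id
  set G := tail F with hGdef
  set m := ∫ y in Set.Ioi (0 : ℝ), G y with hm
  have hm0 : 0 ≤ m := setIntegral_nonneg measurableSet_Ioi fun y _ => tail_nonneg F y
  have hlim : Tendsto (fun x : ℝ => ∫ y in (0 : ℝ)..(x / 2), G y) atTop (nhds m) :=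
    intervalIntegral_tendsto_integral_Ioi 0 hint (tendsto_id.atTop_div_const two_pos)
  have hii : ∀ a b : ℝ, IntervalIntegrable G volume a b := fun a b => hanti.intervalIntegrable
  have hci := antitone_intervalIntegrable_conv hanti
  -- the excess of the convolution over the linear contribution is negligible
  have key : ∀ ε : ℝ, 0 < ε → ∃ x₀ : ℝ, ∀ x, x₀ ≤ x →
      (∫ z in (0 : ℝ)..(x / 2), G z * G (x - z)) - G x * ∫ z in (0 : ℝ)..(x / 2), G z ≤
        ε * G x := by
    intro ε hε
    -- The relative error of the equivalence contributes `e * m`, and truncating `∫ G` at `x/2`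
    -- contributes `e`.
    set e := ε / (m + 1) with he
    have hepos : 0 < e := by positivity
    have h1 := (hF.equiv.isLittleO).def hepos
    have h2 := hlim.eventually (eventually_ge_nhds (show m - e < m by linarith))
    obtain ⟨x₀, hx₀⟩ := eventually_atTop.1 (h1.and h2)
    refine ⟨x₀, fun x hx => ?_⟩
    obtain ⟨k1, k2⟩ := hx₀ x hx
    have hGx : 0 < G x := hF.tail_pos x
    have k1' : (∫ y in (0 : ℝ)..x, G (x - y) * G y) - 2 * G x * m ≤ e * (2 * G x * m) := by
      have := (le_abs_self _).trans k1
      rwa [Real.norm_eq_abs, abs_of_nonneg (by positivity)] at this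
    have k3 : ∫ y in (0 : ℝ)..x, G (x - y) * G y = 2 * ∫ z in (0 : ℝ)..(x / 2), G z * G (x - z) := by
      have := integral_conv_eq_two_mul hanti x 0
      rw [sub_zero] at this
      rw [← this]
      exact intervalIntegral.integral_congr fun z _ => mul_comm _ _
    rw [k3] at k1'
    have k4 : e * (m + 1) = ε := by rw [he]; field_simp
    have k5 : G x * (m - e) ≤ G x * ∫ z in (0 : ℝ)..(x / 2), G z :=
      mul_le_mul_of_nonneg_left k2 hGx.le
    rw [← k4]
    nlinarith
  have key2 : ∀ ε L : ℝ, 0 < ε → 0 ≤ L → ∃ x₀ : ℝ, ∀ x, x₀ ≤ x → ∀ L₁ L₂, 0 ≤ L₁ → L₁ ≤ L₂ →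
      L₂ ≤ x / 2 →
      (∫ z in L₁..L₂, G z * G (x - z)) - G x * ∫ z in L₁..L₂, G z ≤ ε * G x := by
    intro ε L hε hL
    obtain ⟨x₀, hx₀⟩ := key ε hε
    refine ⟨max x₀ 0, fun x hx L₁ L₂ h1 h2 h3 => ?_⟩
    refine le_trans ?_ (hx₀ x (le_of_max_le_left hx))
    have e : ∀ a b : ℝ, (∫ z in a..b, G z * G (x - z)) - G x * ∫ z in a..b, G z =
        ∫ z in a..b, (G z * G (x - z) - G x * G z) := fun a b => by
      rw [intervalIntegral.integral_sub (hci x a b) ((hii a b).const_mul _),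
        intervalIntegral.integral_const_mul]
    rw [e, e]
    refine intervalIntegral.integral_mono_interval h1 h2 h3 ?_
      ((hci x _ _).sub ((hii _ _).const_mul _))
    refine (ae_restrict_iff' measurableSet_Ioc).2 (Eventually.of_forall fun z hz => ?_)
    have : G x ≤ G (x - z) := hanti (by linarith [hz.1])
    have h0 : 0 ≤ G z := tail_nonneg F z
    show 0 ≤ _
    nlinarith
  refine ⟨hanti, hF.tail_pos, tail_le_one F, hint, ?_, ?_⟩
  · intro L ε hε
    set l := max L 1 with hl
    have hl1 : 1 ≤ l := le_max_right _ _
    set p := G (2 * l) * l with hp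
    have hppos : 0 < p := mul_pos (hF.tail_pos _) (by linarith)
    obtain ⟨x₀, hx₀⟩ := key2 (ε * p) l (by positivity) (by linarith)
    refine ⟨max x₀ (4 * l), fun w hw => ?_⟩
    have hw1 := le_of_max_le_left hw
    have hw2 := le_of_max_le_right hw
    -- On `[l, 2l]` one has `G (w + l - z) ≥ G w` and `G z ≥ G (2l)`, so the excess at `w + l` is at
    -- least `(G w - G (w + l)) * p`.
    have k := hx₀ (w + l) (by linarith) l (2 * l) (by linarith) (by linarith) (by linarith)
    have e : (∫ z in l..(2 * l), G z * G (w + l - z)) - G (w + l) * ∫ z in l..(2 * l), G z =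
        ∫ z in l..(2 * l), (G z * G (w + l - z) - G (w + l) * G z) := by
      rw [intervalIntegral.integral_sub (hci _ _ _) ((hii _ _).const_mul _),
        intervalIntegral.integral_const_mul]
    have k2 : ∫ z in l..(2 * l), (G w - G (w + l)) * G (2 * l) ≤
        ∫ z in l..(2 * l), (G z * G (w + l - z) - G (w + l) * G z) := by
      refine intervalIntegral.integral_mono_on (by linarith) (by simp)
        ((hci _ _ _).sub ((hii _ _).const_mul _)) fun z hz => ?_
      have a1 : G w ≤ G (w + l - z) := hanti (by linarith [hz.1])
      have a2 : G (2 * l) ≤ G z := hanti hz.2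
      have a3 : 0 ≤ G (2 * l) := tail_nonneg F _
      have a4 : G (w + l) ≤ G w := hanti (by linarith)
      nlinarith
    rw [intervalIntegral.integral_const, smul_eq_mul] at k2
    rw [e] at k
    have k3 : (G w - G (w + l)) * p ≤ ε * G (w + l) * p := by
      rw [hp]; rw [hp] at k
      nlinarith
    have k4 := le_of_mul_le_mul_right k3 hppos
    have k5 : G (w + l) ≤ G (w + L) := hanti (by linarith [le_max_left L 1])
    nlinarith
  · intro ε hε
    have h2 := (intervalIntegral_tendsto_integral_Ioi 0 hint tendsto_id).eventually
      (eventually_ge_nhds (show m - ε / 4 < m by linarith))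
    obtain ⟨L₀, hL₀⟩ := eventually_atTop.1 h2
    obtain ⟨x₀, hx₀⟩ := key2 (ε / 4) 0 (by positivity) le_rfl
    refine ⟨max L₀ 0, x₀, le_max_right _ _, fun L hL x hx hLx => ?_⟩
    have hL0 := le_of_max_le_right hL
    have k := hx₀ x hx L (x / 2) hL0 (by linarith) le_rfl
    have k1 : ∫ z in L..(x / 2), G z ≤ ε / 4 := by
      have a1 : ∫ z in L..(x / 2), G z ≤ ∫ z in Set.Ioi L, G z := by
        rw [intervalIntegral.integral_of_le (by linarith)]
        exact setIntegral_mono_set (hint.mono_set (Set.Ioi_subset_Ioi hL0))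
          (Eventually.of_forall fun z => tail_nonneg F z) (Set.Ioc_subset_Ioi_self.eventuallyLE)
      have a2 : (∫ z in (0 : ℝ)..L, G z) + ∫ z in Set.Ioi L, G z = m := 
        intervalIntegral.integral_interval_add_Ioi hint
          (hint.mono_set (Set.Ioi_subset_Ioi hL0))
      have a3 := hL₀ L (le_of_max_le_left hL)
      simp only [id] at a3
      linarith
    rw [integral_conv_eq_two_mul hanti]
    have : G x * ∫ z in L..(x / 2), G z ≤ G x * (ε / 4) :=
      mul_le_mul_of_nonneg_left k1 (tail_nonneg F x)
    linarith

/-! ### Calculus of windows. -/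

/-- `(1 / a) ∫_u^{u + a r} φ`: the approximate number of visits above a level at distance `u` by
one jump, for a walk with drift `-a` and `r` jumps to go. -/
noncomputable def window (φ : ℝ → ℝ) (a r u : ℝ) : ℝ := 1 / a * ∫ v in u..(u + a * r), φ v

section Window

variable {φ : ℝ → ℝ} {a r s u w : ℝ}

lemma Antitone.integral_le_mul (hφ : Antitone φ) (u w : ℝ) :
    ∫ v in u..w, φ v ≤ (w - u) * φ u := by
  rcases le_total u w with h | h
  · have := intervalIntegral.integral_mono_on h (hφ.intervalIntegrable (μ := volume))
      (g := fun _ => φ u) (by simp) fun v hv => hφ hv.1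
    simpa using this
  · have := intervalIntegral.integral_mono_on h (f := fun _ => φ u) (by simp)
      (hφ.intervalIntegrable (μ := volume)) fun v hv => hφ hv.2
    rw [intervalIntegral.integral_symm]
    simp at this
    linarith

lemma Antitone.mul_le_integral (hφ : Antitone φ) (u w : ℝ) :
    (w - u) * φ w ≤ ∫ v in u..w, φ v := by
  have := hφ.integral_le_mul w u
  rw [intervalIntegral.integral_symm] at this
  linarith

lemma mul_window (ha : 0 < a) : a * window φ a r u = ∫ v in u..(u + a * r), φ v := by
  rw [window]; field_simp

@[simp] lemma window_zero : window φ a 0 u = 0 := by simp [window]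

lemma window_nonneg (h0 : ∀ x, 0 ≤ φ x) (ha : 0 < a) (hr : 0 ≤ r) : 0 ≤ window φ a r u := by
  have : u ≤ u + a * r := by nlinarith
  exact mul_nonneg (by positivity) (intervalIntegral.integral_nonneg this fun v _ => h0 v)

/-- The window is concave in its length, with slope `φ (u + a * r)` at `r`, so it lies below its
tangent there. The elementary window bounds follow by setting one length to zero, and Jensen by
averaging over a random `s`. -/
lemma window_le_add (hφ : Antitone φ) (ha : 0 < a) (r s u : ℝ) :
    window φ a s u ≤ window φ a r u + (s - r) * φ (u + a * r) := by
  have h := hφ.integral_le_mul (u + a * r) (u + a * s)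
  have h1 := intervalIntegral.integral_add_adjacent_intervals
    (hφ.intervalIntegrable (μ := volume) (a := u) (b := u + a * r))
    (hφ.intervalIntegrable (μ := volume) (a := u + a * r) (b := u + a * s))
  rw [← mul_window ha, ← mul_window ha] at h1
  have : a * window φ a s u ≤ a * (window φ a r u + (s - r) * φ (u + a * r)) := by
    nlinarith
  exact le_of_mul_le_mul_left this ha

lemma window_mono (hφ : Antitone φ) (h0 : ∀ x, 0 ≤ φ x) (ha : 0 < a) (h : r ≤ s) :
    window φ a r u ≤ window φ a s u := by
  have := window_le_add hφ ha s r u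
  nlinarith [h0 (u + a * s)]

lemma window_le_mul (hφ : Antitone φ) (ha : 0 < a) (r u : ℝ) : window φ a r u ≤ r * φ u := by
  simpa using window_le_add hφ ha 0 r u

lemma mul_le_window (hφ : Antitone φ) (ha : 0 < a) (r u : ℝ) :
    r * φ (u + a * r) ≤ window φ a r u := by
  have := window_le_add hφ ha r 0 u
  rw [window_zero] at this
  linarith

lemma window_comp_add (φ : ℝ → ℝ) (a r u h : ℝ) :
    window φ a r (u + h) = window (fun v => φ (v + h)) a r u := by
  rw [window, window, intervalIntegral.integral_comp_add_right]
  rw [show u + a * r + h = u + h + a * r by ring]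

lemma window_const_mul (K a r u : ℝ) : window (fun v => K * φ v) a r u = K * window φ a r u := by
  rw [window, window, intervalIntegral.integral_const_mul]; ring

lemma window_le_window {ψ : ℝ → ℝ} (hφ : Antitone φ) (hψ : Antitone ψ) (ha : 0 < a) (hr : 0 ≤ r)
    (h : ∀ v, u ≤ v → φ v ≤ ψ v) : window φ a r u ≤ window ψ a r u := by
  have : u ≤ u + a * r := by nlinarith
  exact mul_le_mul_of_nonneg_left (intervalIntegral.integral_mono_on this hφ.intervalIntegrable
    hψ.intervalIntegrable fun v hv => h v hv.1) (by positivity)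

lemma window_antitone (hφ : Antitone φ) (ha : 0 < a) (hr : 0 ≤ r) (h : u ≤ w) :
    window φ a r w ≤ window φ a r u := by
  obtain ⟨d, rfl⟩ : ∃ d, w = u + d := ⟨w - u, by ring⟩
  rw [window_comp_add]
  exact window_le_window (fun x y hxy => hφ (by linarith)) hφ ha hr fun v _ => hφ (by linarith)

/-- Concavity of the window in its length. -/
lemma mul_window_le_window_mul (hφ : Antitone φ) (ha : 0 < a) {θ : ℝ} (hθ0 : 0 ≤ θ)
    (hθ1 : θ ≤ 1) : θ * window φ a r u ≤ window φ a (θ * r) u := by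
  have h1 := window_le_add hφ ha (θ * r) r u
  have h2 := window_le_add hφ ha (θ * r) 0 u
  rw [window_zero] at h2
  nlinarith

lemma window_comp_sub_le (hφ : Antitone φ) (h0 : ∀ x, 0 ≤ φ x) (ha : 0 < a) (hr : 0 ≤ r) {z : ℝ}
    (hz : 0 ≤ z) :
    window φ a r (u - z) ≤ window φ a r u + 1 / a * ∫ v in (0 : ℝ)..z, φ (u - v) := by
  have hii : ∀ p q : ℝ, IntervalIntegrable φ volume p q := fun p q => hφ.intervalIntegrable
  rw [intervalIntegral.integral_comp_sub_left, sub_zero, window, window, ← mul_add]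
  refine mul_le_mul_of_nonneg_left ?_ (by positivity)
  rw [add_comm (∫ v in u..(u + a * r), φ v),
    intervalIntegral.integral_add_adjacent_intervals (hii _ _) (hii _ _)]
  have : 0 ≤ a * r := by positivity
  exact intervalIntegral.integral_mono_interval le_rfl (by linarith) (by linarith)
    (Eventually.of_forall h0) (hii _ _)

lemma continuous_window (hφ : Antitone φ) :
    Continuous (fun p : ℝ × ℝ => window φ a p.1 p.2) := by
  have hii : ∀ p q : ℝ, IntervalIntegrable φ volume p q := fun p q => hφ.intervalIntegrable
  have hc := intervalIntegral.continuous_primitive hii 0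
  have : (fun p : ℝ × ℝ => window φ a p.1 p.2) = fun p =>
      1 / a * ((∫ v in (0 : ℝ)..(p.2 + a * p.1), φ v) - ∫ v in (0 : ℝ)..p.2, φ v) := by
    ext p
    rw [window, intervalIntegral.integral_interval_sub_left (hii _ _) (hii _ _)]
  rw [this]
  fun_prop

end Window

/-! ### Convolution estimates and the one-step drift inequality. -/

section Conv

variable {Ω : Type*} [MeasurableSpace Ω] {μ : Measure Ω} [IsProbabilityMeasure μ]

/-- Writing the inner integral as an integral of `G (x - z)` over `z < X ω` and applying Tonelli
replaces the indicator by `P(X > z) ≤ C * G z`. -/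
lemma lintegral_conv_le {G : ℝ → ℝ} (hG : Antitone G) (hpos : ∀ x, 0 ≤ G x) {X : Ω → ℝ}
    (hX : Measurable X) {C L M : ℝ} (hLM : L ≤ M)
    (hC : ∀ z, L ≤ z → μ.real {ω | z < X ω} ≤ C * G z) (x : ℝ) :
    ∫⁻ ω, ENNReal.ofReal (if L < X ω ∧ X ω ≤ M then ∫ z in L..X ω, G (x - z) else 0) ∂μ ≤
      ENNReal.ofReal (C * ∫ z in L..M, G z * G (x - z)) := by
  have hGm : Measurable fun z => G (x - z) := hG.measurable.comp (by fun_prop)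
  have hmono : Monotone fun z => G (x - z) := fun p q hpq => hG (by linarith)
  calc ∫⁻ ω, ENNReal.ofReal (if L < X ω ∧ X ω ≤ M then ∫ z in L..X ω, G (x - z) else 0) ∂μ
      ≤ ∫⁻ ω, (∫⁻ z in Set.Ioc L M,
          Set.indicator {p : Ω × ℝ | p.2 < X p.1} (fun p => ENNReal.ofReal (G (x - p.2))) (ω, z))
            ∂μ := by
        refine lintegral_mono fun ω => ?_
        split_ifs with h
        · rw [intervalIntegral.integral_of_le h.1.le, ofReal_integral_eq_lintegral_ofReal
            hmono.intervalIntegrable.1 (Eventually.of_forall fun z => hpos _)]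
          rw [← restrict_Ioo_eq_restrict_Ioc]
          rw [← lintegral_indicator measurableSet_Ioo, ← lintegral_indicator measurableSet_Ioc]
          refine lintegral_mono fun z => ?_
          by_cases hz : z ∈ Set.Ioo L (X ω)
          · have hz' : z ∈ Set.Ioc L M := ⟨hz.1, hz.2.le.trans h.2⟩
            simp [Set.indicator_of_mem, hz, hz', hz.2]
          · simp [Set.indicator_of_notMem hz]
        · simp
    _ = ∫⁻ z in Set.Ioc L M, (∫⁻ ω,
          Set.indicator {p : Ω × ℝ | p.2 < X p.1} (fun p => ENNReal.ofReal (G (x - p.2))) (ω, z)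
            ∂μ) := by
        refine lintegral_lintegral_swap (Measurable.aemeasurable ?_)
        refine Measurable.indicator (hGm.comp measurable_snd).ennreal_ofReal ?_
        exact measurableSet_lt measurable_snd (hX.comp measurable_fst)
    _ ≤ ∫⁻ z in Set.Ioc L M, ENNReal.ofReal (C * (G z * G (x - z))) := by
        refine setLIntegral_mono' measurableSet_Ioc fun z hz => ?_
        have : ∀ ω, Set.indicator {p : Ω × ℝ | p.2 < X p.1}
            (fun p => ENNReal.ofReal (G (x - p.2))) (ω, z) =
            Set.indicator {ω | z < X ω} (fun _ => ENNReal.ofReal (G (x - z))) ω := fun ω => by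
          simp [Set.indicator]
        simp only [this]
        rw [lintegral_indicator_const (measurableSet_lt measurable_const hX),
          ← ofReal_measureReal, ← ENNReal.ofReal_mul (hpos _), ← mul_assoc]
        refine ENNReal.ofReal_le_ofReal ?_
        rw [mul_comm]
        exact mul_le_mul_of_nonneg_right (hC z hz.1.le) (hpos _)
    _ = ENNReal.ofReal (C * ∫ z in L..M, G z * G (x - z)) := by
        have hC0 : ∀ z, L ≤ z → 0 ≤ C * G z := fun z hz => measureReal_nonneg.trans (hC z hz)
        rw [← intervalIntegral.integral_const_mul, intervalIntegral.integral_of_le hLM,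
          ofReal_integral_eq_lintegral_ofReal]
        · exact ((antitone_intervalIntegrable_conv hG x L M).const_mul C).1
        · refine (ae_restrict_iff' measurableSet_Ioc).2 (Eventually.of_forall fun z hz => ?_)
          show 0 ≤ C * (G z * G (x - z))
          rw [← mul_assoc]
          exact mul_nonneg (hC0 z hz.1.le) (hpos _)

lemma measurable_integral_comp {φ : ℝ → ℝ} (hφ : ∀ p q, IntervalIntegrable φ volume p q) (L : ℝ)
    {X : Ω → ℝ} (hX : Measurable X) : Measurable fun ω => ∫ z in L..X ω, φ z :=
  (intervalIntegral.continuous_primitive hφ L).measurable.comp hX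

lemma integral_conv_le {G : ℝ → ℝ} (hG : Antitone G) (hpos : ∀ x, 0 ≤ G x) {X : Ω → ℝ}
    (hX : Measurable X) {C L M : ℝ} (hLM : L ≤ M)
    (hC : ∀ z, L ≤ z → μ.real {ω | z < X ω} ≤ C * G z) (x : ℝ) :
    Integrable (fun ω => if L < X ω ∧ X ω ≤ M then ∫ z in L..X ω, G (x - z) else 0) μ ∧
    ∫ ω, (if L < X ω ∧ X ω ≤ M then ∫ z in L..X ω, G (x - z) else 0) ∂μ ≤
      C * ∫ z in L..M, G z * G (x - z) := by
  have hmono : Monotone fun z => G (x - z) := fun p q hpq => hG (by linarith)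
  have h := lintegral_conv_le hG hpos hX hLM hC x
  have hC0 : ∀ z, L ≤ z → 0 ≤ C * G z := fun z hz => measureReal_nonneg.trans (hC z hz)
  have h0 : 0 ≤ C * ∫ z in L..M, G z * G (x - z) := by
    rw [← intervalIntegral.integral_const_mul]
    refine intervalIntegral.integral_nonneg hLM fun z hz => ?_
    rw [← mul_assoc]
    exact mul_nonneg (hC0 z hz.1) (hpos _)
  have hnn : ∀ ω, 0 ≤ (if L < X ω ∧ X ω ≤ M then ∫ z in L..X ω, G (x - z) else 0) := by
    intro ω
    split_ifs with hω
    · exact intervalIntegral.integral_nonneg hω.1.le fun z _ => hpos _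
    · exact le_rfl
  have hm : Measurable fun ω => if L < X ω ∧ X ω ≤ M then ∫ z in L..X ω, G (x - z) else 0 := by
    refine Measurable.ite ?_ (measurable_integral_comp (fun p q => hmono.intervalIntegrable) L hX)
      measurable_const
    exact (measurableSet_lt measurable_const hX).inter (measurableSet_le hX measurable_const)
  refine ⟨⟨hm.aestronglyMeasurable, ?_⟩, ?_⟩
  · rw [hasFiniteIntegral_iff_ofReal (Eventually.of_forall hnn)]
    exact h.trans_lt ENNReal.ofReal_lt_top
  · rw [integral_eq_lintegral_of_nonneg_ae (Eventually.of_forall hnn) hm.aestronglyMeasurable]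
    exact ENNReal.toReal_le_of_le_ofReal h0 h

/-- The one-step inequality: if the walk has mean step `-a` and the expected number of remaining
jumps goes down by one in each step, then the window potential loses at least `φ u` up to the error
caused by the curvature of the primitive of `φ`. -/
lemma lintegral_window_step {φ : ℝ → ℝ} (hφ : Antitone φ) (h0 : ∀ x, 0 ≤ φ x) {a r u U : ℝ}
    (ha : 0 < a) (hr : 0 ≤ r) (hu : U ≤ u) {ξ R' D : Ω → ℝ} (hξ : Integrable ξ μ)
    (hξa : ∫ ω, ξ ω ∂μ = -a) (hR0 : ∀ ω, 0 ≤ R' ω) (hR : Integrable R' μ)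
    (hRr : ∫ ω, R' ω ∂μ = r - 1) (hD0 : ∀ ω, 0 ≤ D ω) (hD : Integrable D μ)
    (hDle : ∀ ω, ξ ω ≤ u - U → (∫ v in (u - ξ ω)..u, φ v) - ξ ω * φ u ≤ D ω) :
    0 ≤ window φ a r u - φ u + 1 / a * ∫ ω, D ω ∂μ ∧
    ∫⁻ ω, ENNReal.ofReal (if ξ ω ≤ u - U then window φ a (R' ω) (u - ξ ω) else 0) ∂μ ≤
      ENNReal.ofReal (window φ a r u - φ u + 1 / a * ∫ ω, D ω ∂μ) := by
  set w := u + a * r with hw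
  have hwu : φ w ≤ φ u := hφ (by nlinarith)
  -- An affine majorant in `ξ` and `R'`, plus `D`. The new upper endpoint `u - ξ + a * R'` has mean
  -- `w`, and the primitive of `φ` is replaced by its tangent at `w`; `D` absorbs the curvature at
  -- the lower endpoint. When `ξ > u - U` every term is nonnegative, so the bound by zero is free.
  set up : Ω → ℝ := fun ω => 1 / a * D ω + 1 / a * (φ u - φ w) * ξ ω +
    (window φ a r u - r * φ w) + φ w * R' ω with hup
  have hupI : Integrable up μ := by
    exact (((hD.const_mul _).add (hξ.const_mul _)).add (integrable_const _)).add (hR.const_mul _)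
  have hrw : r * φ w ≤ window φ a r u := mul_le_window hφ ha r u
  have hpt : ∀ ω, (if ξ ω ≤ u - U then window φ a (R' ω) (u - ξ ω) else 0) ≤ up ω := by
    intro ω
    split_ifs with h
    · have hii : ∀ p q : ℝ, IntervalIntegrable φ volume p q := fun p q => hφ.intervalIntegrable
      have e1 := intervalIntegral.integral_add_adjacent_intervals (hii (u - ξ ω) u)
        (hii u (u - ξ ω + a * R' ω))
      have e2 := intervalIntegral.integral_add_adjacent_intervals (hii u w)
        (hii w (u - ξ ω + a * R' ω))
      have e3 := hφ.integral_le_mul w (u - ξ ω + a * R' ω)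
      have e4 := hDle ω h
      rw [← mul_window ha] at e1
      have e5 : ∫ v in u..w, φ v = a * window φ a r u := (mul_window ha).symm
      refine le_of_mul_le_mul_left ?_ ha
      have e6 : a * up ω = D ω + (φ u - φ w) * ξ ω + a * (window φ a r u - r * φ w) +
          a * φ w * R' ω := by
        rw [hup]; field_simp
      rw [e6, ← e1, ← e2, e5]
      rw [hw] at e3 ⊢
      nlinarith
    · push Not at h
      have hξ0 : 0 ≤ ξ ω := by linarith
      have a1 : 0 ≤ 1 / a * D ω := mul_nonneg (by positivity) (hD0 ω)
      have a2 : 0 ≤ 1 / a * (φ u - φ w) * ξ ω :=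
        mul_nonneg (mul_nonneg (by positivity) (by linarith)) hξ0
      have a3 : 0 ≤ φ w * R' ω := mul_nonneg (h0 _) (hR0 ω)
      simp only [hup]
      linarith
  have hup0 : ∀ ω, 0 ≤ up ω := fun ω => by
    refine le_trans ?_ (hpt ω)
    split_ifs
    · exact window_nonneg h0 ha (hR0 ω)
    · exact le_rfl
  have hupE : ∫ ω, up ω ∂μ = window φ a r u - φ u + 1 / a * ∫ ω, D ω ∂μ := by
    have I1 : Integrable (fun ω => 1 / a * D ω) μ := hD.const_mul _
    have I2 : Integrable (fun ω => 1 / a * (φ u - φ w) * ξ ω) μ := hξ.const_mul _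
    have I4 : Integrable (fun ω => φ w * R' ω) μ := hR.const_mul _
    have J1 := integral_add I1 I2
    have J2 := integral_add (I1.add I2) (integrable_const (window φ a r u - r * φ w))
    have J3 := integral_add ((I1.add I2).add (integrable_const (window φ a r u - r * φ w))) I4
    simp only [Pi.add_apply] at J1 J2 J3
    rw [hup, J3, J2, J1, integral_const_mul, integral_const_mul, integral_const_mul,
      integral_const, hξa, hRr]
    simp
    field_simp
    ring
  refine ⟨hupE ▸ integral_nonneg hup0, ?_⟩
  rw [← hupE, ofReal_integral_eq_lintegral_ofReal hupI (Eventually.of_forall hup0)]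
  exact lintegral_mono fun ω => ENNReal.ofReal_le_ofReal (hpt ω)

end Conv

/-! ### Tail of a sum with a lighter summand; control of the curvature error. -/

section Tails

variable {Ω : Type*} [MeasurableSpace Ω] {μ : Measure Ω} [IsProbabilityMeasure μ]

lemma ProbabilityTheory.IndepFun.lintegral_comp_eq {α β : Type*} [MeasurableSpace α]
    [MeasurableSpace β] {X : Ω → α} {Z : Ω → β} (h : IndepFun X Z μ) (hX : Measurable X)
    (hZ : Measurable Z) {f : α × β → ENNReal} (hf : Measurable f) :
    ∫⁻ ω, f (X ω, Z ω) ∂μ = ∫⁻ ω, (∫⁻ ω', f (X ω, Z ω') ∂μ) ∂μ := by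
  have h1 := (indepFun_iff_map_prod_eq_prod_map_map hX.aemeasurable hZ.aemeasurable).1 h
  have h2 : ∫⁻ ω, f (X ω, Z ω) ∂μ = ∫⁻ p, f p ∂(μ.map fun ω => (X ω, Z ω)) :=
    (lintegral_map hf (hX.prodMk hZ)).symm
  have := Measure.isProbabilityMeasure_map (μ := μ) hZ.aemeasurable
  rw [h2, h1, lintegral_prod _ hf.aemeasurable, lintegral_map hf.lintegral_prod_right' hX]
  refine lintegral_congr fun ω => ?_
  rw [lintegral_map (by fun_prop) hZ]

lemma IsStrongTail.exists_le_mul {G : ℝ → ℝ} (hG : IsStrongTail G) {p : ℝ → ℝ}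
    (hp : ∀ x, p x ≤ 1) {K x₀ : ℝ} (h : ∀ x, x₀ ≤ x → p x ≤ K * G x) :
    ∃ C, 0 < C ∧ ∀ x, p x ≤ C * G x := by
  refine ⟨max K (1 / G x₀), lt_max_of_lt_right (one_div_pos.2 (hG.pos _)), fun x => ?_⟩
  rcases le_total x₀ x with hx | hx
  · exact (h x hx).trans (mul_le_mul_of_nonneg_right (le_max_left _ _) (hG.pos x).le)
  · calc p x ≤ 1 := hp x
      _ = 1 / G x₀ * G x₀ := by field_simp [(hG.pos x₀).ne']
      _ ≤ max K (1 / G x₀) * G x := by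
        have := hG.pos x₀
        exact mul_le_mul (le_max_right _ _) (hG.antitone hx) (hG.pos _).le
          (le_max_of_le_right (by positivity))

/-- Adding an independent nonnegative variable with a lighter tail does not increase the tail by
more than a factor close to one. -/
lemma IsStrongTail.tail_add_le {G : ℝ → ℝ} (hG : IsStrongTail G) {Y θ : Ω → ℝ}
    (hY : Measurable Y) (hθ : Measurable θ) (hind : IndepFun θ Y μ)
    (hYG : ∀ x, μ.real {ω | x < Y ω} ≤ G x)
    (hθG : ∀ ε : ℝ, 0 < ε → ∃ x₀, ∀ x, x₀ ≤ x → μ.real {ω | x < θ ω} ≤ ε * G x)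
    {ε : ℝ} (hε : 0 < ε) :
    ∃ x₀, ∀ u, x₀ ≤ u → μ.real {ω | u < Y ω + θ ω} ≤ (1 + ε) * G u := by
  obtain ⟨x₁, hx₁⟩ := hθG 1 one_pos
  obtain ⟨C, hC0, hC⟩ := hG.exists_le_mul (p := fun x => μ.real {ω | x < θ ω})
    (fun x => measureReal_le_one) hx₁
  set e := min ε 1 / 5 with he
  have he0 : 0 < e := by positivity
  have he1 : e ≤ 1 / 5 := by rw [he]; linarith [min_le_right ε 1]
  have he2 : 5 * e ≤ ε := by rw [he]; linarith [min_le_left ε 1]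
  obtain ⟨L, x₂, hL0, hL⟩ := hG.conv (e / C) (by positivity)
  -- The extra unit permits bounding the value `G (u - θ)` by the integral of `G (u - 1 - z)` over
  -- `[θ - 1, θ]`, so that the convolution estimate applies at `u - 1`.
  set h := L + 1 with hh
  obtain ⟨x₃, hx₃⟩ := hθG e he0
  obtain ⟨U, hU⟩ := hG.long_tailed h e he0
  refine ⟨max (max (x₂ + 1) (x₃ + h)) (max (U + h) (2 * h)), fun u hu => ?_⟩
  simp only [max_le_iff] at hu
  obtain ⟨⟨hu2, hu3⟩, huU, huh⟩ := hu
  have hflat : G (u - h) ≤ (1 + e) * G u := by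
    have := hU (u - h) (by linarith)
    rwa [sub_add_cancel] at this
  have hsub : {ω | u < Y ω + θ ω} ⊆ {ω | u - h < Y ω} ∪ {ω | u - h < θ ω} ∪
      {ω | (h < θ ω ∧ θ ω ≤ u - h) ∧ u - θ ω < Y ω} := by
    intro ω hω
    simp only [Set.mem_union, Set.mem_ofPred_eq] at hω ⊢
    by_cases k1 : u - h < Y ω
    · simp [k1]
    by_cases k2 : u - h < θ ω
    · simp [k2]
    right
    push Not at k1 k2
    exact ⟨⟨by linarith, k2⟩, by linarith⟩
  have hthird : μ.real {ω | (h < θ ω ∧ θ ω ≤ u - h) ∧ u - θ ω < Y ω} ≤ e * G (u - 1) := by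
    have hS : MeasurableSet {p : ℝ × ℝ | (h < p.1 ∧ p.1 ≤ u - h) ∧ u - p.1 < p.2} := by
      refine ((measurableSet_lt measurable_const measurable_fst).inter
        (measurableSet_le measurable_fst measurable_const)).inter
        (measurableSet_lt (measurable_const.sub measurable_fst) measurable_snd)
    have h1 := hind.lintegral_comp_eq hθ hY (f := Set.indicator
      {p : ℝ × ℝ | (h < p.1 ∧ p.1 ≤ u - h) ∧ u - p.1 < p.2} fun _ => 1)
      (measurable_const.indicator hS)
    have h2 : ∫⁻ ω, Set.indicator {p : ℝ × ℝ | (h < p.1 ∧ p.1 ≤ u - h) ∧ u - p.1 < p.2}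
        (fun _ => (1 : ENNReal)) (θ ω, Y ω) ∂μ =
        μ {ω | (h < θ ω ∧ θ ω ≤ u - h) ∧ u - θ ω < Y ω} := by
      have hS' : MeasurableSet {ω | (h < θ ω ∧ θ ω ≤ u - h) ∧ u - θ ω < Y ω} :=
        (hθ.prodMk hY) hS
      rw [← lintegral_indicator_one hS']
      rfl
    have h3 := lintegral_conv_le (μ := μ) hG.antitone (fun x => (hG.pos x).le) hθ (L := L)
      (M := u - 1 - L) (by linarith) (fun z _ => hC z) (u - 1)
    have h4 := hL L le_rfl (u - 1) (by linarith) (by linarith)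
    have h5 : μ {ω | (h < θ ω ∧ θ ω ≤ u - h) ∧ u - θ ω < Y ω} ≤
        ENNReal.ofReal (e * G (u - 1)) := by
      rw [← h2, h1]
      refine le_trans ?_ (h3.trans (ENNReal.ofReal_le_ofReal ?_))
      · refine lintegral_mono fun ω => ?_
        by_cases hω : h < θ ω ∧ θ ω ≤ u - h
        · have c1 : L < θ ω ∧ θ ω ≤ u - 1 - L := ⟨by linarith [hω.1], by linarith [hω.2]⟩
          have c2 : ∀ ω', Set.indicator {p : ℝ × ℝ | (h < p.1 ∧ p.1 ≤ u - h) ∧ u - p.1 < p.2}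
              (fun _ => (1 : ENNReal)) (θ ω, Y ω') =
              Set.indicator {ω' | u - θ ω < Y ω'} 1 ω' := fun ω' => by
            simp [Set.indicator, hω]
          simp only [c2]
          rw [lintegral_indicator_one (measurableSet_lt measurable_const hY), if_pos c1,
            ← ofReal_measureReal]
          refine ENNReal.ofReal_le_ofReal ((hYG _).trans ?_)
          have hmono : Monotone fun z => G (u - 1 - z) := fun p q hpq =>
            hG.antitone (by linarith)
          calc G (u - θ ω) = ∫ z in (θ ω - 1)..θ ω, G (u - θ ω) := by simp
            _ ≤ ∫ z in (θ ω - 1)..θ ω, G (u - 1 - z) :=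
              intervalIntegral.integral_mono_on (by linarith) (by simp) hmono.intervalIntegrable
                fun z hz => hG.antitone (by linarith [hz.1])
            _ ≤ ∫ z in L..θ ω, G (u - 1 - z) :=
              intervalIntegral.integral_mono_interval (by linarith [hω.1]) (by linarith) le_rfl
                (Eventually.of_forall fun z => (hG.pos _).le) hmono.intervalIntegrable
        · have c2 : ∀ ω', Set.indicator {p : ℝ × ℝ | (h < p.1 ∧ p.1 ≤ u - h) ∧ u - p.1 < p.2}
              (fun _ => (1 : ENNReal)) (θ ω, Y ω') = 0 := fun ω' => by
            simp only [Set.indicator, Set.mem_ofPred_eq, hω, false_and, if_false]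
          simp [c2]
      · calc C * ∫ z in L..(u - 1 - L), G z * G (u - 1 - z) ≤ C * (e / C * G (u - 1)) :=
              mul_le_mul_of_nonneg_left h4 hC0.le
          _ = e * G (u - 1) := by field_simp
    exact ENNReal.toReal_le_of_le_ofReal (mul_nonneg he0.le (hG.pos _).le) h5
  have h1 : G (u - 1) ≤ G (u - h) := hG.antitone (by linarith)
  have k1 := hYG (u - h)
  have k2 := hx₃ (u - h) (by linarith)
  have k3 := (measureReal_mono hsub (measure_ne_top μ _)).trans
    ((measureReal_union_le _ _).trans (add_le_add_left (measureReal_union_le _ _) _))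
  have k4 : 0 < G u := hG.pos u
  have k5 : e * G (u - 1) ≤ e * G (u - h) := mul_le_mul_of_nonneg_left h1 he0.le
  have k6 : (1 + 2 * e) * G (u - h) ≤ (1 + 2 * e) * ((1 + e) * G u) :=
    mul_le_mul_of_nonneg_left hflat (by linarith)
  have k7 : (1 + 2 * e) * (1 + e) * G u ≤ (1 + ε) * G u :=
    mul_le_mul_of_nonneg_right (by nlinarith) k4.le
  linarith

/-- A dominating function for the curvature error in the one-step inequality. -/
lemma exists_curvature_bound {G φ : ℝ → ℝ} (hG : IsStrongTail G) (hφ : Antitone φ)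
    (h0 : ∀ x, 0 ≤ φ x) {κ : ℝ} (hφκ : ∀ x, φ x ≤ κ * G x) {ξ : Ω → ℝ} (hξm : Measurable ξ)
    (hξ : Integrable ξ μ) {C L U u ε₁ ε₂ ε₃ : ℝ} (hC : ∀ z, L ≤ z → μ.real {ω | z < ξ ω} ≤ C * G z)
    (hL : 0 ≤ L) (hC0 : 0 ≤ C) (hLU : L ≤ U) (hUu : U ≤ u) (hε₁ : 0 ≤ ε₁) (hε₂ : 0 ≤ ε₂)
    (hflat : ∀ w, U ≤ w → φ w ≤ (1 + ε₁) * φ (w + L))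
    (hconv : L ≤ u - L → ∫ z in L..(u - L), G z * G (u - z) ≤ ε₂ * G u)
    (hneg : ∫ ω, (if ξ ω < -L then -ξ ω else 0) ∂μ ≤ ε₃) :
    ∃ D : Ω → ℝ, (∀ ω, 0 ≤ D ω) ∧ Integrable D μ ∧
      (∀ ω, ξ ω ≤ u - U → (∫ v in (u - ξ ω)..u, φ v) - ξ ω * φ u ≤ D ω) ∧
      ∫ ω, D ω ∂μ ≤ (ε₃ + L * ε₁) * φ u + κ * C * ε₂ * G u := by
  have hκ : 0 ≤ κ := by
    by_contra hκ
    have := (h0 0).trans (hφκ 0)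
    have := hG.pos 0
    nlinarith
  have hii : ∀ p q : ℝ, IntervalIntegrable φ volume p q := fun p q => hφ.intervalIntegrable
  have hmono : Monotone fun z => G (u - z) := fun p q hpq => hG.antitone (by linarith)
  -- Three ranges of the step. For `ξ < -L` the error is at most `-ξ * φ u`, of small mean. For `|ξ|
  -- ≤ L` flatness gives `L * ε₁ * φ u`. For `L < ξ` the piece within `L` of `u` is again flat, and
  -- the rest is at most `κ * B`, whose mean is a convolution integral.
  set A : Ω → ℝ := fun ω => if ξ ω < -L then -ξ ω else 0 with hA
  set B : Ω → ℝ := fun ω => if L < ξ ω ∧ ξ ω ≤ u - L then ∫ z in L..ξ ω, G (u - z) else 0 with hB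
  have hA0 : ∀ ω, 0 ≤ A ω := fun ω => by
    simp only [hA]; split_ifs <;> linarith
  have hB0 : ∀ ω, 0 ≤ B ω := fun ω => by
    simp only [hB]; split_ifs with h
    · exact intervalIntegral.integral_nonneg h.1.le fun z _ => (hG.pos _).le
    · exact le_rfl
  have hAI : Integrable A μ := by
    refine hξ.mono ?_ (Eventually.of_forall fun ω => ?_)
    · exact (Measurable.ite (measurableSet_lt hξm measurable_const) hξm.neg
        measurable_const).aestronglyMeasurable
    · simp only [hA]; split_ifs <;> simp
  have hBI : Integrable B μ ∧ ∫ ω, B ω ∂μ ≤ C * (ε₂ * G u) := by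
    by_cases h : L ≤ u - L
    · have := integral_conv_le hG.antitone (fun x => (hG.pos x).le) hξm h hC u
      exact ⟨this.1, this.2.trans (mul_le_mul_of_nonneg_left (hconv h) hC0)⟩
    · have : B = 0 := by
        ext ω
        simp only [hB, Pi.zero_apply]
        rw [if_neg]
        rintro ⟨h1, h2⟩
        exact h (h1.le.trans h2)
      rw [this]
      refine ⟨integrable_zero _ _ _, ?_⟩
      simp only [Pi.zero_apply, integral_zero]
      have := hG.pos u
      positivity
  refine ⟨fun ω => A ω * φ u + L * ε₁ * φ u + κ * B ω, fun ω => ?_, ?_, fun ω hω => ?_, ?_⟩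
  · have := h0 u; have := hA0 ω; have := hB0 ω
    positivity
  · exact ((hAI.mul_const _).add (integrable_const _)).add (hBI.1.const_mul _)
  · have hφu := h0 u
    have hAω := mul_nonneg (hA0 ω) hφu
    have hBω := mul_nonneg hκ (hB0 ω)
    have hLε : 0 ≤ L * ε₁ * φ u := by positivity
    rcases lt_or_ge (ξ ω) 0 with hneg0 | hpos0
    · have e1 := hφ.integral_le_mul (u - ξ ω) u
      rw [show u - (u - ξ ω) = ξ ω by ring] at e1
      by_cases hc : ξ ω < -L
      · have : A ω = -ξ ω := by simp only [hA, if_pos hc]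
        have := h0 (u - ξ ω)
        show _ ≤ A ω * φ u + L * ε₁ * φ u + κ * B ω
        nlinarith
      · push Not at hc
        have e2 : φ (u + L) ≤ φ (u - ξ ω) := hφ (by linarith)
        have e3 := hflat u hUu
        have e4 : φ (u + L) ≤ φ u := hφ (by linarith)
        show _ ≤ A ω * φ u + L * ε₁ * φ u + κ * B ω
        have e5 : φ u - φ (u - ξ ω) ≤ ε₁ * φ u := by nlinarith
        have e6 : -ξ ω * (φ u - φ (u - ξ ω)) ≤ -ξ ω * (ε₁ * φ u) :=
          mul_le_mul_of_nonneg_left e5 (by linarith)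
        have e7 : -ξ ω * (ε₁ * φ u) ≤ L * (ε₁ * φ u) :=
          mul_le_mul_of_nonneg_right (by linarith) (by positivity)
        linarith
    · have hflat' : ∀ z, 0 ≤ z → z ≤ L → U ≤ u - z → φ (u - z) ≤ (1 + ε₁) * φ u := by
        intro z hz hzL hzU
        have := hflat (u - z) hzU
        have e : φ (u - z + L) ≤ φ u := hφ (by linarith)
        nlinarith
      show _ ≤ A ω * φ u + L * ε₁ * φ u + κ * B ω
      rcases le_or_gt (ξ ω) L with hc | hc
      · have e1 := hφ.integral_le_mul (u - ξ ω) u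
        rw [show u - (u - ξ ω) = ξ ω by ring] at e1
        have e2 := hflat' (ξ ω) hpos0 hc (by linarith)
        have e3 : ξ ω * φ (u - ξ ω) ≤ ξ ω * ((1 + ε₁) * φ u) :=
          mul_le_mul_of_nonneg_left e2 hpos0
        have e4 : ξ ω * (ε₁ * φ u) ≤ L * (ε₁ * φ u) :=
          mul_le_mul_of_nonneg_right hc (by positivity)
        linarith
      · have hBe : B ω = ∫ z in L..ξ ω, G (u - z) := by
          simp only [hB]; rw [if_pos ⟨hc, by linarith⟩]
        have e0 := intervalIntegral.integral_add_adjacent_intervals (hii (u - ξ ω) (u - L))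
          (hii (u - L) u)
        have e1 := hφ.integral_le_mul (u - L) u
        rw [show u - (u - L) = L by ring] at e1
        have e2 := hflat' L hL le_rfl (by linarith)
        have e3 : L * φ (u - L) ≤ L * ((1 + ε₁) * φ u) := mul_le_mul_of_nonneg_left e2 hL
        have e4 : ∫ v in (u - ξ ω)..(u - L), φ v ≤ κ * B ω := by
          rw [hBe, ← intervalIntegral.integral_comp_sub_left (fun v => φ v) u,
            ← intervalIntegral.integral_const_mul]
          have hmφ : Monotone fun z => φ (u - z) := fun p q hpq => hφ (by linarith)
          exact intervalIntegral.integral_mono_on hc.le hmφ.intervalIntegrable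
            (hmono.intervalIntegrable.const_mul _) fun z _ => hφκ _
        have e5 : L * φ u ≤ ξ ω * φ u := mul_le_mul_of_nonneg_right hc.le hφu
        linarith
  · have J1 := integral_add ((hAI.mul_const (φ u)).add (integrable_const (L * ε₁ * φ u)))
      (hBI.1.const_mul κ)
    have J2 := integral_add (hAI.mul_const (φ u)) (integrable_const (L * ε₁ * φ u))
    simp only [Pi.add_apply] at J1 J2
    rw [J1, J2, integral_mul_const, integral_const_mul κ B, integral_const]
    simp only [probReal_univ, one_smul]
    have := mul_le_mul_of_nonneg_left hBI.2 hκ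
    have := mul_le_mul_of_nonneg_right hneg (h0 u)
    linarith

end Tails

lemma tendsto_integral_neg_part {Ω : Type*} [MeasurableSpace Ω] {μ : Measure Ω} {ξ : Ω → ℝ} (hξm : Measurable ξ) (hξ : Integrable ξ μ) :
    Tendsto (fun L : ℝ => ∫ ω, (if ξ ω < -L then -ξ ω else 0) ∂μ) atTop (nhds 0) := by
  have h := tendsto_integral_filter_of_dominated_convergence (μ := μ) (l := atTop)
    (F := fun (L : ℝ) ω => if ξ ω < -L then -ξ ω else 0) (f := fun _ => 0) (fun ω => |ξ ω|)
    (Eventually.of_forall fun L => (Measurable.ite (measurableSet_lt hξm measurable_const) hξm.neg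
        measurable_const).aestronglyMeasurable)
    (Eventually.of_forall fun L => Eventually.of_forall fun ω => by split_ifs <;> simp)
    hξ.abs (Eventually.of_forall fun ω => ?_)
  · simpa using h
  · refine tendsto_const_nhds.congr' ?_
    filter_upwards [eventually_ge_atTop (-ξ ω)] with L hL
    rw [if_neg (by linarith)]

/-! ### A uniform consequence of the strong law of large numbers. -/

section LawOfLargeNumbers

variable {Ω : Type*} [MeasurableSpace Ω] {μ : Measure Ω} [IsProbabilityMeasure μ]

/-- With high probability, a random walk stays above a line of slightly smaller slope. -/
lemma exists_walk_ge {ζ : ℕ → Ω → ℝ} (hm : ∀ n, Measurable (ζ n)) (hind : iIndepFun ζ μ)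
    (hid : ∀ n, IdentDistrib (ζ n) (ζ 0) μ μ) (hint : Integrable (ζ 0) μ) {δ ε : ℝ} (hδ : 0 < δ)
    (hε : 0 < ε) :
    ∃ R : ℝ, 0 ≤ R ∧ μ.real {ω | ∃ n : ℕ, ∑ i ∈ Finset.range n, ζ i ω <
      (∫ ω, ζ 0 ω ∂μ - δ) * n - R} ≤ ε := by
  set m := ∫ ω, ζ 0 ω ∂μ with hmdef
  set B : ℕ → Set Ω := fun R => {ω | ∃ n : ℕ, ∑ i ∈ Finset.range n, ζ i ω < (m - δ) * n - R}
  have hslln := strong_law_ae_real ζ hint (fun i j hij => hind.indepFun hij) hid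
  have hBm : ∀ R, MeasurableSet (B R) := fun R => by
    have : B R = ⋃ n : ℕ, {ω | ∑ i ∈ Finset.range n, ζ i ω < (m - δ) * n - R} := by
      ext ω; simp [B]
    rw [this]
    exact MeasurableSet.iUnion fun n => measurableSet_lt
      (Finset.measurable_sum _ fun i _ => hm i) measurable_const
  have hanti : Antitone B := fun R S hRS ω ⟨n, hn⟩ =>
    ⟨n, hn.trans_le (by have : (R : ℝ) ≤ S := by exact_mod_cast hRS
                        linarith)⟩
  have hlim := tendsto_measure_iInter_atTop (μ := μ) (fun R => (hBm R).nullMeasurableSet) hanti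
    ⟨0, measure_ne_top μ _⟩
  -- By the strong law only finitely many partial sums fall below the line, and a large enough `R`
  -- absorbs these.
  have hnull : μ (⋂ R, B R) = 0 := by
    refine measure_eq_zero_iff_ae_notMem.2 ?_
    filter_upwards [hslln] with ω hω hmem
    have h1 := hω.eventually (eventually_gt_nhds (show m - δ < m by linarith))
    obtain ⟨N, hN⟩ := eventually_atTop.1 h1
    set x : ℕ → ℝ := fun n => |∑ i ∈ Finset.range n, ζ i ω - (m - δ) * n|
    obtain ⟨R, hR⟩ := exists_nat_ge (∑ n ∈ Finset.range (N + 1), x n)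
    obtain ⟨n, hn⟩ := Set.mem_iInter.1 hmem R
    have hR0 : (0 : ℝ) ≤ R := Nat.cast_nonneg R
    rcases lt_or_ge n (N + 1) with hlt | hge
    · have h2 : x n ≤ ∑ n ∈ Finset.range (N + 1), x n :=
        Finset.single_le_sum (f := x) (fun i _ => abs_nonneg _) (Finset.mem_range.2 hlt)
      have h3 := neg_abs_le (∑ i ∈ Finset.range n, ζ i ω - (m - δ) * n)
      simp only [x] at h2
      linarith
    · have h2 := hN n (by omega)
      have hn0 : (0 : ℝ) < n := by exact_mod_cast (by omega : 0 < n)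
      rw [lt_div_iff₀ hn0] at h2
      linarith
  rw [hnull] at hlim
  have h2 := (ENNReal.tendsto_toReal ENNReal.zero_ne_top).comp hlim
  obtain ⟨R, hR⟩ := (h2.eventually (eventually_le_nhds (show (0 : ENNReal).toReal < ε by
    simpa using hε))).exists
  exact ⟨R, Nat.cast_nonneg R, hR⟩

end LawOfLargeNumbers

/-! ### Renewal theory of the jump epochs. -/

namespace CompoundRenewal

variable {Ω : Type*} [MeasurableSpace Ω] {μ : Measure Ω} [IsProbabilityMeasure μ]
  {τ Y : ℕ → Ω → ℝ}

/-- The distribution function of the `n`-th jump epoch. -/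
noncomputable def epochCdf (μ : Measure Ω) (τ : ℕ → Ω → ℝ) (n : ℕ) (s : ℝ) : ℝ :=
  μ.real {ω | epoch τ n ω ≤ s}

/-- The renewal function, counting the renewal at time zero. -/
noncomputable def renewal (μ : Measure Ω) (τ : ℕ → Ω → ℝ) (s : ℝ) : ℝ :=
  ∑' n, epochCdf μ τ n s

/-- The mean number of jumps up to time `s`. -/
noncomputable def meanCount (μ : Measure Ω) (τ : ℕ → Ω → ℝ) (s : ℝ) : ℝ :=
  ∑' n, epochCdf μ τ (n + 1) s

lemma epochCdf_nonneg (n : ℕ) (s : ℝ) : 0 ≤ epochCdf μ τ n s := measureReal_nonneg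

lemma epochCdf_le_one (n : ℕ) (s : ℝ) : epochCdf μ τ n s ≤ 1 := measureReal_le_one

lemma epochCdf_mono (n : ℕ) : Monotone (epochCdf μ τ n) := fun _ _ h =>
  measureReal_mono fun _ hω => le_trans hω h

lemma epoch_succ (n : ℕ) (ω : Ω) : epoch τ (n + 1) ω = epoch τ n ω + τ n ω :=
  Finset.sum_range_succ _ _

@[simp] lemma epoch_zero (ω : Ω) : epoch τ 0 ω = 0 := rfl

namespace IsInput

variable (h : IsInput μ τ Y)
include h

lemma measurable_epoch (n : ℕ) : Measurable (epoch τ n) :=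
  Finset.measurable_sum _ fun i _ => h.measurable_tau i

lemma ae_tau_pos : ∀ᵐ ω ∂μ, ∀ n, 0 < τ n ω := ae_all_iff.2 h.tau_pos

lemma epochCdf_of_neg (n : ℕ) {s : ℝ} (hs : s < 0) : epochCdf μ τ n s = 0 := by
  rw [epochCdf, measureReal_eq_zero_iff, measure_eq_zero_iff_ae_notMem]
  filter_upwards [h.ae_tau_pos] with ω hω hmem
  have : 0 ≤ epoch τ n ω := Finset.sum_nonneg fun i _ => (hω i).le
  exact absurd (hmem : epoch τ n ω ≤ s) (by linarith)

lemma epochCdf_zero {s : ℝ} (hs : 0 ≤ s) : epochCdf μ τ 0 s = 1 := by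
  simp [epochCdf, hs]

lemma epochCdf_anti (s : ℝ) : Antitone fun n => epochCdf μ τ n s := by
  refine antitone_nat_of_succ_le fun n => ?_
  refine ENNReal.toReal_mono (measure_ne_top _ _) (measure_mono_ae ?_)
  filter_upwards [h.tau_pos n] with ω hω hmem
  have h1 : epoch τ (n + 1) ω ≤ s := hmem
  rw [epoch_succ] at h1
  show epoch τ n ω ≤ s
  linarith

lemma indepFun_tau_epoch (n : ℕ) : IndepFun (τ n) (epoch τ n) μ := by
  have h1 := h.indep_tau.indepFun_finsetSum_of_notMem h.measurable_tau
    (s := Finset.range n) (i := n) (by simp)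
  have e : (∑ j ∈ Finset.range n, τ j) = epoch τ n := by
    ext ω; simp [epoch]
  rw [e] at h1
  exact h1.symm

lemma measurable_epochCdf_comp (n : ℕ) (s : ℝ) :
    Measurable fun ω => epochCdf μ τ n (s - τ 0 ω) :=
  (epochCdf_mono n).measurable.comp (measurable_const.sub (h.measurable_tau 0))

lemma integrable_epochCdf_comp (n : ℕ) (s : ℝ) :
    Integrable (fun ω => epochCdf μ τ n (s - τ 0 ω)) μ :=
  Integrable.of_bound (h.measurable_epochCdf_comp n s).aestronglyMeasurable 1
    (Eventually.of_forall fun ω => by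
      rw [Real.norm_of_nonneg (epochCdf_nonneg _ _)]; exact epochCdf_le_one _ _)

/-- The convolution recursion for the distributions of the jump epochs. -/
lemma epochCdf_succ (n : ℕ) (s : ℝ) :
    epochCdf μ τ (n + 1) s = ∫ ω, epochCdf μ τ n (s - τ 0 ω) ∂μ := by
  have hS : MeasurableSet {p : ℝ × ℝ | p.2 ≤ s - p.1} :=
    measurableSet_le measurable_snd (measurable_const.sub measurable_fst)
  have h1 := (h.indepFun_tau_epoch n).lintegral_comp_eq (h.measurable_tau n) (h.measurable_epoch n)
    (f := Set.indicator {p : ℝ × ℝ | p.2 ≤ s - p.1} 1) (measurable_one.indicator hS)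
  have h2 : ∫⁻ ω, Set.indicator {p : ℝ × ℝ | p.2 ≤ s - p.1} (1 : ℝ × ℝ → ENNReal)
      (τ n ω, epoch τ n ω) ∂μ = μ {ω | epoch τ (n + 1) ω ≤ s} := by
    rw [← lintegral_indicator_one (measurableSet_le (h.measurable_epoch _) measurable_const)]
    refine lintegral_congr fun ω => ?_
    simp only [Set.indicator, Set.mem_ofPred_eq, epoch_succ, le_sub_iff_add_le]
    rfl
  have h3 : ∀ ω, ∫⁻ ω', Set.indicator {p : ℝ × ℝ | p.2 ≤ s - p.1} (1 : ℝ × ℝ → ENNReal)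
      (τ n ω, epoch τ n ω') ∂μ = ENNReal.ofReal (epochCdf μ τ n (s - τ n ω)) := by
    intro ω
    rw [epochCdf, ofReal_measureReal,
      ← lintegral_indicator_one (measurableSet_le (h.measurable_epoch _) measurable_const)]
    rfl
  have hm : Measurable fun x => ENNReal.ofReal (epochCdf μ τ n (s - x)) :=
    ((epochCdf_mono n).measurable.comp (measurable_const.sub measurable_id)).ennreal_ofReal
  have h4 : ∫⁻ ω, ENNReal.ofReal (epochCdf μ τ n (s - τ n ω)) ∂μ =
      ∫⁻ ω, ENNReal.ofReal (epochCdf μ τ n (s - τ 0 ω)) ∂μ :=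
    ((h.identDistrib_tau n).comp hm).lintegral_eq
  rw [h2] at h1
  simp only [h3] at h1
  rw [h4] at h1
  rw [epochCdf, measureReal_def, h1, integral_eq_lintegral_of_nonneg_ae
    (Eventually.of_forall fun ω => epochCdf_nonneg _ _)
    (h.measurable_epochCdf_comp n s).aestronglyMeasurable]

/-- The first `n` and the next `k` interarrival times must each sum to at most `s`. This
submultiplicativity gives summability and controls the tail of the series for `meanCount`. -/
lemma epochCdf_add_le (n k : ℕ) (s : ℝ) :
    epochCdf μ τ (n + k) s ≤ epochCdf μ τ n s * epochCdf μ τ k s := by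
  induction k generalizing s with
  | zero =>
    rcases lt_or_ge s 0 with hs | hs
    · simp [h.epochCdf_of_neg _ hs]
    · simp [h.epochCdf_zero hs]
  | succ k ih =>
    rw [← add_assoc, h.epochCdf_succ, h.epochCdf_succ k, ← integral_const_mul]
    refine integral_mono_ae (h.integrable_epochCdf_comp _ _)
      ((h.integrable_epochCdf_comp _ _).const_mul _) ?_
    filter_upwards [h.tau_pos 0] with ω hω
    exact (ih _).trans (mul_le_mul_of_nonneg_right (epochCdf_mono n (by linarith))
      (epochCdf_nonneg _ _))

/-- A self-bounding inequality: when `epochCdf μ τ n₀ s < 1` it can be solved for the partial sum,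
with a bound independent of `J`. -/
lemma sum_epochCdf_le (n₀ J : ℕ) (s : ℝ) :
    ∑ n ∈ Finset.range J, epochCdf μ τ (n + 1) s ≤
      n₀ + epochCdf μ τ n₀ s * ∑ n ∈ Finset.range J, epochCdf μ τ (n + 1) s := by
  calc ∑ n ∈ Finset.range J, epochCdf μ τ (n + 1) s
      ≤ ∑ n ∈ Finset.range (n₀ + J), epochCdf μ τ (n + 1) s :=
        Finset.sum_le_sum_of_subset_of_nonneg (Finset.range_mono (by omega))
          fun _ _ _ => epochCdf_nonneg _ _
    _ = ∑ n ∈ Finset.range n₀, epochCdf μ τ (n + 1) s +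
          ∑ n ∈ Finset.range J, epochCdf μ τ (n₀ + (n + 1)) s := by
        rw [Finset.sum_range_add]; simp only [add_assoc]
    _ ≤ _ := by
        refine add_le_add ?_ ?_
        · calc ∑ n ∈ Finset.range n₀, epochCdf μ τ (n + 1) s
              ≤ ∑ n ∈ Finset.range n₀, (1 : ℝ) := Finset.sum_le_sum fun _ _ => epochCdf_le_one _ _
            _ = n₀ := by simp
        · rw [Finset.mul_sum]
          exact Finset.sum_le_sum fun n _ => h.epochCdf_add_le _ _ _

lemma mean_tau_pos : 0 < ∫ ω, τ 0 ω ∂μ := by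
  have h0 : 0 ≤ᵐ[μ] τ 0 := (h.tau_pos 0).mono fun _ => le_of_lt
  refine (integral_nonneg_of_ae h0).lt_of_ne' fun h1 => ?_
  rw [integral_eq_zero_iff_of_nonneg_ae h0 h.integrable_tau] at h1
  obtain ⟨ω, h2, h3⟩ := ((h.tau_pos 0).and h1).exists
  exact h2.ne' h3

/-- The `n`-th jump epoch is unlikely to come before time `t` if `n` is much larger than `t`. -/
lemma exists_epochCdf_le {δ ε : ℝ} (hδ : 0 < δ) (hε : 0 < ε) : ∃ R : ℝ, 0 ≤ R ∧
    ∀ (n : ℕ) (t : ℝ), t < (∫ ω, τ 0 ω ∂μ - δ) * n - R → epochCdf μ τ n t ≤ ε := by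
  obtain ⟨R, hR0, hR⟩ := exists_walk_ge h.measurable_tau h.indep_tau h.identDistrib_tau
    h.integrable_tau hδ hε
  refine ⟨R, hR0, fun n t ht => le_trans (measureReal_mono ?_) hR⟩
  intro ω hω
  exact ⟨n, lt_of_le_of_lt hω ht⟩

lemma exists_le_epochCdf {δ ε : ℝ} (hδ : 0 < δ) (hε : 0 < ε) : ∃ R : ℝ, 0 ≤ R ∧
    ∀ (n : ℕ) (t : ℝ), (∫ ω, τ 0 ω ∂μ + δ) * n + R ≤ t → 1 - ε ≤ epochCdf μ τ n t := by
  obtain ⟨R, hR0, hR⟩ := exists_walk_ge (μ := μ) (ζ := fun n ω => -τ n ω)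
    (fun n => (h.measurable_tau n).neg) (h.indep_tau.comp (fun _ x => -x) fun _ => measurable_neg)
    (fun n => (h.identDistrib_tau n).comp measurable_neg) h.integrable_tau.neg hδ hε
  refine ⟨R, hR0, fun n t ht => ?_⟩
  have h1 : μ.real {ω | epoch τ n ω ≤ t}ᶜ ≤ ε := by
    refine le_trans (measureReal_mono ?_) hR
    intro ω hω
    have hω' : t < epoch τ n ω := not_le.1 hω
    refine ⟨n, ?_⟩
    rw [Finset.sum_neg_distrib, integral_neg]
    have : epoch τ n ω = ∑ i ∈ Finset.range n, τ i ω := rfl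
    linarith
  rw [probReal_compl_eq_one_sub (measurableSet_le (h.measurable_epoch n) measurable_const)] at h1
  rw [epochCdf]; linarith

lemma exists_epochCdf_le_of_time (t : ℝ) {ε : ℝ} (hε : 0 < ε) : ∃ n : ℕ, epochCdf μ τ n t ≤ ε := by
  have hp := h.mean_tau_pos
  obtain ⟨R, _, hR⟩ := h.exists_epochCdf_le (half_pos hp) hε
  obtain ⟨n, hn⟩ := exists_nat_gt ((t + R) / ((∫ ω, τ 0 ω ∂μ) / 2))
  refine ⟨n, hR n t ?_⟩
  rw [div_lt_iff₀ (half_pos hp)] at hn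
  linarith

lemma summable_epochCdf_succ (s : ℝ) : Summable fun n => epochCdf μ τ (n + 1) s := by
  obtain ⟨n₀, hn₀⟩ := h.exists_epochCdf_le_of_time s (half_pos one_pos)
  refine summable_of_sum_range_le (c := 2 * n₀) (fun n => epochCdf_nonneg _ _) fun J => ?_
  have h1 := h.sum_epochCdf_le n₀ J s
  have h2 : 0 ≤ ∑ n ∈ Finset.range J, epochCdf μ τ (n + 1) s :=
    Finset.sum_nonneg fun _ _ => epochCdf_nonneg _ _
  nlinarith

lemma summable_epochCdf (s : ℝ) : Summable fun n => epochCdf μ τ n s :=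
  (summable_nat_add_iff 1).1 (h.summable_epochCdf_succ s)

lemma meanCount_nonneg (s : ℝ) : 0 ≤ meanCount μ τ s := tsum_nonneg fun _ => epochCdf_nonneg _ _

lemma renewal_nonneg (s : ℝ) : 0 ≤ renewal μ τ s := tsum_nonneg fun _ => epochCdf_nonneg _ _

lemma renewal_mono : Monotone (renewal μ τ) := fun s t hst =>
  (h.summable_epochCdf s).tsum_le_tsum (fun n => epochCdf_mono n hst) (h.summable_epochCdf t)

lemma meanCount_mono : Monotone (meanCount μ τ) := fun s t hst =>
  (h.summable_epochCdf_succ s).tsum_le_tsum (fun _ => epochCdf_mono _ hst)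
    (h.summable_epochCdf_succ t)

lemma renewal_eq {s : ℝ} (hs : 0 ≤ s) : renewal μ τ s = 1 + meanCount μ τ s := by
  rw [renewal, (h.summable_epochCdf s).tsum_eq_zero_add, h.epochCdf_zero hs, meanCount]

lemma measurable_renewal_comp (s : ℝ) : Measurable fun ω => renewal μ τ (s - τ 0 ω) :=
  h.renewal_mono.measurable.comp (measurable_const.sub (h.measurable_tau 0))

lemma integrable_renewal_comp (s : ℝ) : Integrable (fun ω => renewal μ τ (s - τ 0 ω)) μ := by
  refine Integrable.of_bound (h.measurable_renewal_comp s).aestronglyMeasurable (renewal μ τ s) ?_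
  filter_upwards [h.tau_pos 0] with ω hω
  rw [Real.norm_of_nonneg (h.renewal_nonneg _)]
  exact h.renewal_mono (by linarith)

/-- The renewal equation. -/
lemma integral_renewal_comp (s : ℝ) :
    ∫ ω, renewal μ τ (s - τ 0 ω) ∂μ = meanCount μ τ s := by
  have h1 := hasSum_integral_of_summable_integral_norm (μ := μ)
    (F := fun n ω => epochCdf μ τ n (s - τ 0 ω)) (fun n => h.integrable_epochCdf_comp n s) (by
      simp only [Real.norm_of_nonneg (epochCdf_nonneg _ _), ← h.epochCdf_succ]
      exact h.summable_epochCdf_succ s)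
  simp only [← h.epochCdf_succ] at h1
  exact h1.tsum_eq.symm

lemma meanCount_le (n₀ : ℕ) (s : ℝ) :
    meanCount μ τ s ≤ n₀ + epochCdf μ τ n₀ s * meanCount μ τ s := by
  have h1 := (h.summable_epochCdf_succ s).hasSum.tendsto_sum_nat
  exact le_of_tendsto_of_tendsto' h1 (tendsto_const_nhds.add (h1.const_mul _))
    fun J => h.sum_epochCdf_le n₀ J s

lemma mul_epochCdf_le_meanCount (n : ℕ) (s : ℝ) : n * epochCdf μ τ n s ≤ meanCount μ τ s := by
  calc n * epochCdf μ τ n s = ∑ k ∈ Finset.range n, epochCdf μ τ n s := by simp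
    _ ≤ ∑ k ∈ Finset.range n, epochCdf μ τ (k + 1) s :=
      Finset.sum_le_sum fun k hk => h.epochCdf_anti s (by simp at hk; omega)
    _ ≤ meanCount μ τ s := (h.summable_epochCdf_succ s).sum_le_tsum _
      fun _ _ => epochCdf_nonneg _ _

/-- The tail of the series defining the mean number of jumps is a small fraction of the sum,
uniformly on bounded time intervals. -/
lemma meanCount_le_sum_add (K : ℕ) (s : ℝ) :
    meanCount μ τ s ≤ ∑ n ∈ Finset.range K, epochCdf μ τ (n + 1) s +
      epochCdf μ τ K s * meanCount μ τ s := by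
  rw [meanCount, ← (h.summable_epochCdf_succ s).sum_add_tsum_nat_add K]
  refine add_le_add_right ?_ _
  rw [(h.summable_epochCdf_succ s).sum_add_tsum_nat_add K, ← tsum_mul_left]
  refine Summable.tsum_le_tsum (fun n => ?_)
    ((summable_nat_add_iff (f := fun n => epochCdf μ τ (n + 1) s) K).2 (h.summable_epochCdf_succ s))
    ((h.summable_epochCdf_succ s).mul_left _)
  rw [show n + K + 1 = K + (n + 1) by ring]
  exact h.epochCdf_add_le _ _ _

/-- The upper half of the elementary renewal theorem. -/
lemma exists_meanCount_le {ε : ℝ} (hε : 0 < ε) : ∃ t₀ : ℝ, 0 < t₀ ∧ ∀ t, t₀ ≤ t →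
    meanCount μ τ t ≤ (1 + ε) * (t / ∫ ω, τ 0 ω ∂μ) := by
  set p := ∫ ω, τ 0 ω ∂μ with hp
  have hp0 : 0 < p := h.mean_tau_pos
  set e := min ε 1 / 8 with he
  have he0 : 0 < e := by positivity
  have he1 : e ≤ 1 / 8 := by rw [he]; linarith [min_le_right ε 1]
  have he2 : 8 * e ≤ ε := by rw [he]; linarith [min_le_left ε 1]
  obtain ⟨R, hR0, hR⟩ := h.exists_epochCdf_le (δ := e * p) (ε := e) (by positivity) he0
  refine ⟨(R + p + 1) / e, by positivity, fun t ht => ?_⟩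
  rw [div_le_iff₀ he0] at ht
  have ht0 : 0 < t := by nlinarith
  set q := p - e * p with hq
  have hq0 : 0 < q := by rw [hq]; nlinarith
  -- This is the least index, about `t / p`, for which the law of large numbers gives `P(T_n ≤ t) ≤
  -- e`; then `meanCount_le` yields `(1 - e) * meanCount ≤ n`.
  set n := ⌊(t + R) / q⌋₊ + 1 with hn
  have hn1 : (t + R) / q < n := by rw [hn]; exact_mod_cast Nat.lt_floor_add_one _
  have hn2 : (n : ℝ) ≤ (t + R) / q + 1 := by
    rw [hn]; push_cast; linarith [Nat.floor_le (show 0 ≤ (t + R) / q by positivity)]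
  rw [div_lt_iff₀ hq0] at hn1
  have h1 := hR n t (by linarith)
  have h2 := h.meanCount_le n t
  have h3 := h.meanCount_nonneg t
  have h4 : (1 - e) * meanCount μ τ t ≤ n := by nlinarith
  have h5 : (1 - e) * (n : ℝ) * p ≤ t + R + p := by
    have : q * n ≤ t + R + q := by
      calc q * n ≤ q * ((t + R) / q + 1) := mul_le_mul_of_nonneg_left hn2 hq0.le
        _ = t + R + q := by field_simp
    have : q ≤ p := by rw [hq]; nlinarith
    nlinarith
  rw [← mul_div_assoc, le_div_iff₀ hp0]
  have h6 : (1 - e) * ((1 - e) * meanCount μ τ t) * p ≤ (1 - e) * n * p :=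
    mul_le_mul_of_nonneg_right (mul_le_mul_of_nonneg_left h4 (by linarith)) hp0.le
  have h7 : (1 - e) * (1 - e) * (meanCount μ τ t * p) ≤ (1 + e) * t := by nlinarith
  have h8 : 1 + e ≤ (1 - e) * (1 - e) * (1 + ε) := by
    have a1 : (1 - 2 * e) * (1 + 8 * e) ≤ (1 - 2 * e) * (1 + ε) :=
      mul_le_mul_of_nonneg_left (by linarith) (by linarith)
    have a2 : (1 - 2 * e) * (1 + ε) ≤ (1 - e) * (1 - e) * (1 + ε) :=
      mul_le_mul_of_nonneg_right (by nlinarith) (by linarith)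
    nlinarith
  have h9 : (1 - e) * (1 - e) * (meanCount μ τ t * p) ≤ (1 - e) * (1 - e) * ((1 + ε) * t) := by
    nlinarith
  exact le_of_mul_le_mul_left h9 (by nlinarith)

/-- By the law of large numbers, nearly `t / E τ` jumps occur by time `t` with high probability. It
serves both the elementary renewal theorem and the choice of the number of jumps in the lower bound
for the maximum. -/
lemma exists_nat_le_epochCdf {ε : ℝ} (hε : 0 < ε) : ∃ t₀ : ℝ, 0 < t₀ ∧ ∀ t, t₀ ≤ t →
    ∃ J : ℕ, (1 - ε) * (t / ∫ ω, τ 0 ω ∂μ) ≤ J ∧ 1 - ε ≤ epochCdf μ τ J t := by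
  set p := ∫ ω, τ 0 ω ∂μ with hp
  have hp0 : 0 < p := h.mean_tau_pos
  set e := min ε 1 / 8 with he
  have he0 : 0 < e := by positivity
  have he1 : e ≤ 1 / 8 := by rw [he]; linarith [min_le_right ε 1]
  have he2 : 8 * e ≤ ε := by rw [he]; linarith [min_le_left ε 1]
  obtain ⟨R, hR0, hR⟩ := h.exists_le_epochCdf (δ := e * p) (ε := ε) (by positivity) hε
  refine ⟨(R + 2 * p + 1) / e, by positivity, fun t ht => ?_⟩
  rw [div_le_iff₀ he0] at ht
  have ht0 : 0 < t := by nlinarith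
  have htR : R ≤ t := by nlinarith
  set q := p + e * p with hq
  have hq0 : 0 < q := by positivity
  have hJ0 : 0 ≤ (t - R) / q := div_nonneg (by linarith) hq0.le
  refine ⟨⌊(t - R) / q⌋₊, ?_, hR _ _ ?_⟩
  · have h1 := (Nat.lt_floor_add_one ((t - R) / q)).le
    have h2 : t - R ≤ q * (⌊(t - R) / q⌋₊ + 1) := by
      rw [div_le_iff₀ hq0] at h1; linarith
    rw [← mul_div_assoc, div_le_iff₀ hp0]
    set J : ℝ := (⌊(t - R) / q⌋₊ : ℝ)
    have hJ : 0 ≤ J := Nat.cast_nonneg _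
    have h3 : (1 - e) * t ≤ (1 + e) * (J * p) := by nlinarith
    have h4 : (1 + e) * ((1 - ε) * t) ≤ (1 + e) * (J * p) := by nlinarith
    exact le_of_mul_le_mul_left h4 (by linarith)
  · have h1 := Nat.floor_le hJ0
    rw [le_div_iff₀ hq0] at h1
    linarith

/-- The lower half of the elementary renewal theorem. -/
lemma exists_le_meanCount {ε : ℝ} (hε : 0 < ε) (hε1 : ε ≤ 1) : ∃ t₀ : ℝ, 0 < t₀ ∧ ∀ t, t₀ ≤ t →
    (1 - ε) * (t / ∫ ω, τ 0 ω ∂μ) ≤ meanCount μ τ t := by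
  obtain ⟨t₀, ht₀, H⟩ := h.exists_nat_le_epochCdf (half_pos hε)
  refine ⟨t₀, ht₀, fun t ht => ?_⟩
  obtain ⟨J, hJ1, hJ2⟩ := H t ht
  have h1 := h.mul_epochCdf_le_meanCount J t
  have h2 : 0 ≤ t / ∫ ω, τ 0 ω ∂μ := div_nonneg (ht₀.le.trans ht) h.mean_tau_pos.le
  have h3 : (1 - ε / 2) * ((1 - ε / 2) * (t / ∫ ω, τ 0 ω ∂μ)) ≤ J * epochCdf μ τ J t := by
    rw [mul_comm (J : ℝ)]
    exact mul_le_mul hJ2 hJ1 (mul_nonneg (by linarith) h2) (epochCdf_nonneg _ _)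
  nlinarith [sq_nonneg ε]

end IsInput

end CompoundRenewal

/-! ### Construction of the dominating potential. -/

section Potential

variable {Ω : Type*} [MeasurableSpace Ω] {μ : Measure Ω} [IsProbabilityMeasure μ]

/-- A slowly decreasing weight going from `K` down to `m`. -/
noncomputable def rampWeight (K m δ d v : ℝ) : ℝ := max m (min K (K - δ * (v - d)))

lemma rampWeight_antitone {K m δ d : ℝ} (hδ : 0 ≤ δ) : Antitone (rampWeight K m δ d) := fun v w h =>
  max_le_max le_rfl (min_le_min le_rfl (by nlinarith))

lemma rampWeight_le {K m δ d : ℝ} (h : m ≤ K) (v : ℝ) : rampWeight K m δ d v ≤ K :=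
  max_le h (min_le_left _ _)

lemma le_rampWeight (K m δ d v : ℝ) : m ≤ rampWeight K m δ d v := le_max_left _ _

lemma rampWeight_of_le {K m δ d v : ℝ} (h : m ≤ K) (hδ : 0 ≤ δ) (hv : v ≤ d) : rampWeight K m δ d v = K := by
  rw [rampWeight, min_eq_left (by nlinarith), max_eq_right h]

lemma rampWeight_of_ge {K m δ d v : ℝ} (hm : 0 ≤ m) (hδ : 0 < δ) (hv : d + K / δ ≤ v) :
    rampWeight K m δ d v = m := by
  rw [rampWeight, max_eq_left]
  refine (min_le_right _ _).trans ?_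
  have : K / δ ≤ v - d := by linarith
  rw [div_le_iff₀ hδ] at this
  linarith

lemma rampWeight_le_add {K m δ d : ℝ} (hδ : 0 ≤ δ) (v : ℝ) {L : ℝ} (hL : 0 ≤ L) :
    rampWeight K m δ d v ≤ rampWeight K m δ d (v + L) + δ * L := by
  have hδL : 0 ≤ δ * L := mul_nonneg hδ hL
  simp only [rampWeight, max_le_iff]
  refine ⟨by linarith [le_max_left m (min K (K - δ * (v + L - d)))], ?_⟩
  have h1 := le_max_right m (min K (K - δ * (v + L - d)))
  rcases min_choice K (K - δ * (v + L - d)) with h2 | h2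
  · linarith [min_le_left K (K - δ * (v - d))]
  · linarith [min_le_right K (K - δ * (v - d))]

/-- Since `k ≥ 1`, an additive variation of `k` by `e` is also a relative one; then `(1 + e)² ≤ 1 +
3e` for `e ≤ 1`. The weighted tail `k * G` is thus as flat as `G`. -/
lemma mul_flat {k G : ℝ → ℝ} {e w L : ℝ} (he : 0 ≤ e) (he1 : e ≤ 1) (hk : 1 ≤ k (w + L))
    (hkL : k w ≤ k (w + L) + e) (hG0 : 0 ≤ G (w + L)) (hGw : 0 ≤ G w)
    (hG : G w ≤ (1 + e) * G (w + L)) : k w * G w ≤ (1 + 3 * e) * (k (w + L) * G (w + L)) := by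
  have h1 : k w ≤ (1 + e) * k (w + L) := by nlinarith
  calc k w * G w ≤ (1 + e) * k (w + L) * ((1 + e) * G (w + L)) :=
        mul_le_mul h1 hG hGw (by nlinarith)
    _ = (1 + e) * (1 + e) * (k (w + L) * G (w + L)) := by ring
    _ ≤ (1 + 3 * e) * (k (w + L) * G (w + L)) :=
        mul_le_mul_of_nonneg_right (by nlinarith) (mul_nonneg (by linarith) hG0)

/-- The supermartingale inequality with crossings charged at cost one: the loss `φ u` pays for the
crossing probability and the curvature (`hmain`). Charging every step with `η > u - U` covers the
threshold `U₀`, and the cap at one is free because the integrand never exceeds one. -/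
lemma lintegral_step_le {φ : ℝ → ℝ} (hφ : Antitone φ) (h0 : ∀ x, 0 ≤ φ x) {a r u U : ℝ}
    (ha : 0 < a) (hr : 0 ≤ r) (hu : U ≤ u) {ξ η R' D : Ω → ℝ} (hη : Measurable η)
    (hξη : ∀ ω, ξ ω ≤ η ω) (hξ : Integrable ξ μ)
    (hξa : ∫ ω, ξ ω ∂μ = -a) (hR0 : ∀ ω, 0 ≤ R' ω) (hR : Integrable R' μ)
    (hRr : ∫ ω, R' ω ∂μ = r - 1) (hD0 : ∀ ω, 0 ≤ D ω) (hD : Integrable D μ)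
    (hDle : ∀ ω, ξ ω ≤ u - U → (∫ v in (u - ξ ω)..u, φ v) - ξ ω * φ u ≤ D ω)
    (hmain : μ.real {ω | u - U < η ω} + 1 / a * ∫ ω, D ω ∂μ ≤ φ u) {U₀ : ℝ} (hU₀ : U₀ ≤ U) :
    ∫⁻ ω, (if u - U₀ < η ω then 1 else min 1 (ENNReal.ofReal (window φ a (R' ω) (u - ξ ω)))) ∂μ ≤
      min 1 (ENNReal.ofReal (window φ a r u)) := by
  refine le_min ?_ ?_
  · calc _ ≤ ∫⁻ _, (1 : ENNReal) ∂μ := lintegral_mono fun ω => by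
          split_ifs
          · exact le_rfl
          · exact min_le_left _ _
      _ = 1 := by simp
  obtain ⟨k1, k2⟩ := lintegral_window_step hφ h0 ha hr hu hξ hξa hR0 hR hRr hD0 hD hDle
  have hS : MeasurableSet {ω | u - U < η ω} := measurableSet_lt measurable_const hη
  calc _ ≤ ∫⁻ ω, (Set.indicator {ω | u - U < η ω} 1 ω +
        ENNReal.ofReal (if ξ ω ≤ u - U then window φ a (R' ω) (u - ξ ω) else 0)) ∂μ := by
        refine lintegral_mono fun ω => ?_
        by_cases h1 : u - U < η ω
        · rw [Set.indicator_of_mem (by exact h1)]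
          refine le_trans ?_ le_self_add
          split_ifs
          · exact le_rfl
          · exact min_le_left _ _
        · have h2 : ξ ω ≤ u - U := (hξη ω).trans (not_lt.1 h1)
          rw [if_neg (by linarith [not_lt.1 h1]), if_pos h2]
          exact (min_le_right _ _).trans le_add_self
    _ = μ {ω | u - U < η ω} + ∫⁻ ω, ENNReal.ofReal
          (if ξ ω ≤ u - U then window φ a (R' ω) (u - ξ ω) else 0) ∂μ := by
        rw [lintegral_add_left (measurable_one.indicator hS), lintegral_indicator_one hS]
    _ ≤ ENNReal.ofReal (μ.real {ω | u - U < η ω}) + ENNReal.ofReal _ := by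
        rw [ofReal_measureReal]
        exact add_le_add_right k2 _
    _ = ENNReal.ofReal (_ + _) := (ENNReal.ofReal_add measureReal_nonneg k1).symm
    _ ≤ ENNReal.ofReal (window φ a r u) := ENNReal.ofReal_le_ofReal (by linarith)

set_option maxHeartbeats 400000 in
/-- There is a potential, asymptotic to a window of `G`, that dominates its own one-step mean. -/
lemma IsStrongTail.exists_potential {G : ℝ → ℝ} (hG : IsStrongTail G) {ξ η : Ω → ℝ}
    (hξm : Measurable ξ) (hη : Measurable η) (hξη : ∀ ω, ξ ω ≤ η ω) (hξ : Integrable ξ μ) {a : ℝ}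
    (ha : 0 < a) (hξa : ∫ ω, ξ ω ∂μ = -a)
    (hηG : ∀ ε : ℝ, 0 < ε → ∃ x₀, ∀ u, x₀ ≤ u → μ.real {ω | u < η ω} ≤ (1 + ε) * G u)
    {ε : ℝ} (hε : 0 < ε) (hε1 : ε ≤ 1) :
    ∃ (φ : ℝ → ℝ) (U₀ X₀ K : ℝ), Antitone φ ∧ (∀ v, 0 ≤ φ v) ∧ (∀ v, φ v ≤ K * G v) ∧
      (∀ v, X₀ ≤ v → φ v = (1 + 3 * ε) * G v) ∧ 0 ≤ U₀ ∧
      ∀ (u r : ℝ) (R' : Ω → ℝ), U₀ ≤ u → 0 ≤ r → (∀ ω, 0 ≤ R' ω) → Integrable R' μ →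
        ∫ ω, R' ω ∂μ = r - 1 →
        ∫⁻ ω, (if u - U₀ < η ω then 1 else min 1 (ENNReal.ofReal (window φ a (R' ω) (u - ξ ω)))) ∂μ
          ≤ min 1 (ENNReal.ofReal (window φ a r u)) := by
  -- The budget far from the level: a fraction `ε / 2` of `φ` pays for curvature, and the rest must
  -- cover `(1 + ε) * G`.
  have haux : 1 + ε ≤ (1 - ε / 2) * (1 + 3 * ε) := by nlinarith
  have haux' : (1 + ε / 3) * (1 + ε / 3) ≤ 1 + ε := by nlinarith
  obtain ⟨x₁, hx₁⟩ := hηG 1 one_pos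
  obtain ⟨C, hC0, hC⟩ := hG.exists_le_mul (p := fun x => μ.real {ω | x < η ω})
    (fun x => measureReal_le_one) hx₁
  have hCξ : ∀ z, μ.real {ω | z < ξ ω} ≤ C * G z := fun z =>
    (measureReal_mono fun ω hω => lt_of_lt_of_le hω (hξη ω)).trans (hC z)
  have hnegtend := tendsto_integral_neg_part hξm hξ
  -- scales at which the curvature error is at most the fraction `q` of `φ`
  have scales : ∀ κ q : ℝ, 0 < κ → 0 < q → ∃ L U e : ℝ, 0 ≤ L ∧ L ≤ U ∧ 0 < e ∧ e ≤ 1 ∧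
      L * (3 * e) ≤ q / 4 ∧ (∀ w, U ≤ w → G w ≤ (1 + e) * G (w + L)) ∧
      (∀ u, U ≤ u → L ≤ u - L → ∫ z in L..(u - L), G z * G (u - z) ≤ q / (4 * (κ * C)) * G u) ∧
      ∫ ω, (if ξ ω < -L then -ξ ω else 0) ∂μ ≤ q / 4 := by
    intro κ q hκ hq
    obtain ⟨L₁, x₀, hL10, hL₁⟩ := hG.conv (q / (4 * (κ * C))) (by positivity)
    obtain ⟨L₂, hL₂⟩ := eventually_atTop.1 (hnegtend.eventually
      (eventually_le_nhds (show 0 < q / 4 by positivity)))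
    set L := max L₁ L₂ with hL
    have hL0 : 0 ≤ L := hL10.trans (le_max_left _ _)
    set e := min 1 (q / (12 * (L + 1))) with he
    have he0 : 0 < e := lt_min one_pos (by positivity)
    obtain ⟨U, hU⟩ := hG.long_tailed L e he0
    refine ⟨L, max L (max U x₀), e, hL0, le_max_left _ _, he0, min_le_left _ _, ?_,
      fun w hw => hU w ((le_max_left _ _).trans ((le_max_right _ _).trans hw)),
      fun u hu => hL₁ L (le_max_left _ _) u
        ((le_max_right _ _).trans ((le_max_right _ _).trans hu)), hL₂ L (le_max_right _ _)⟩
    have h1 : e ≤ q / (12 * (L + 1)) := min_le_right _ _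
    rw [le_div_iff₀ (by positivity)] at h1
    nlinarith
  -- The scale near the level has to be fixed before `K`, which depends on `U₀`. There is no
  -- circularity: where `φ u = K * G u` the factor `K` cancels from the relative curvature error, so
  -- `κ = 1` is enough.
  obtain ⟨L₀, U₀, e₀, hL₀, hLU₀, he₀, he₀1, hLe₀, hflat₀, hconv₀, hneg₀⟩ :=
    scales 1 (a / 2) one_pos (by positivity)
  obtain ⟨U₁, hU₁⟩ := hG.long_tailed U₀ 1 one_pos
  obtain ⟨C₁, hC₁0, hC₁⟩ := hG.exists_le_mul (p := fun x => G (x - U₀)) (fun x => hG.le_one _)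
    (K := 1 + 1) (x₀ := U₁ + U₀) (fun x hx => by
      have := hU₁ (x - U₀) (by linarith)
      rwa [sub_add_cancel] at this)
  -- Near the level, half of `K * G u` covers the crossing probability, at most `C * C₁ * G u`; the
  -- other half covers the curvature.
  set K := max (2 * (C * C₁)) (1 + 3 * ε) with hK
  have hK1 : 1 + 3 * ε ≤ K := le_max_right _ _
  have hK0 : 0 < K := by linarith
  obtain ⟨L, U, e, hL, hLU, he, he1, hLe, hflat, hconv, hneg⟩ :=
    scales K (a * ε / 2) hK0 (by positivity)
  set V := max U U₀ with hV
  obtain ⟨x₂, hx₂⟩ := hηG (ε / 3) (by positivity)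
  obtain ⟨U₂, hU₂⟩ := hG.long_tailed V (ε / 3) (by positivity)
  set d := max V (max (x₂ + V) (U₂ + V)) with hd
  have hd1 : V ≤ d := le_max_left _ _
  have hdx : x₂ + V ≤ d := (le_max_left _ _).trans (le_max_right _ _)
  have hdU : U₂ + V ≤ d := (le_max_right _ _).trans (le_max_right _ _)
  -- The ramp from `K` down to `1 + 3 * ε` is slow enough to be flat at both scales, `L₀` and `L`.
  set δ := min (e₀ / (L₀ + 1)) (e / (L + 1)) with hδ
  have hδ0 : 0 < δ := lt_min (by positivity) (by positivity)
  have hδ1 : δ * L₀ ≤ e₀ := by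
    have h1 : δ ≤ e₀ / (L₀ + 1) := min_le_left _ _
    rw [le_div_iff₀ (by positivity)] at h1; nlinarith
  have hδ2 : δ * L ≤ e := by
    have h1 : δ ≤ e / (L + 1) := min_le_right _ _
    rw [le_div_iff₀ (by positivity)] at h1; nlinarith
  set k := rampWeight K (1 + 3 * ε) δ d with hk
  have hk0 : ∀ v, 1 + 3 * ε ≤ k v := le_rampWeight _ _ _ _
  have hkK : ∀ v, k v ≤ K := rampWeight_le hK1
  have hkanti : Antitone k := rampWeight_antitone hδ0.le
  have hGnn : ∀ v, 0 ≤ G v := fun v => (hG.pos v).le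
  have hφ : Antitone fun v => k v * G v := fun v w hvw =>
    mul_le_mul (hkanti hvw) (hG.antitone hvw) (hGnn _) (by linarith [hk0 v])
  have hφ0 : ∀ v, 0 ≤ k v * G v := fun v => mul_nonneg (by linarith [hk0 v]) (hGnn v)
  have hφK : ∀ v, k v * G v ≤ K * G v := fun v => mul_le_mul_of_nonneg_right (hkK v) (hGnn v)
  have hflatφ : ∀ w L e : ℝ, 0 ≤ L → 0 < e → e ≤ 1 → δ * L ≤ e → G w ≤ (1 + e) * G (w + L) →
      k w * G w ≤ (1 + 3 * e) * (k (w + L) * G (w + L)) := fun w L e hL he he1 hδ h =>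
    mul_flat he.le he1 (by linarith [hk0 (w + L)])
      ((rampWeight_le_add hδ0.le w hL).trans (add_le_add_right hδ _)) (hGnn _) (hGnn _) h
  refine ⟨fun v => k v * G v, U₀, d + K / δ, K, hφ, hφ0, hφK, fun v hv => ?_, hL₀.trans hLU₀, ?_⟩
  · simp only [hk, rampWeight_of_ge (by linarith : 0 ≤ 1 + 3 * ε) hδ0 hv]
  intro u r R' hu hr hR0 hR hRr
  have hGpos := hG.pos u
  -- For `u ≤ d` the weight is exactly `K` and the scale `U₀` is used; beyond `d` the weight may
  -- have started to decrease and the finer scale `V` is used.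
  rcases le_total u d with hud | hud
  · obtain ⟨D, hD0, hDI, hDle, hDint⟩ := exists_curvature_bound (μ := μ) hG hφ hφ0 hφK hξm hξ
      (fun z _ => hCξ z) hL₀ hC0.le hLU₀ hu (ε₁ := 3 * e₀) (ε₂ := (a / 2) / (4 * (1 * C)))
      (by positivity) (by positivity)
      (fun w hw => hflatφ w L₀ e₀ hL₀ he₀ he₀1 hδ1 (hflat₀ w hw)) (hconv₀ u hu) hneg₀
    refine lintegral_step_le hφ hφ0 ha hr hu hη hξη hξ hξa hR0 hR hRr hD0 hDI hDle ?_ le_rfl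
    have hku : k u = K := rampWeight_of_le hK1 hδ0.le hud
    have h1 : μ.real {ω | u - U₀ < η ω} ≤ C * C₁ * G u := by
      refine (hC _).trans ?_
      rw [mul_assoc]
      exact mul_le_mul_of_nonneg_left (hC₁ u) hC0.le
    have h2 : 2 * (C * C₁) * G u ≤ K * G u := mul_le_mul_of_nonneg_right (le_max_left _ _) hGpos.le
    have h3 : K * C * ((a / 2) / (4 * (1 * C))) * G u = a / 8 * (K * G u) := by
      field_simp; ring
    rw [h3] at hDint
    simp only [hku] at hDint ⊢
    have h4 : (a / 2 / 4 + L₀ * (3 * e₀)) * (K * G u) ≤ (a / 4) * (K * G u) :=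
      mul_le_mul_of_nonneg_right (by linarith) (by positivity)
    have h5 : 1 / a * ∫ ω, D ω ∂μ ≤ 1 / a * (a / 2 * (K * G u)) :=
      mul_le_mul_of_nonneg_left (by nlinarith [mul_pos hK0 hGpos]) (by positivity)
    have h6 : 1 / a * (a / 2 * (K * G u)) = K * G u / 2 := by field_simp
    linarith
  · have hVu : V ≤ u := hd1.trans hud
    have hUu : U ≤ u := (le_max_left _ _).trans hVu
    obtain ⟨D, hD0, hDI, hDle, hDint⟩ := exists_curvature_bound (μ := μ) (U := V) hG hφ hφ0 hφK
      hξm hξ (fun z _ => hCξ z) hL hC0.le (hLU.trans (le_max_left _ _)) hVu (ε₁ := 3 * e)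
      (ε₂ := (a * ε / 2) / (4 * (K * C))) (by positivity) (by positivity)
      (fun w hw => hflatφ w L e hL he he1 hδ2 (hflat w ((le_max_left _ _).trans hw)))
      (hconv u hUu) hneg
    refine lintegral_step_le hφ hφ0 ha hr hVu hη hξη hξ hξa hR0 hR hRr hD0 hDI hDle ?_
      (le_max_right _ _)
    have h1 : μ.real {ω | u - V < η ω} ≤ (1 + ε) * G u := by
      have a1 := hx₂ (u - V) (by linarith)
      have a2 := hU₂ (u - V) (by linarith)
      rw [sub_add_cancel] at a2
      have a3 : (1 + ε / 3) * G (u - V) ≤ (1 + ε / 3) * ((1 + ε / 3) * G u) :=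
        mul_le_mul_of_nonneg_left a2 (by positivity)
      have a4 : (1 + ε / 3) * (1 + ε / 3) * G u ≤ (1 + ε) * G u :=
        mul_le_mul_of_nonneg_right haux' hGpos.le
      linarith
    have h3 : K * C * ((a * ε / 2) / (4 * (K * C))) * G u = a * ε / 8 * G u := by
      field_simp; ring
    rw [h3] at hDint
    set F := k u * G u with hF
    have hFG : (1 + 3 * ε) * G u ≤ F := mul_le_mul_of_nonneg_right (hk0 u) hGpos.le
    have hF0 : 0 ≤ F := hφ0 u
    have h4 : (a * ε / 2 / 4 + L * (3 * e)) * F ≤ a * ε / 4 * F :=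
      mul_le_mul_of_nonneg_right (by linarith) hF0
    have h5 : a * ε / 8 * G u ≤ a * ε / 8 * F :=
      mul_le_mul_of_nonneg_left (by linarith [mul_nonneg hε.le hGpos.le]) (by positivity)
    have h6 : 1 / a * ∫ ω, D ω ∂μ ≤ 1 / a * (a * ε / 2 * F) :=
      mul_le_mul_of_nonneg_left (by linarith [mul_nonneg (mul_pos ha hε).le hF0])
        (by positivity)
    have h7 : 1 / a * (a * ε / 2 * F) = ε / 2 * F := by field_simp
    have h8 : (1 + ε) * G u ≤ (1 - ε / 2) * F := by
      have : (1 - ε / 2) * ((1 + 3 * ε) * G u) ≤ (1 - ε / 2) * F :=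
        mul_le_mul_of_nonneg_left hFG (by linarith)
      have : (1 + ε) * G u ≤ (1 - ε / 2) * (1 + 3 * ε) * G u :=
        mul_le_mul_of_nonneg_right haux hGpos.le
      linarith
    show _ ≤ F
    linarith

end Potential

/-! ### Sample paths and the chain embedded at the jumps. -/

namespace CompoundRenewal

variable {Ω : Type*} [MeasurableSpace Ω] {μ : Measure Ω} [IsProbabilityMeasure μ]
  {τ Y : ℕ → Ω → ℝ}

section Paths

variable {ω : Ω}

lemma strictMono_epoch (hpos : ∀ n, 0 < τ n ω) : StrictMono fun n => epoch τ n ω :=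
  strictMono_nat_of_lt_succ fun n => by
    simp only [epoch_succ]; linarith [hpos n]

lemma epoch_nonneg (hpos : ∀ n, 0 < τ n ω) (n : ℕ) : 0 ≤ epoch τ n ω :=
  Finset.sum_nonneg fun i _ => (hpos i).le

lemma count_eq (hpos : ∀ n, 0 < τ n ω) {u : ℝ} {n : ℕ} (h1 : epoch τ n ω ≤ u)
    (h2 : u < epoch τ (n + 1) ω) : count τ u ω = n := by
  have hmono := strictMono_epoch hpos
  have : {k : ℕ | 1 ≤ k ∧ epoch τ k ω ≤ u} = Finset.Icc 1 n := by
    ext k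
    simp only [Set.mem_ofPred_eq, Finset.coe_Icc, Set.mem_Icc, and_congr_right_iff]
    intro _
    constructor
    · intro hk
      have := hmono.lt_iff_lt.1 (show epoch τ k ω < epoch τ (n + 1) ω from hk.trans_lt h2)
      omega
    · intro hk
      exact (hmono.monotone hk).trans h1
  rw [count, this, Set.ncard_coe_finset]
  simp

lemma count_spec (hpos : ∀ n, 0 < τ n ω) (htop : Tendsto (fun n => epoch τ n ω) atTop atTop)
    {u : ℝ} (hu : 0 ≤ u) :
    epoch τ (count τ u ω) ω ≤ u ∧ u < epoch τ (count τ u ω + 1) ω := by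
  have hex : ∃ n, u < epoch τ (n + 1) ω := by
    obtain ⟨n, hn⟩ := ((tendsto_add_atTop_iff_nat 1).2 htop).eventually_gt_atTop u |>.exists
    exact ⟨n, hn⟩
  classical
  set n := Nat.find hex with hn
  have h2 : u < epoch τ (n + 1) ω := Nat.find_spec hex
  have h1 : epoch τ n ω ≤ u := by
    rcases Nat.eq_zero_or_pos n with h0 | h0
    · rw [h0, epoch_zero]; exact hu
    · have := Nat.find_min hex (m := n - 1) (by omega)
      rw [Nat.sub_add_cancel h0] at this
      exact not_lt.1 this
  rw [count_eq hpos h1 h2]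
  exact ⟨h1, h2⟩

lemma lt_count_iff (hpos : ∀ n, 0 < τ n ω) (htop : Tendsto (fun n => epoch τ n ω) atTop atTop)
    {u : ℝ} (hu : 0 ≤ u) (n : ℕ) : n < count τ u ω ↔ epoch τ (n + 1) ω ≤ u := by
  obtain ⟨h1, h2⟩ := count_spec hpos htop hu
  have hmono := strictMono_epoch hpos
  constructor
  · intro h
    exact (hmono.monotone (show n + 1 ≤ count τ u ω from h)).trans h1
  · intro h
    have := hmono.lt_iff_lt.1 (show epoch τ (n + 1) ω < epoch τ (count τ u ω + 1) ω from
      h.trans_lt h2)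
    omega

lemma lt_runningMax (hpos : ∀ n, 0 < τ n ω) (htop : Tendsto (fun n => epoch τ n ω) atTop atTop)
    {c t x : ℝ} (ht : 0 ≤ t) {n : ℕ} (hn : epoch τ (n + 1) ω ≤ t)
    (hx : x < ∑ i ∈ Finset.range (n + 1), Y i ω + c * epoch τ (n + 1) ω) :
    x < runningMax τ Y c t ω := by
  have hmono := strictMono_epoch hpos
  -- The real `sSup` of a set unbounded above is zero, so boundedness of the path on `[0, t]` has to
  -- be established.
  have hbdd : BddAbove ((fun u : ℝ => process τ Y c u ω) '' Set.Icc 0 t) := by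
    refine ⟨∑ i ∈ Finset.range (count τ t ω), |Y i ω| + |c| * t, ?_⟩
    rintro _ ⟨u, ⟨hu0, hut⟩, rfl⟩
    have hle : count τ u ω ≤ count τ t ω := by
      have := hmono.lt_iff_lt.1 (((count_spec hpos htop hu0).1.trans hut).trans_lt
        (count_spec hpos htop ht).2)
      omega
    refine add_le_add ?_ ?_
    · calc ∑ i ∈ Finset.range (count τ u ω), Y i ω
          ≤ ∑ i ∈ Finset.range (count τ u ω), |Y i ω| :=
            Finset.sum_le_sum fun i _ => le_abs_self _
        _ ≤ _ := Finset.sum_le_sum_of_subset_of_nonneg (Finset.range_mono hle)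
            fun _ _ _ => abs_nonneg _
    · calc c * u ≤ |c| * u := mul_le_mul_of_nonneg_right (le_abs_self c) hu0
        _ ≤ |c| * t := mul_le_mul_of_nonneg_left hut (abs_nonneg c)
  refine lt_of_lt_of_le hx (le_csSup hbdd ⟨epoch τ (n + 1) ω, ⟨epoch_nonneg hpos _, hn⟩, ?_⟩)
  have : count τ (epoch τ (n + 1) ω) ω = n + 1 := count_eq hpos le_rfl (hmono (by omega))
  simp only [process, this]

end Paths

section Chain

/-- One step of the chain formed by the remaining time and the distance to the level at the
successive jump epochs; it is sent to a state with negative remaining time when the jump and the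
positive part of the drift until the next jump bring the path within `U` of the level. -/
noncomputable def chainStep (c U : ℝ) (q : ℝ × ℝ) (p : ℝ × ℝ) : ℝ × ℝ :=
  if 0 ≤ q.1 ∧ p.1 + max (c * p.2) 0 ≤ q.2 - U then (q.1 - p.2, q.2 - (p.1 + c * p.2)) else (-1, 0)

/-- The remaining time and the distance to the level `x` immediately before the successive jumps. -/
noncomputable def chain (τ Y : ℕ → Ω → ℝ) (c U x t : ℝ) : ℕ → Ω → ℝ × ℝ
  | 0, ω => if c * τ 0 ω ≤ x - U then (t - τ 0 ω, x - c * τ 0 ω) else (-1, 0)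
  | n + 1, ω => chainStep c U (chain τ Y c U x t n ω) (Y n ω, τ (n + 1) ω)

/-- The chain comes within `U` of the level in its `n`-th step. -/
def chainCrosses (τ Y : ℕ → Ω → ℝ) (c U x t : ℝ) (n : ℕ) : Set Ω :=
  {ω | 0 ≤ (chain τ Y c U x t n ω).1 ∧
    (chain τ Y c U x t n ω).2 - U < Y n ω + max (c * τ (n + 1) ω) 0}

variable {c U x t : ℝ}

lemma measurable_chainStep (c U : ℝ) :
    Measurable fun r : (ℝ × ℝ) × (ℝ × ℝ) => chainStep c U r.1 r.2 := by
  refine Measurable.ite ?_ (by fun_prop) measurable_const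
  have h1 : MeasurableSet {r : (ℝ × ℝ) × (ℝ × ℝ) | 0 ≤ r.1.1} :=
    measurableSet_le measurable_const (by fun_prop)
  have h2 : MeasurableSet {r : (ℝ × ℝ) × (ℝ × ℝ) | r.2.1 + max (c * r.2.2) 0 ≤ r.1.2 - U} :=
    measurableSet_le (by fun_prop) (by fun_prop)
  exact h1.inter h2

/-- Live states, those with nonnegative remaining time, stay in the range of distances where the
one-step inequality is available. -/
lemma chain_invariant (n : ℕ) (ω : Ω) (h : 0 ≤ (chain τ Y c U x t n ω).1) :
    U ≤ (chain τ Y c U x t n ω).2 := by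
  cases n with
  | zero =>
    simp only [chain] at h ⊢
    split_ifs at h ⊢ with h1
    · show U ≤ x - c * τ 0 ω
      linarith
    · exact absurd h (by norm_num)
  | succ n =>
    simp only [chain, chainStep] at h ⊢
    split_ifs at h ⊢ with h1
    · have := h1.2
      have := le_max_left (c * τ (n + 1) ω) 0
      simp only at *
      linarith
    · exact absurd h (by norm_num)

/-- Between two jumps the path exceeds its value after the earlier one by at most the positive part
of the drift over the whole gap, so it is enough to test `Y n + max (c * τ (n + 1)) 0` at each jump.
If no test succeeds, the chain follows the true path and the level cannot be exceeded. The first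
alternative is the drift before the first jump, which matters only for `c > 0`. -/
lemma exists_chainCrosses {ω : Ω} (hpos : ∀ n, 0 < τ n ω)
    (htop : Tendsto (fun n => epoch τ n ω) atTop atTop) (hU : 0 ≤ U) (hUx : U ≤ x)
    (hx : x < runningMax τ Y c t ω) (ht : 0 ≤ t) :
    (x - U < c * τ 0 ω ∧ x - U < c * t) ∨ ∃ n, ω ∈ chainCrosses τ Y c U x t n := by
  obtain ⟨_, ⟨u, ⟨hu0, hut⟩, rfl⟩, hu⟩ := exists_lt_of_lt_csSup
    (Set.image_nonempty.2 (Set.nonempty_Icc.2 ht)) hx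
  have hmono := strictMono_epoch hpos
  obtain ⟨h1, h2⟩ := count_spec hpos htop hu0
  simp only [process] at hu
  rcases hn : count τ u ω with _ | m
  · left
    rw [hn] at h2 hu
    simp only [Finset.range_zero, Finset.sum_empty, zero_add] at hu
    rw [epoch_succ, epoch_zero, zero_add] at h2
    have hc : 0 < c := by
      by_contra hc
      nlinarith [not_lt.1 hc]
    constructor <;> nlinarith
  · rw [hn] at h1 h2 hu
    have hT1 : τ 0 ω ≤ t := by
      have : epoch τ 1 ω ≤ epoch τ (m + 1) ω := hmono.monotone (by omega)
      rw [epoch_succ, epoch_zero, zero_add] at this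
      linarith
    by_cases h0 : x - U < c * τ 0 ω
    · left
      have hc : 0 < c := by
        by_contra hc
        nlinarith [not_lt.1 hc, hpos 0]
      exact ⟨h0, h0.trans_le (by nlinarith)⟩
    right
    by_contra hno
    push Not at hno h0
    have key : ∀ k ≤ m, chain τ Y c U x t k ω = (t - epoch τ (k + 1) ω,
        x - (∑ i ∈ Finset.range k, Y i ω + c * epoch τ (k + 1) ω)) := by
      intro k
      induction k with
      | zero => intro _; simp [chain, h0, epoch_succ]
      | succ k ih =>
        intro hk
        have hk' := ih (by omega)
        have hTk : epoch τ (k + 1) ω ≤ epoch τ (m + 1) ω := hmono.monotone (by omega)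
        have h3 := hno k
        simp only [chainCrosses, hk', Set.mem_ofPred_eq, not_and, not_lt] at h3
        have h4 : 0 ≤ t - epoch τ (k + 1) ω := by linarith
        simp only [chain, chainStep, hk']
        rw [if_pos ⟨h4, h3 h4⟩]
        rw [epoch_succ (k + 1), Finset.sum_range_succ]
        ext <;> simp only <;> ring
    have h3 := hno m
    simp only [chainCrosses, key m le_rfl, Set.mem_ofPred_eq, not_and, not_lt] at h3
    have h4 := h3 (by linarith)
    rw [Finset.sum_range_succ] at hu
    rw [epoch_succ (m + 1)] at h2
    have h5 : c * u ≤ c * epoch τ (m + 1) ω + max (c * τ (m + 1) ω) 0 := by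
      rcases le_total c 0 with hc | hc
      · nlinarith [le_max_right (c * τ (m + 1) ω) 0]
      · nlinarith [le_max_left (c * τ (m + 1) ω) 0]
    linarith

end Chain

/-! ### Independence of the past. -/

namespace IsInput

variable (h : IsInput μ τ Y)
include h

lemma ae_tendsto_epoch : ∀ᵐ ω ∂μ, Tendsto (fun n => epoch τ n ω) atTop atTop := by
  have hslln := strong_law_ae_real τ h.integrable_tau (fun i j hij => h.indep_tau.indepFun hij)
    h.identDistrib_tau
  filter_upwards [hslln] with ω hω
  refine (tendsto_natCast_atTop_atTop.atTop_mul_pos h.mean_tau_pos hω).congr' ?_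
  filter_upwards [eventually_gt_atTop 0] with n hn
  have : (n : ℝ) ≠ 0 := by positivity
  rw [epoch]
  field_simp

/-- Merging both sequences into one independent family makes independence of the past a statement
about disjoint index sets. -/
lemma iIndepFun_elim : iIndepFun (Sum.elim τ Y) μ := by
  rw [iIndepFun_iff_measure_inter_preimage_eq_mul]
  intro S sets hsets
  have hA : MeasurableSet {x : ℕ → ℝ | ∀ i ∈ S.toLeft, x i ∈ sets (Sum.inl i)} := by
    have : {x : ℕ → ℝ | ∀ i ∈ S.toLeft, x i ∈ sets (Sum.inl i)} =
        ⋂ i ∈ S.toLeft, (fun x : ℕ → ℝ => x i) ⁻¹' sets (Sum.inl i) := by ext; simp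
    rw [this]
    exact Finset.measurableSet_biInter _ fun i hi =>
      measurable_pi_apply i (hsets _ (by simpa using hi))
  have hB : MeasurableSet {x : ℕ → ℝ | ∀ i ∈ S.toRight, x i ∈ sets (Sum.inr i)} := by
    have : {x : ℕ → ℝ | ∀ i ∈ S.toRight, x i ∈ sets (Sum.inr i)} =
        ⋂ i ∈ S.toRight, (fun x : ℕ → ℝ => x i) ⁻¹' sets (Sum.inr i) := by ext; simp
    rw [this]
    exact Finset.measurableSet_biInter _ fun i hi =>
      measurable_pi_apply i (hsets _ (by simpa using hi))
  have e1 := h.indep_tau_jump.measure_inter_preimage_eq_mul _ _ hA hB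
  have e2 := (iIndepFun_iff_measure_inter_preimage_eq_mul.1 h.indep_tau) S.toLeft
    (sets := fun i => sets (Sum.inl i)) fun i hi => hsets _ (by simpa using hi)
  have e3 := (iIndepFun_iff_measure_inter_preimage_eq_mul.1 h.indep_jump) S.toRight
    (sets := fun i => sets (Sum.inr i)) fun i hi => hsets _ (by simpa using hi)
  have a2 : (⋂ i ∈ S.toLeft, τ i ⁻¹' sets (Sum.inl i)) =
      (fun ω n => τ n ω) ⁻¹' {x : ℕ → ℝ | ∀ i ∈ S.toLeft, x i ∈ sets (Sum.inl i)} := by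
    ext; simp
  have a3 : (⋂ i ∈ S.toRight, Y i ⁻¹' sets (Sum.inr i)) =
      (fun ω n => Y n ω) ⁻¹' {x : ℕ → ℝ | ∀ i ∈ S.toRight, x i ∈ sets (Sum.inr i)} := by
    ext; simp
  have a1 : (⋂ i ∈ S, Sum.elim τ Y i ⁻¹' sets i) =
      (⋂ i ∈ S.toLeft, τ i ⁻¹' sets (Sum.inl i)) ∩ (⋂ i ∈ S.toRight, Y i ⁻¹' sets (Sum.inr i)) := by
    ext ω
    simp only [Set.mem_iInter, Set.mem_inter_iff, Finset.mem_toLeft, Finset.mem_toRight,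
      Set.mem_preimage, Sum.forall, Sum.elim_inl, Sum.elim_inr]
  rw [a1, a2, a3, e1, ← a2, ← a3, e2, e3]
  conv_rhs => rw [← Finset.toLeft_disjSum_toRight (u := S), Finset.prod_disjSum]
  rfl

end IsInput

/-- The information available immediately before the `n`-th jump. -/
abbrev past (τ Y : ℕ → Ω → ℝ) (n : ℕ) : MeasurableSpace Ω :=
  ⨆ i ∈ {i : ℕ ⊕ ℕ | Sum.elim (fun k => k ≤ n) (fun k => k < n) i},
    MeasurableSpace.comap (Sum.elim τ Y i) inferInstance

lemma past_mono : Monotone (past τ Y) := fun n m hnm => by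
  refine biSup_mono fun i hi => ?_
  rcases i with k | k
  · exact le_trans (show k ≤ n from hi) hnm
  · exact lt_of_lt_of_le (show k < n from hi) hnm

lemma measurable_past_tau {n k : ℕ} (hk : k ≤ n) : Measurable[past τ Y n] (τ k) :=
  Measurable.mono (comap_measurable (τ k)) (le_iSup₂_of_le
    (f := fun (i : ℕ ⊕ ℕ) (_ : i ∈ {i : ℕ ⊕ ℕ | Sum.elim (fun k => k ≤ n) (fun k => k < n) i}) =>
      MeasurableSpace.comap (Sum.elim τ Y i) inferInstance) (Sum.inl k) hk le_rfl) le_rfl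

lemma measurable_past_jump {n k : ℕ} (hk : k < n) : Measurable[past τ Y n] (Y k) :=
  Measurable.mono (comap_measurable (Y k)) (le_iSup₂_of_le
    (f := fun (i : ℕ ⊕ ℕ) (_ : i ∈ {i : ℕ ⊕ ℕ | Sum.elim (fun k => k ≤ n) (fun k => k < n) i}) =>
      MeasurableSpace.comap (Sum.elim τ Y i) inferInstance) (Sum.inr k) hk le_rfl) le_rfl

lemma measurable_past_epoch {n k : ℕ} (hk : k ≤ n + 1) : Measurable[past τ Y n] (epoch τ k) :=
  Finset.measurable_sum _ fun i hi => measurable_past_tau (by simp at hi; omega)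

lemma measurable_past_chain (c U x t : ℝ) (n : ℕ) :
    Measurable[past τ Y n] (chain τ Y c U x t n) := by
  induction n with
  | zero =>
    have h0 : Measurable[past τ Y 0] (τ 0) := measurable_past_tau le_rfl
    have hf : Measurable fun z : ℝ => if c * z ≤ x - U then (t - z, x - c * z) else (-1, 0) :=
      Measurable.ite (measurableSet_le (by fun_prop) (by fun_prop)) (by fun_prop) measurable_const
    exact hf.comp h0
  | succ n ih =>
    have h1 : Measurable[past τ Y (n + 1)] (chain τ Y c U x t n) :=
      ih.mono (past_mono (Nat.le_succ n)) le_rfl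
    have h2 : Measurable[past τ Y (n + 1)] (τ (n + 1)) := measurable_past_tau le_rfl
    have h3 : Measurable[past τ Y (n + 1)] (Y n) := measurable_past_jump (Nat.lt_succ_self n)
    exact (measurable_chainStep c U).comp (h1.prodMk (h3.prodMk h2))

namespace IsInput

variable (h : IsInput μ τ Y)
include h

lemma measurable_elim (i : ℕ ⊕ ℕ) : Measurable (Sum.elim τ Y i) := by
  rcases i with k | k
  · exact h.measurable_tau k
  · exact h.measurable_jump k

lemma past_le (n : ℕ) : past τ Y n ≤ ‹MeasurableSpace Ω› :=
  iSup₂_le fun i _ => (h.measurable_elim i).comap_le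

/-- The `n`-th jump and the following interarrival time are independent of the past. -/
lemma indepFun_past {β : Type*} [MeasurableSpace β] {n : ℕ} {q : Ω → β}
    (hq : Measurable[past τ Y n] q) : IndepFun q (fun ω => (Y n ω, τ (n + 1) ω)) μ := by
  have h1 := indep_iSup_of_disjoint (fun i => (h.measurable_elim i).comap_le)
    ((iIndepFun_iff_iIndep _ _ _).1 h.iIndepFun_elim)
    (S := {i : ℕ ⊕ ℕ | Sum.elim (fun k => k ≤ n) (fun k => k < n) i})
    (T := {Sum.inl (n + 1), Sum.inr n}) (by
      rw [Set.disjoint_left]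
      rintro i hi (rfl | rfl)
      · exact absurd (show n + 1 ≤ n from hi) (by omega)
      · exact absurd (show n < n from hi) (by omega))
  rw [IndepFun_iff_Indep]
  refine indep_of_indep_of_le_left (indep_of_indep_of_le_right h1 ?_) hq.comap_le
  refine Measurable.comap_le ?_
  refine Measurable.prodMk ?_ ?_
  · exact Measurable.mono (comap_measurable (Y n)) (le_iSup₂_of_le
      (f := fun (i : ℕ ⊕ ℕ) (_ : i ∈ ({Sum.inl (n + 1), Sum.inr n} : Set (ℕ ⊕ ℕ))) =>
        MeasurableSpace.comap (Sum.elim τ Y i) inferInstance) (Sum.inr n) (by simp) le_rfl) le_rfl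
  · exact Measurable.mono (comap_measurable (τ (n + 1))) (le_iSup₂_of_le
      (f := fun (i : ℕ ⊕ ℕ) (_ : i ∈ ({Sum.inl (n + 1), Sum.inr n} : Set (ℕ ⊕ ℕ))) =>
        MeasurableSpace.comap (Sum.elim τ Y i) inferInstance) (Sum.inl (n + 1)) (by simp) le_rfl)
      le_rfl

lemma indepFun_jump_tau (n m : ℕ) : IndepFun (Y n) (τ m) μ :=
  h.iIndepFun_elim.indepFun (i := Sum.inr n) (j := Sum.inl m) (by simp)

lemma map_jump_tau (n : ℕ) :
    μ.map (fun ω => (Y n ω, τ (n + 1) ω)) = μ.map (fun ω => (Y 0 ω, τ 0 ω)) := by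
  rw [(indepFun_iff_map_prod_eq_prod_map_map (h.measurable_jump n).aemeasurable
      (h.measurable_tau (n + 1)).aemeasurable).1 (h.indepFun_jump_tau n (n + 1)),
    (indepFun_iff_map_prod_eq_prod_map_map (h.measurable_jump 0).aemeasurable
      (h.measurable_tau 0).aemeasurable).1 (h.indepFun_jump_tau 0 0),
    (h.identDistrib_jump n).map_eq, (h.identDistrib_tau (n + 1)).map_eq]

lemma measurable_chain (c U x t : ℝ) (n : ℕ) : Measurable (chain τ Y c U x t n) :=
  (measurable_past_chain c U x t n).mono (h.past_le n) le_rfl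

lemma measurableSet_chainCrosses (c U x t : ℝ) (n : ℕ) :
    MeasurableSet (chainCrosses τ Y c U x t n) := by
  have h1 := h.measurable_chain c U x t n
  have h2 := h.measurable_jump n
  have h3 := h.measurable_tau (n + 1)
  exact (measurableSet_le measurable_const h1.fst).inter (measurableSet_lt
    (h1.snd.sub measurable_const) (h2.add ((h3.const_mul c).max measurable_const)))

lemma integral_count {t : ℝ} (ht : 0 ≤ t) :
    ∫ ω, (count τ t ω : ℝ) ∂μ = meanCount μ τ t := by
  have hm : ∀ n, MeasurableSet {ω | epoch τ (n + 1) ω ≤ t} := fun n =>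
    measurableSet_le (h.measurable_epoch _) measurable_const
  have hint : ∀ n, ∫ ω, Set.indicator {ω | epoch τ (n + 1) ω ≤ t} (fun _ => (1 : ℝ)) ω ∂μ =
      epochCdf μ τ (n + 1) t := fun n => by
    rw [integral_indicator_const _ (hm n)]; simp [epochCdf]
  have h1 := hasSum_integral_of_summable_integral_norm (μ := μ)
    (F := fun n ω => Set.indicator {ω | epoch τ (n + 1) ω ≤ t} (fun _ => (1 : ℝ)) ω)
    (fun n => (integrable_const _).indicator (hm n)) (by
      have : ∀ n ω, ‖Set.indicator {ω | epoch τ (n + 1) ω ≤ t} (fun _ => (1 : ℝ)) ω‖ =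
          Set.indicator {ω | epoch τ (n + 1) ω ≤ t} (fun _ => (1 : ℝ)) ω := fun n ω =>
        Real.norm_of_nonneg (Set.indicator_nonneg (fun _ _ => zero_le_one) _)
      simp only [this, hint]
      exact h.summable_epochCdf_succ t)
  simp only [hint] at h1
  rw [meanCount, h1.tsum_eq]
  refine integral_congr_ae ?_
  filter_upwards [h.ae_tau_pos, h.ae_tendsto_epoch] with ω hpos htop
  rw [tsum_eq_sum (s := Finset.range (count τ t ω))]
  · rw [Finset.sum_congr rfl (g := fun _ => (1 : ℝ))]
    · simp
    · intro n hn
      rw [Finset.mem_range, lt_count_iff hpos htop ht] at hn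
      exact Set.indicator_of_mem (by exact hn) _
  · intro n hn
    rw [Finset.mem_range, lt_count_iff hpos htop ht] at hn
    exact Set.indicator_of_notMem (by exact hn) _

end IsInput

/-! ### Supermartingale bound for the crossing probability. -/

/-- The potential of a state of the chain: a window of length the mean number of remaining jumps. -/
noncomputable def potential (μ : Measure Ω) (τ : ℕ → Ω → ℝ) (φ : ℝ → ℝ) (a : ℝ) (q : ℝ × ℝ) :
    ENNReal :=
  if 0 ≤ q.1 then min 1 (ENNReal.ofReal (window φ a (renewal μ τ q.1) q.2)) else 0

namespace IsInput

variable (h : IsInput μ τ Y)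
include h

lemma measurable_window_renewal {φ : ℝ → ℝ} (hφ : Antitone φ) (a : ℝ) :
    Measurable fun q : ℝ × ℝ => window φ a (renewal μ τ q.1) q.2 :=
  (continuous_window hφ).measurable.comp
    ((h.renewal_mono.measurable.comp measurable_fst).prodMk measurable_snd)

/-- A crossing kills the chain, so each outcome contributes either one or the next potential. The
pair `(Y n, τ (n + 1))` is independent of the current state and distributed as `(Y 0, τ 0)`, so
`hstep` applies conditionally. -/
lemma measure_chainCrosses_add_le {φ : ℝ → ℝ} (hφ : Antitone φ) {a c U x t : ℝ}
    (hstep : ∀ s u : ℝ, 0 ≤ s → U ≤ u →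
      ∫⁻ ω, (if u - U < Y 0 ω + max (c * τ 0 ω) 0 then 1 else
        min 1 (ENNReal.ofReal (window φ a (renewal μ τ (s - τ 0 ω)) (u - (Y 0 ω + c * τ 0 ω))))) ∂μ
        ≤ min 1 (ENNReal.ofReal (window φ a (renewal μ τ s) u))) (n : ℕ) :
    μ (chainCrosses τ Y c U x t n) + ∫⁻ ω, potential μ τ φ a (chain τ Y c U x t (n + 1) ω) ∂μ ≤
      ∫⁻ ω, potential μ τ φ a (chain τ Y c U x t n ω) ∂μ := by
  set Ψ : (ℝ × ℝ) × (ℝ × ℝ) → ENNReal := fun r => if 0 ≤ r.1.1 ∧ U ≤ r.1.2 then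
    (if r.1.2 - U < r.2.1 + max (c * r.2.2) 0 then 1 else
      min 1 (ENNReal.ofReal (window φ a (renewal μ τ (r.1.1 - r.2.2))
        (r.1.2 - (r.2.1 + c * r.2.2))))) else 0 with hΨ
  have hΨm : Measurable Ψ := by
    have h1 : MeasurableSet {r : (ℝ × ℝ) × (ℝ × ℝ) | 0 ≤ r.1.1} :=
      measurableSet_le measurable_const (by fun_prop)
    have h2 : MeasurableSet {r : (ℝ × ℝ) × (ℝ × ℝ) | U ≤ r.1.2} :=
      measurableSet_le measurable_const (by fun_prop)
    have h3 : MeasurableSet {r : (ℝ × ℝ) × (ℝ × ℝ) | r.1.2 - U < r.2.1 + max (c * r.2.2) 0} :=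
      measurableSet_lt (by fun_prop) (by fun_prop)
    have h4 : Measurable fun r : (ℝ × ℝ) × (ℝ × ℝ) =>
        ((r.1.1 - r.2.2, r.1.2 - (r.2.1 + c * r.2.2)) : ℝ × ℝ) := by fun_prop
    exact Measurable.ite (h1.inter h2) (Measurable.ite h3 measurable_const
      (measurable_const.min ((h.measurable_window_renewal hφ a).comp h4).ennreal_ofReal))
      measurable_const
  have hpair : Measurable fun ω => (Y n ω, τ (n + 1) ω) :=
    (h.measurable_jump n).prodMk (h.measurable_tau (n + 1))
  have hpair0 : Measurable fun ω => (Y 0 ω, τ 0 ω) :=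
    (h.measurable_jump 0).prodMk (h.measurable_tau 0)
  have hD := h.measurableSet_chainCrosses c U x t n
  calc μ (chainCrosses τ Y c U x t n) + ∫⁻ ω, potential μ τ φ a (chain τ Y c U x t (n + 1) ω) ∂μ
      = ∫⁻ ω, (Set.indicator (chainCrosses τ Y c U x t n) 1 ω +
          potential μ τ φ a (chain τ Y c U x t (n + 1) ω)) ∂μ := by
        rw [lintegral_add_left (measurable_one.indicator hD), lintegral_indicator_one hD]
    _ ≤ ∫⁻ ω, Ψ (chain τ Y c U x t n ω, (Y n ω, τ (n + 1) ω)) ∂μ := by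
        refine lintegral_mono fun ω => ?_
        set q := chain τ Y c U x t n ω with hq
        have hqU := chain_invariant (τ := τ) (Y := Y) (c := c) (U := U) (x := x) (t := t) n ω
        rw [← hq] at hqU
        by_cases h0 : 0 ≤ q.1
        · simp only [hΨ, if_pos (And.intro h0 (hqU h0))]
          by_cases h1 : q.2 - U < Y n ω + max (c * τ (n + 1) ω) 0
          · have hmem : ω ∈ chainCrosses τ Y c U x t n := ⟨h0, h1⟩
            have hch : chain τ Y c U x t (n + 1) ω = (-1, 0) := by
              rw [chain, chainStep, if_neg]
              rintro ⟨_, h2⟩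
              exact absurd h1 (not_lt.2 h2)
            rw [if_pos h1, Set.indicator_of_mem hmem, hch, potential, if_neg (by norm_num)]
            simp
          · have hmem : ω ∉ chainCrosses τ Y c U x t n := fun hc => h1 hc.2
            have hch : chain τ Y c U x t (n + 1) ω =
                (q.1 - τ (n + 1) ω, q.2 - (Y n ω + c * τ (n + 1) ω)) := by
              rw [chain, chainStep, if_pos ⟨h0, not_lt.1 h1⟩]
            rw [if_neg h1, Set.indicator_of_notMem hmem, hch, zero_add, potential]
            split_ifs
            · exact le_rfl
            · exact zero_le
        · have hmem : ω ∉ chainCrosses τ Y c U x t n := fun hc => h0 hc.1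
          have hch : chain τ Y c U x t (n + 1) ω = (-1, 0) := by
            rw [chain, chainStep, if_neg]
            exact fun h2 => h0 h2.1
          rw [Set.indicator_of_notMem hmem, hch, potential, if_neg (by norm_num)]
          simp
    _ = ∫⁻ ω, (∫⁻ ω', Ψ (chain τ Y c U x t n ω, (Y n ω', τ (n + 1) ω')) ∂μ) ∂μ :=
        (h.indepFun_past (measurable_past_chain c U x t n)).lintegral_comp_eq
          (h.measurable_chain c U x t n) hpair hΨm
    _ ≤ ∫⁻ ω, potential μ τ φ a (chain τ Y c U x t n ω) ∂μ := by
        refine lintegral_mono fun ω => ?_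
        set q := chain τ Y c U x t n ω with hq
        have e1 : ∫⁻ ω', Ψ (q, (Y n ω', τ (n + 1) ω')) ∂μ = ∫⁻ ω', Ψ (q, (Y 0 ω', τ 0 ω')) ∂μ := by
          have hm : Measurable fun p => Ψ (q, p) := hΨm.comp measurable_prodMk_left
          rw [← lintegral_map hm hpair, h.map_jump_tau n, lintegral_map hm hpair0]
        rw [e1]
        by_cases h0 : 0 ≤ q.1 ∧ U ≤ q.2
        · simp only [hΨ, if_pos h0]
          rw [potential, if_pos h0.1]
          exact hstep q.1 q.2 h0.1 h0.2
        · simp only [hΨ, if_neg h0]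
          simp

lemma measure_iUnion_chainCrosses_le {φ : ℝ → ℝ} (hφ : Antitone φ) {a c U x t : ℝ}
    (hstep : ∀ s u : ℝ, 0 ≤ s → U ≤ u →
      ∫⁻ ω, (if u - U < Y 0 ω + max (c * τ 0 ω) 0 then 1 else
        min 1 (ENNReal.ofReal (window φ a (renewal μ τ (s - τ 0 ω)) (u - (Y 0 ω + c * τ 0 ω))))) ∂μ
        ≤ min 1 (ENNReal.ofReal (window φ a (renewal μ τ s) u))) :
    μ (⋃ n, chainCrosses τ Y c U x t n) ≤
      ∫⁻ ω, potential μ τ φ a (chain τ Y c U x t 0 ω) ∂μ := by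
  have key : ∀ N : ℕ, ∑ n ∈ Finset.range N, μ (chainCrosses τ Y c U x t n) +
      ∫⁻ ω, potential μ τ φ a (chain τ Y c U x t N ω) ∂μ ≤
      ∫⁻ ω, potential μ τ φ a (chain τ Y c U x t 0 ω) ∂μ := by
    intro N
    induction N with
    | zero => simp
    | succ N ih =>
      rw [Finset.sum_range_succ, add_assoc]
      exact (add_le_add_right (h.measure_chainCrosses_add_le hφ hstep N) _).trans ih
  refine (measure_iUnion_le _).trans ?_
  rw [ENNReal.tsum_eq_iSup_nat]
  exact iSup_le fun N => le_self_add.trans (key N)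

/-- Jensen for the window, concave in its length, with the renewal equation `E H(t - τ) = m(t)`.
This is where the mean number of jumps, without the renewal at zero, enters the bound. -/
lemma lintegral_window_renewal_le {φ : ℝ → ℝ} (hφ : Antitone φ) (h0 : ∀ x, 0 ≤ φ x) {a : ℝ}
    (ha : 0 < a) (t u : ℝ) :
    ∫⁻ ω, ENNReal.ofReal (window φ a (renewal μ τ (t - τ 0 ω)) u) ∂μ ≤
      ENNReal.ofReal (window φ a (meanCount μ τ t) u) := by
  set m := meanCount μ τ t with hm
  set up : Ω → ℝ := fun ω =>
    (window φ a m u - m * φ (u + a * m)) + renewal μ τ (t - τ 0 ω) * φ (u + a * m) with hup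
  have hI : Integrable up μ :=
    (integrable_const _).add ((h.integrable_renewal_comp t).mul_const _)
  have hle : ∀ ω, window φ a (renewal μ τ (t - τ 0 ω)) u ≤ up ω := fun ω => by
    have := window_le_add hφ ha m (renewal μ τ (t - τ 0 ω)) u
    simp only [hup]; linarith
  have hE : ∫ ω, up ω ∂μ = window φ a m u := by
    have J := integral_add (μ := μ) (integrable_const (window φ a m u - m * φ (u + a * m)))
      ((h.integrable_renewal_comp t).mul_const (φ (u + a * m)))
    rw [hup, J, integral_mul_const, h.integral_renewal_comp]
    simp [hm]
  rw [← hE, ofReal_integral_eq_lintegral_ofReal hI (Eventually.of_forall fun ω =>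
    (window_nonneg h0 ha (h.renewal_nonneg _)).trans (hle ω))]
  exact lintegral_mono fun ω => ENNReal.ofReal_le_ofReal (hle ω)

/-- The probability of exceeding the level is bounded by the potential of the initial state, except
for the event that the drift alone brings the path close to the level. -/
lemma measure_runningMax_le {φ : ℝ → ℝ} (hφ : Antitone φ) {a c U x t : ℝ} (hU : 0 ≤ U)
    (hUx : U ≤ x) (ht : 0 ≤ t)
    (hstep : ∀ s u : ℝ, 0 ≤ s → U ≤ u →
      ∫⁻ ω, (if u - U < Y 0 ω + max (c * τ 0 ω) 0 then 1 else
        min 1 (ENNReal.ofReal (window φ a (renewal μ τ (s - τ 0 ω)) (u - (Y 0 ω + c * τ 0 ω))))) ∂μ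
        ≤ min 1 (ENNReal.ofReal (window φ a (renewal μ τ s) u))) :
    μ {ω | x < runningMax τ Y c t ω} ≤ μ {ω | x - U < c * τ 0 ω ∧ x - U < c * t} +
      ∫⁻ ω, potential μ τ φ a (chain τ Y c U x t 0 ω) ∂μ := by
  calc μ {ω | x < runningMax τ Y c t ω}
      ≤ μ ({ω | x - U < c * τ 0 ω ∧ x - U < c * t} ∪ ⋃ n, chainCrosses τ Y c U x t n) := by
        refine measure_mono_ae ?_
        filter_upwards [h.ae_tau_pos, h.ae_tendsto_epoch] with ω hpos htop hω
        rcases exists_chainCrosses hpos htop hU hUx hω ht with h1 | h1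
        · exact Or.inl h1
        · exact Or.inr (Set.mem_iUnion.2 h1)
    _ ≤ _ := (measure_union_le _ _).trans
        (add_le_add_right (h.measure_iUnion_chainCrosses_le hφ hstep) _)

/-- The potential is nonzero only if `τ 0 ≤ t`, and then the drift before the first jump brings the
level closer by at most `ρ`. -/
lemma lintegral_potential_le_of_lt {φ : ℝ → ℝ} (hφ : Antitone φ) (h0 : ∀ x, 0 ≤ φ x)
    {a c U x t ρ : ℝ} (ha : 0 < a) (hρ : 0 ≤ ρ) (hct : c * t < ρ) :
    ∫⁻ ω, potential μ τ φ a (chain τ Y c U x t 0 ω) ∂μ ≤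
      ENNReal.ofReal (window φ a (meanCount μ τ t) (x - ρ)) := by
  refine le_trans (lintegral_mono_ae ?_) (h.lintegral_window_renewal_le hφ h0 ha t (x - ρ))
  filter_upwards [h.ae_tau_pos] with ω hpos
  simp only [chain, potential]
  split_ifs with h1 h2 h2
  · refine (min_le_right _ _).trans (ENNReal.ofReal_le_ofReal ?_)
    refine window_antitone hφ ha (h.renewal_nonneg _) ?_
    show x - ρ ≤ x - c * τ 0 ω
    have h3 : τ 0 ω ≤ t := by
      have : 0 ≤ t - τ 0 ω := h2
      linarith
    rcases le_total c 0 with hc | hc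
    · nlinarith [hpos 0]
    · nlinarith
  · exact zero_le
  · norm_num at h2
  · exact zero_le

/-- Split according to `c * τ 0`. Up to `ρ`, the level is shifted by `ρ`. Between `ρ` and `x - ρ`,
the window gains the layer `[x - ρ, x]`, weighted by `P(cτ > ρ)`, and deeper layers that average to
a convolution integral. Beyond `x - ρ`, the potential is at most one. -/
lemma lintegral_potential_le {G φ : ℝ → ℝ} (hG : IsStrongTail G) (hφ : Antitone φ)
    (h0 : ∀ x, 0 ≤ φ x) {K : ℝ} (hK : 0 ≤ K) (hφK : ∀ v, φ v ≤ K * G v)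
    {a c U x t ρ e₁ e₂ : ℝ} (ha : 0 < a) (hρ : 0 ≤ ρ) (hρx : ρ ≤ x - ρ)
    (hτG : ∀ z, ρ ≤ z → μ.real {ω | z < c * τ 0 ω} ≤ e₁ * G z) (he₁ : e₁ ≤ 1)
    (hconv : ∫ z in ρ..(x - ρ), G z * G (x - z) ≤ e₂ * G x) :
    ∫⁻ ω, potential μ τ φ a (chain τ Y c U x t 0 ω) ∂μ ≤
      ENNReal.ofReal (window φ a (meanCount μ τ t) (x - ρ)) +
      ENNReal.ofReal (1 / a * (ρ * φ (x - ρ)) * (e₁ * G ρ)) +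
      ENNReal.ofReal (1 / a * K * (e₂ * G x)) + ENNReal.ofReal (e₁ * G (x - ρ)) := by
  have hX : Measurable fun ω => c * τ 0 ω := (h.measurable_tau 0).const_mul c
  have hS : ∀ z, MeasurableSet {ω | z < c * τ 0 ω} := fun z => measurableSet_lt measurable_const hX
  have hGnn : ∀ v, 0 ≤ G v := fun v => (hG.pos v).le
  set T₁ : Ω → ENNReal := fun ω => ENNReal.ofReal (window φ a (renewal μ τ (t - τ 0 ω)) (x - ρ))
  set T₂ : Ω → ENNReal := Set.indicator {ω | ρ < c * τ 0 ω}
    fun _ => ENNReal.ofReal (1 / a * (ρ * φ (x - ρ)))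
  set T₃ : Ω → ENNReal := fun ω => ENNReal.ofReal (1 / a * K) *
    ENNReal.ofReal (if ρ < c * τ 0 ω ∧ c * τ 0 ω ≤ x - ρ then ∫ z in ρ..(c * τ 0 ω), G (x - z) else 0)
  set T₄ : Ω → ENNReal := Set.indicator {ω | x - ρ < c * τ 0 ω} 1
  have hT₁m : Measurable T₁ := by
    have : Measurable fun ω => ((t - τ 0 ω, x - ρ) : ℝ × ℝ) :=
      (measurable_const.sub (h.measurable_tau 0)).prodMk measurable_const
    exact ((h.measurable_window_renewal hφ a).comp this).ennreal_ofReal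
  have hT₂m : Measurable T₂ := measurable_const.indicator (hS _)
  have hT₄m : Measurable T₄ := measurable_one.indicator (hS _)
  have hpt : ∀ ω, potential μ τ φ a (chain τ Y c U x t 0 ω) ≤ T₁ ω + T₂ ω + T₃ ω + T₄ ω := by
    intro ω
    have hle1 : potential μ τ φ a (chain τ Y c U x t 0 ω) ≤ 1 := by
      rw [potential]; split_ifs
      · exact min_le_left _ _
      · exact zero_le
    have hleW : potential μ τ φ a (chain τ Y c U x t 0 ω) ≤
        ENNReal.ofReal (window φ a (renewal μ τ (t - τ 0 ω)) (x - c * τ 0 ω)) := by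
      simp only [chain, potential]
      split_ifs with h1 h2 h2
      · exact min_le_right _ _
      · exact zero_le
      · norm_num at h2
      · exact zero_le
    have hR := h.renewal_nonneg (t - τ 0 ω)
    by_cases h1 : x - ρ < c * τ 0 ω
    · have : T₄ ω = 1 := Set.indicator_of_mem (by exact h1) _
      rw [this]
      exact hle1.trans le_add_self
    by_cases h2 : ρ < c * τ 0 ω
    · have e2 : T₂ ω = ENNReal.ofReal (1 / a * (ρ * φ (x - ρ))) :=
        Set.indicator_of_mem (by exact h2) _
      have e3 : T₃ ω = ENNReal.ofReal (1 / a * K * ∫ z in ρ..(c * τ 0 ω), G (x - z)) := by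
        simp only [T₃]
        rw [if_pos ⟨h2, not_lt.1 h1⟩, ENNReal.ofReal_mul (p := 1 / a * K) (by positivity)]
      refine le_trans ?_ le_self_add
      have hmφ : Monotone fun v => φ (x - v) := fun p q hpq => hφ (by linarith)
      have hmG : Monotone fun v => G (x - v) := fun p q hpq => hG.antitone (by linarith)
      have w1 := window_comp_sub_le (u := x) hφ h0 ha hR (z := c * τ 0 ω) (by linarith)
      have w2 : window φ a (renewal μ τ (t - τ 0 ω)) x ≤
          window φ a (renewal μ τ (t - τ 0 ω)) (x - ρ) :=
        window_antitone hφ ha hR (by linarith)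
      have w3 : ∫ v in (0 : ℝ)..ρ, φ (x - v) ≤ ρ * φ (x - ρ) := by
        have := intervalIntegral.integral_mono_on hρ hmφ.intervalIntegrable
          (g := fun _ => φ (x - ρ)) (by simp) (μ := volume) fun v hv => hφ (by linarith [hv.2])
        simpa using this
      have w4 : ∫ v in ρ..(c * τ 0 ω), φ (x - v) ≤ K * ∫ v in ρ..(c * τ 0 ω), G (x - v) := by
        rw [← intervalIntegral.integral_const_mul]
        exact intervalIntegral.integral_mono_on h2.le hmφ.intervalIntegrable
          (hmG.intervalIntegrable.const_mul _) fun v _ => hφK _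
      have w5 := intervalIntegral.integral_add_adjacent_intervals (μ := volume)
        (hmφ.intervalIntegrable (a := 0) (b := ρ))
        (hmφ.intervalIntegrable (a := ρ) (b := c * τ 0 ω))
      have w6 : 0 ≤ ∫ v in ρ..(c * τ 0 ω), G (x - v) :=
        intervalIntegral.integral_nonneg h2.le fun v _ => hGnn _
      rw [e2, e3]
      simp only [T₁]
      rw [← ENNReal.ofReal_add (window_nonneg h0 ha hR)
        (mul_nonneg (by positivity) (mul_nonneg hρ (h0 _))), ← ENNReal.ofReal_add
        (add_nonneg (window_nonneg h0 ha hR) (mul_nonneg (by positivity) (mul_nonneg hρ (h0 _))))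
        (mul_nonneg (by positivity) w6)]
      refine hleW.trans (ENNReal.ofReal_le_ofReal ?_)
      have w7 : 1 / a * ∫ v in (0 : ℝ)..(c * τ 0 ω), φ (x - v) ≤
          1 / a * (ρ * φ (x - ρ) + K * ∫ v in ρ..(c * τ 0 ω), G (x - v)) :=
        mul_le_mul_of_nonneg_left (by linarith) (by positivity)
      linarith
    · refine le_trans ?_ (le_self_add.trans (le_self_add.trans le_self_add))
      exact hleW.trans (ENNReal.ofReal_le_ofReal
        (window_antitone hφ ha hR (by linarith [not_lt.1 h2])))
  have hT₃ : ∫⁻ ω, T₃ ω ∂μ ≤ ENNReal.ofReal (1 / a * K * (e₂ * G x)) := by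
    have := lintegral_conv_le (μ := μ) hG.antitone hGnn hX hρx (C := 1)
      (fun z hz => (hτG z hz).trans (mul_le_mul_of_nonneg_right he₁ (hGnn z))) x
    rw [lintegral_const_mul' _ _ ENNReal.ofReal_ne_top,
      ENNReal.ofReal_mul (p := 1 / a * K) (by positivity)]
    refine mul_le_mul_right (this.trans (ENNReal.ofReal_le_ofReal ?_)) _
    rw [one_mul]; exact hconv
  have hT₁₂m : Measurable fun ω => T₁ ω + T₂ ω := hT₁m.add hT₂m
  calc _ ≤ ∫⁻ ω, (T₁ ω + T₂ ω + T₃ ω + T₄ ω) ∂μ := lintegral_mono hpt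
    _ = ∫⁻ ω, T₁ ω ∂μ + ∫⁻ ω, T₂ ω ∂μ + ∫⁻ ω, T₃ ω ∂μ + ∫⁻ ω, T₄ ω ∂μ := by
        rw [lintegral_add_right _ hT₄m, lintegral_add_left hT₁₂m,
          lintegral_add_left hT₁m]
    _ ≤ _ := by
        refine add_le_add (add_le_add (add_le_add
          (h.lintegral_window_renewal_le hφ h0 ha t (x - ρ)) ?_) hT₃) ?_
        · rw [lintegral_indicator_const (hS _), ← ofReal_measureReal,
            ← ENNReal.ofReal_mul (mul_nonneg (by positivity) (mul_nonneg hρ (h0 _)))]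
          exact ENNReal.ofReal_le_ofReal (mul_le_mul_of_nonneg_left (hτG ρ le_rfl)
            (mul_nonneg (by positivity) (mul_nonneg hρ (h0 _))))
        · rw [lintegral_indicator_one (hS _), ← ofReal_measureReal]
          exact ENNReal.ofReal_le_ofReal (hτG _ hρx)

end IsInput

end CompoundRenewal

/-! ### The uniform upper bound. -/

namespace CompoundRenewal.IsInput

variable {Ω : Type*} [MeasurableSpace Ω] {μ : Measure Ω} [IsProbabilityMeasure μ]
  {τ Y : ℕ → Ω → ℝ}

lemma exists_mul_le_of_isStrongTail {G : ℝ → ℝ} (hG : IsStrongTail G) :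
    ∃ m, 0 < m ∧ ∀ ρ, 0 ≤ ρ → ρ * G ρ ≤ m := by
  refine ⟨(∫ v in Set.Ioi (0 : ℝ), G v) + 1, ?_, fun ρ hρ => ?_⟩
  · have : 0 ≤ ∫ v in Set.Ioi (0 : ℝ), G v :=
      setIntegral_nonneg measurableSet_Ioi fun v _ => (hG.pos v).le
    linarith
  · have h1 := hG.antitone.mul_le_integral 0 ρ
    have h2 : ∫ v in (0 : ℝ)..ρ, G v ≤ ∫ v in Set.Ioi (0 : ℝ), G v := by
      rw [intervalIntegral.integral_of_le hρ]
      exact setIntegral_mono_set hG.integrableOn (Eventually.of_forall fun z => (hG.pos z).le)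
        (Set.Ioc_subset_Ioi_self.eventuallyLE)
    linarith

variable (h : IsInput μ τ Y)
include h

set_option maxHeartbeats 800000 in
/-- The uniform upper bound for the tail of the running maximum. -/
theorem exists_runningMax_le {G : ℝ → ℝ} (hG : IsStrongTail G) {c a ε : ℝ}
    (hYG : ∀ x, μ.real {ω | x < Y 0 ω} ≤ G x)
    (hτG : ∀ e : ℝ, 0 < e → ∃ x₀, ∀ x, x₀ ≤ x → μ.real {ω | x < c * τ 0 ω} ≤ e * G x)
    (ha : 0 < a) (hmean : ∫ ω, (Y 0 ω + c * τ 0 ω) ∂μ = -a) (hε : 0 < ε) :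
    ∃ x₀, ∀ x, x₀ ≤ x → ∀ t, 0 < t →
      μ.real {ω | x < runningMax τ Y c t ω} ≤ (1 + ε) * window G a (meanCount μ τ t) x := by
  have hτm := h.measurable_tau 0
  have hYm := h.measurable_jump 0
  have hGnn : ∀ v, 0 ≤ G v := fun v => (hG.pos v).le
  have hηG : ∀ e : ℝ, 0 < e → ∃ x₀, ∀ u, x₀ ≤ u →
      μ.real {ω | u < Y 0 ω + max (c * τ 0 ω) 0} ≤ (1 + e) * G u := by
    intro e he
    have hind : IndepFun (fun ω => max (c * τ 0 ω) 0) (Y 0) μ :=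
      (h.indepFun_jump_tau 0 0).symm.comp (φ := fun z => max (c * z) 0) (ψ := id) (by fun_prop)
        measurable_id
    refine hG.tail_add_le (θ := fun ω => max (c * τ 0 ω) 0) hYm (by fun_prop) hind hYG ?_ he
    intro e he
    obtain ⟨x₀, hx₀⟩ := hτG e he
    refine ⟨max x₀ 0, fun x hx => ?_⟩
    rw [max_le_iff] at hx
    have : {ω | x < max (c * τ 0 ω) 0} = {ω | x < c * τ 0 ω} := by
      ext ω; simp [hx.2.not_gt]
    rw [this]
    exact hx₀ x hx.1
  set e := min ε 1 / 9 with he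
  have he0 : 0 < e := by positivity
  have he1 : e ≤ 1 / 9 := by rw [he]; linarith [min_le_right ε 1]
  have he2 : 9 * e ≤ ε := by rw [he]; linarith [min_le_left ε 1]
  have haux : (1 + 3 * e) * (1 + e) ≤ 2 := by nlinarith
  have haux1 : 1 + 4 * e + 3 * e ^ 2 ≤ 1 + ε := by nlinarith
  have haux2 : 1 + 5 * e + 3 * e ^ 2 ≤ 1 + ε := by nlinarith
  obtain ⟨φ, U, X, K, hφ, hφ0, hφK, hφX, hU, hstep⟩ := hG.exists_potential (μ := μ)
    (ξ := fun ω => Y 0 ω + c * τ 0 ω) (η := fun ω => Y 0 ω + max (c * τ 0 ω) 0)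
    (by fun_prop) (by fun_prop) (fun ω => add_le_add_right (le_max_left _ _) _)
    (h.integrable_jump.add (h.integrable_tau.const_mul c)) ha hmean hηG he0 (by linarith)
  have hstep' : ∀ s u : ℝ, 0 ≤ s → U ≤ u →
      ∫⁻ ω, (if u - U < Y 0 ω + max (c * τ 0 ω) 0 then 1 else
        min 1 (ENNReal.ofReal (window φ a (renewal μ τ (s - τ 0 ω)) (u - (Y 0 ω + c * τ 0 ω))))) ∂μ
        ≤ min 1 (ENNReal.ofReal (window φ a (renewal μ τ s) u)) := fun s u hs hu =>
    hstep u (renewal μ τ s) (fun ω => renewal μ τ (s - τ 0 ω)) hu (h.renewal_nonneg _)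
      (fun ω => h.renewal_nonneg _) (h.integrable_renewal_comp s) (by
        rw [h.integral_renewal_comp, h.renewal_eq hs]; ring)
  have hK0 : 0 ≤ K := by
    by_contra hK
    have h1 := (hφ0 0).trans (hφK 0)
    have h2 := hG.pos 0
    nlinarith
  -- a time after which the mean number of jumps is bounded below
  obtain ⟨κ, t₁, hκ0, hκ⟩ : ∃ κ t₁ : ℝ, 0 < κ ∧ ∀ t, t₁ ≤ t → κ ≤ meanCount μ τ t := by
    obtain ⟨t₁, ht₁, H⟩ := h.exists_le_meanCount (ε := 1 / 2) (by norm_num) (by norm_num)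
    have hp := h.mean_tau_pos
    exact ⟨(1 - 1 / 2) * (t₁ / ∫ ω, τ 0 ω ∂μ), t₁, by positivity, fun t ht =>
      (H t₁ le_rfl).trans (h.meanCount_mono ht)⟩
  obtain ⟨m, hm0, hm⟩ := exists_mul_le_of_isStrongTail hG
  -- the error budget, as a multiple of the tail
  set b := e * κ / 2 with hb
  have hb0 : 0 < b := by positivity
  -- The cutoff `ρ` will depend on `e₁`. The bound `ρ * G ρ ≤ m`, valid for every `ρ ≥ 0`, avoids
  -- circularity.
  set e₁ := min (b / 8) (min 1 (b * a / (8 * m))) with he₁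
  have he₁0 : 0 < e₁ := lt_min (by positivity) (lt_min one_pos (by positivity))
  have he₁1 : e₁ ≤ 1 := (min_le_right _ _).trans (min_le_left _ _)
  have he₁b : e₁ ≤ b / 8 := min_le_left _ _
  have he₁m : e₁ * (8 * m) ≤ b * a := by
    rw [← le_div_iff₀ (by positivity)]
    exact (min_le_right _ _).trans (min_le_right _ _)
  set e₂ := b * a / (4 * (K + 1)) with he₂
  have he₂0 : 0 < e₂ := by positivity
  have he₂K : K * e₂ ≤ b * a / 4 := by
    have : (K + 1) * e₂ = b * a / 4 := by rw [he₂]; field_simp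
    nlinarith
  obtain ⟨z₀, hz₀⟩ := hτG e₁ he₁0
  obtain ⟨L, xL, hL0, hL⟩ := hG.conv e₂ he₂0
  -- The second entry ensures that `c * t ≥ ρ` forces `t ≥ t₁`.
  set ρ := max (max z₀ L) (|c| * |t₁| + 1) with hρ
  have hρz : z₀ ≤ ρ := (le_max_left _ _).trans (le_max_left _ _)
  have hρL : L ≤ ρ := (le_max_right _ _).trans (le_max_left _ _)
  have hρt : |c| * |t₁| + 1 ≤ ρ := le_max_right _ _
  have hρ0 : 0 ≤ ρ := hL0.trans hρL
  obtain ⟨x₁, hx₁⟩ := hG.long_tailed ρ e he0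
  obtain ⟨x₂, hx₂⟩ := hG.long_tailed U 1 one_pos
  obtain ⟨x₃, hx₃⟩ := hG.long_tailed (a * κ) 1 one_pos
  refine ⟨max (max (max (x₁ + ρ) (x₂ + U)) (max x₃ xL)) (max (max (X + ρ) (2 * ρ)) (max (ρ + U)
    (z₀ + U))), fun x hx t ht => ?_⟩
  simp only [max_le_iff] at hx
  obtain ⟨⟨⟨hx1, hx2⟩, hx3, hxL⟩, ⟨hxX, hxρ⟩, hxU, hxz⟩ := hx
  set M := meanCount μ τ t with hM
  have hM0 : 0 ≤ M := h.meanCount_nonneg t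
  have hW0 : 0 ≤ window G a M x := window_nonneg hGnn ha hM0
  have hGx : 0 < G x := hG.pos x
  have hflat : ∀ v, x ≤ v → G (v - ρ) ≤ (1 + e) * G v := fun v hv => by
    have := hx₁ (v - ρ) (by linarith)
    rwa [sub_add_cancel] at this
  have hwin : window φ a M (x - ρ) ≤ (1 + 4 * e + 3 * e ^ 2) * window G a M x := by
    have h1 : window φ a M (x - ρ) = window (fun v => φ (v + -ρ)) a M x := by
      rw [sub_eq_add_neg, window_comp_add]
    rw [h1, ← window_const_mul]
    refine window_le_window (fun p q hpq => hφ (by linarith))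
      (fun p q hpq => mul_le_mul_of_nonneg_left (hG.antitone hpq) (by positivity)) ha hM0 ?_
    intro v hv
    rw [← sub_eq_add_neg, hφX _ (by linarith)]
    have := mul_le_mul_of_nonneg_left (hflat v hv) (show 0 ≤ 1 + 3 * e by positivity)
    calc _ ≤ _ := this
      _ = _ := by ring
  have hmain := h.measure_runningMax_le hφ (x := x) (t := t) (c := c) hU (by linarith) ht.le hstep'
  -- As `t → 0` the window becomes much smaller than `G x`, so errors of order `G x` are not
  -- allowed. They occur only when `c * t ≥ ρ`, and then `meanCount ≥ κ` makes the window at least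
  -- `κ / 2 * G x`.
  by_cases hct : c * t < ρ
  · have h1 : {ω | x - U < c * τ 0 ω ∧ x - U < c * t} = ∅ := by
      ext ω
      simp only [Set.mem_ofPred_eq, Set.mem_empty_iff_false, iff_false, not_and]
      intro _
      linarith
    rw [h1, measure_empty, zero_add] at hmain
    have h2 := hmain.trans (h.lintegral_potential_le_of_lt hφ hφ0 ha hρ0 hct)
    have h3 := ENNReal.toReal_le_of_le_ofReal (window_nonneg hφ0 ha hM0) h2
    exact h3.trans (hwin.trans (mul_le_mul_of_nonneg_right haux1 hW0))
  · push Not at hct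
    have ht1 : t₁ ≤ t := by
      by_contra hlt
      push Not at hlt
      have h1 : c * t ≤ |c| * t := mul_le_mul_of_nonneg_right (le_abs_self c) ht.le
      have h2 : |c| * t ≤ |c| * |t₁| :=
        mul_le_mul_of_nonneg_left (hlt.le.trans (le_abs_self _)) (abs_nonneg c)
      linarith
    have hP : μ.real {ω | x - U < c * τ 0 ω ∧ x - U < c * t} ≤ b / 4 * G x := by
      have h1 : μ.real {ω | x - U < c * τ 0 ω ∧ x - U < c * t} ≤ e₁ * G (x - U) :=
        (measureReal_mono fun ω hω => hω.1).trans (hz₀ _ (by linarith))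
      have h2 := hx₂ (x - U) (by linarith)
      rw [sub_add_cancel] at h2
      have h3 := mul_le_mul he₁b h2 (hGnn _) (by positivity)
      linarith
    have hpot := h.lintegral_potential_le (U := U) (t := t) (x := x) (ρ := ρ) (c := c) hG hφ hφ0
      hK0 hφK ha hρ0 (by linarith) (fun z hz => hz₀ z (hρz.trans hz)) he₁1
      (hL ρ hρL x hxL (by linarith))
    have hflatx := hflat x le_rfl
    have hflat2 : G (x - ρ) ≤ 2 * G x :=
      hflatx.trans (mul_le_mul_of_nonneg_right (by linarith) hGx.le)
    have hE2 : 1 / a * (ρ * φ (x - ρ)) * (e₁ * G ρ) ≤ b / 4 * G x := by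
      rw [hφX _ (by linarith)]
      have h1 : (1 + 3 * e) * G (x - ρ) ≤ 2 * G x := by
        have h2 := mul_le_mul_of_nonneg_left hflatx (show 0 ≤ 1 + 3 * e by positivity)
        have h3 := mul_le_mul_of_nonneg_right haux hGx.le
        linarith
      have h2 : ρ * G ρ * ((1 + 3 * e) * G (x - ρ)) ≤ m * (2 * G x) :=
        mul_le_mul (hm ρ hρ0) h1 (mul_nonneg (by positivity) (hGnn _)) hm0.le
      have h3 : 1 / a * (ρ * ((1 + 3 * e) * G (x - ρ))) * (e₁ * G ρ) =
          1 / a * e₁ * (ρ * G ρ * ((1 + 3 * e) * G (x - ρ))) := by ring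
      rw [h3]
      have h4 := mul_le_mul_of_nonneg_left h2 (show 0 ≤ 1 / a * e₁ by positivity)
      refine h4.trans ?_
      have h5 : 1 / a * e₁ * (m * (2 * G x)) = e₁ * (8 * m) * (G x / (4 * a)) := by
        field_simp; ring
      rw [h5]
      refine (mul_le_mul_of_nonneg_right he₁m (by positivity)).trans (le_of_eq ?_)
      field_simp
    have hE3 : 1 / a * K * (e₂ * G x) ≤ b / 4 * G x := by
      have h1 : 1 / a * K * (e₂ * G x) = K * e₂ * (G x / a) := by field_simp
      rw [h1]
      refine (mul_le_mul_of_nonneg_right he₂K (by positivity)).trans (le_of_eq ?_)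
      field_simp
    have hE4 : e₁ * G (x - ρ) ≤ b / 4 * G x := by
      have h3 := mul_le_mul he₁b hflat2 (hGnn _) (by positivity)
      linarith
    have hbud : b * G x ≤ e * window G a M x := by
      have h1 : κ * G (x + a * κ) ≤ window G a κ x := mul_le_window hG.antitone ha κ x
      have h2 := window_mono (u := x) hG.antitone hGnn ha (hκ t ht1)
      have h3 := hx₃ x hx3
      have h4 : κ / 2 * G x ≤ window G a M x := by
        have := mul_le_mul_of_nonneg_left h3 hκ0.le
        linarith
      calc b * G x = e * (κ / 2 * G x) := by rw [hb]; ring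
        _ ≤ _ := mul_le_mul_of_nonneg_left h4 he0.le
    have hWφ := window_nonneg (u := x - ρ) hφ0 ha hM0
    have hfin : μ {ω | x < runningMax τ Y c t ω} ≤ ENNReal.ofReal (b / 4 * G x +
        (window φ a M (x - ρ) + b / 4 * G x + b / 4 * G x + b / 4 * G x)) := by
      have hq : 0 ≤ b / 4 * G x := by positivity
      rw [ENNReal.ofReal_add hq (by positivity), ENNReal.ofReal_add (by positivity) hq,
        ENNReal.ofReal_add (by positivity) hq, ENNReal.ofReal_add hWφ hq]
      refine hmain.trans (add_le_add ?_ (hpot.trans ?_))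
      · rw [← ofReal_measureReal]
        exact ENNReal.ofReal_le_ofReal hP
      · exact add_le_add (add_le_add (add_le_add le_rfl (ENNReal.ofReal_le_ofReal hE2))
          (ENNReal.ofReal_le_ofReal hE3)) (ENNReal.ofReal_le_ofReal hE4)
    have h3 := ENNReal.toReal_le_of_le_ofReal (by positivity) hfin
    have h4 : (1 + 5 * e + 3 * e ^ 2) * window G a M x ≤ (1 + ε) * window G a M x :=
      mul_le_mul_of_nonneg_right haux2 hW0
    have h5 : μ.real {ω | x < runningMax τ Y c t ω} ≤ _ := h3
    linarith

end CompoundRenewal.IsInput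

/-! ### Windows compared with sums, and their decay. -/

section WindowSums

variable {φ : ℝ → ℝ} {a : ℝ}

lemma window_succ (hφ : Antitone φ) (J : ℕ) (u : ℝ) :
    window φ a (J + 1 : ℕ) u = window φ a J u + window φ a 1 (u + a * J) := by
  have hii : ∀ p q : ℝ, IntervalIntegrable φ volume p q := fun p q => hφ.intervalIntegrable
  rw [window, window, window, ← mul_add,
    ← intervalIntegral.integral_add_adjacent_intervals (hii u (u + a * J)) (hii _ _)]
  push_cast
  rw [show u + a * ((J : ℝ) + 1) = u + a * J + a * 1 by ring]

lemma window_le_sum (hφ : Antitone φ) (ha : 0 < a) (J : ℕ) (u : ℝ) :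
    window φ a J u ≤ ∑ n ∈ Finset.range J, φ (u + a * n) := by
  induction J with
  | zero => simp
  | succ J ih =>
    rw [window_succ hφ, Finset.sum_range_succ]
    exact add_le_add ih (by simpa using window_le_mul hφ ha 1 (u + a * J))

lemma sum_le_window (hφ : Antitone φ) (ha : 0 < a) (J : ℕ) (u : ℝ) :
    ∑ n ∈ Finset.range J, φ (u + a * (n + 1)) ≤ window φ a J u := by
  induction J with
  | zero => simp
  | succ J ih =>
    rw [window_succ hφ, Finset.sum_range_succ]
    refine add_le_add ih ?_
    have := mul_le_window hφ ha 1 (u + a * J)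
    rwa [one_mul, show u + a * J + a * 1 = u + a * (J + 1) by ring] at this

lemma IsStrongTail.tendsto_zero {G : ℝ → ℝ} (hG : IsStrongTail G) :
    ∀ e : ℝ, 0 < e → ∃ x₀, ∀ x, x₀ ≤ x → G x ≤ e := by
  intro e he
  obtain ⟨m, hm0, hm⟩ := CompoundRenewal.IsInput.exists_mul_le_of_isStrongTail hG
  refine ⟨m / e, fun x hx => ?_⟩
  have hx0 : 0 < x := (div_pos hm0 he).trans_le hx
  rw [div_le_iff₀ he] at hx
  have := hm x hx0.le
  exact le_of_mul_le_mul_left (this.trans hx) hx0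

lemma IsStrongTail.window_le {G : ℝ → ℝ} (hG : IsStrongTail G) (ha : 0 < a) :
    ∀ e : ℝ, 0 < e → ∃ x₀, ∀ x, x₀ ≤ x → ∀ r, 0 ≤ r → window G a r x ≤ e := by
  intro e he
  have hlim := intervalIntegral_tendsto_integral_Ioi 0 hG.integrableOn tendsto_id
  set m := ∫ y in Set.Ioi (0 : ℝ), G y
  obtain ⟨x₀, hx₀⟩ := eventually_atTop.1 (hlim.eventually
    (eventually_ge_nhds (show m - a * e < m by nlinarith)))
  refine ⟨max x₀ 0, fun x hx r hr => ?_⟩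
  rw [max_le_iff] at hx
  have hsub : Set.Ioi x ⊆ Set.Ioi (0 : ℝ) := Set.Ioi_subset_Ioi hx.2
  have a1 : ∫ v in x..(x + a * r), G v ≤ ∫ v in Set.Ioi x, G v := by
    rw [intervalIntegral.integral_of_le (by nlinarith)]
    exact setIntegral_mono_set (hG.integrableOn.mono_set hsub)
      (Eventually.of_forall fun z => (hG.pos z).le) (Set.Ioc_subset_Ioi_self.eventuallyLE)
  have a2 : (∫ z in (0 : ℝ)..x, G z) + ∫ z in Set.Ioi x, G z = m :=
    intervalIntegral.integral_interval_add_Ioi hG.integrableOn (hG.integrableOn.mono_set hsub)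
  have a3 := hx₀ x hx.1
  simp only [id] at a3
  refine le_of_mul_le_mul_left ?_ ha
  rw [mul_window ha]
  linarith

end WindowSums

/-! ### The uniform lower bound. -/

namespace CompoundRenewal.IsInput

variable {Ω : Type*} [MeasurableSpace Ω] {μ : Measure Ω} [IsProbabilityMeasure μ]
  {τ Y : ℕ → Ω → ℝ} (h : IsInput μ τ Y)
include h

lemma measureReal_past_inter {n : ℕ} {q : Ω → ℝ × ℝ} (hq : Measurable[past τ Y n] q)
    {S : Set (ℝ × ℝ)} (hS : MeasurableSet S) (y : ℝ) :
    μ.real (q ⁻¹' S ∩ {ω | y < Y n ω}) = μ.real (q ⁻¹' S) * μ.real {ω | y < Y 0 ω} := by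
  have h1 := (h.indepFun_past hq).measure_inter_preimage_eq_mul S (Set.Ioi y ×ˢ Set.univ) hS
    (measurableSet_Ioi.prod MeasurableSet.univ)
  have h2 : (fun ω => (Y n ω, τ (n + 1) ω)) ⁻¹' (Set.Ioi y ×ˢ Set.univ) = {ω | y < Y n ω} := by
    ext; simp
  rw [h2] at h1
  have h3 : μ {ω | y < Y n ω} = μ {ω | y < Y 0 ω} :=
    (h.identDistrib_jump n).measure_mem_eq measurableSet_Ioi
  rw [measureReal_def, h1, h3, ENNReal.toReal_mul]
  rfl

lemma measureReal_epoch_inter {n : ℕ} {t : ℝ} {f : (ℕ → ℝ) → ℝ} (hf : Measurable f) {S : Set ℝ}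
    (hS : MeasurableSet S) :
    μ.real ({ω | epoch τ n ω ≤ t} ∩ (fun ω => f fun i => Y i ω) ⁻¹' S) =
      epochCdf μ τ n t * μ.real ((fun ω => f fun i => Y i ω) ⁻¹' S) := by
  have h1 := (h.indep_tau_jump.comp (φ := fun x : ℕ → ℝ => ∑ i ∈ Finset.range n, x i) (ψ := f)
    (Finset.measurable_sum _ fun i _ => measurable_pi_apply i) hf).measure_inter_preimage_eq_mul
      (Set.Iic t) S measurableSet_Iic hS
  have h2 : ((fun x : ℕ → ℝ => ∑ i ∈ Finset.range n, x i) ∘ fun ω n => τ n ω) ⁻¹' Set.Iic t =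
      {ω | epoch τ n ω ≤ t} := rfl
  rw [h2] at h1
  rw [measureReal_def]
  refine (congrArg ENNReal.toReal h1).trans ?_
  rw [ENNReal.toReal_mul]
  rfl

/-- A lower bound from the disjoint events that the `n`-th jump is the first one to exceed
`x + d n`, while the path before that jump is not below `-d n`. -/
lemma sum_le_measureReal_runningMax {G : ℝ → ℝ} (hGnn : ∀ v, 0 ≤ G v)
    (hYG : ∀ x, 0 ≤ x → μ.real {ω | x < Y 0 ω} = G x) {c t x : ℝ} (ht : 0 ≤ t) {d : ℕ → ℝ}
    (hd : ∀ n, 0 ≤ x + d n) (J : ℕ) :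
    ∑ n ∈ Finset.range J, (μ.real {ω | epoch τ (n + 1) ω ≤ t ∧
        -d n ≤ ∑ i ∈ Finset.range n, Y i ω + c * epoch τ (n + 1) ω} -
      epochCdf μ τ (n + 1) t * ∑ j ∈ Finset.range J, G (x + d j)) * G (x + d n) ≤
      μ.real {ω | x < runningMax τ Y c t ω} := by
  set Γ : ℕ → Set Ω := fun n => {ω | epoch τ (n + 1) ω ≤ t ∧
        -d n ≤ ∑ i ∈ Finset.range n, Y i ω + c * epoch τ (n + 1) ω} with hΓ
  set B : ℕ → Set Ω := fun n => {ω | x + d n < Y n ω} with hB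
  have hBm : ∀ n, MeasurableSet (B n) := fun n =>
    measurableSet_lt measurable_const (h.measurable_jump n)
  have hΓm : ∀ n, MeasurableSet (Γ n) := fun n =>
    (measurableSet_le (h.measurable_epoch _) measurable_const).inter
      (measurableSet_le measurable_const ((Finset.measurable_sum _ fun i _ =>
        h.measurable_jump i).add ((h.measurable_epoch _).const_mul c)))
  set A : ℕ → Set Ω := fun n => (Γ n ∩ B n) \ ⋃ j ∈ Finset.range n, B j with hA
  have hAm : ∀ n, MeasurableSet (A n) := fun n =>
    ((hΓm n).inter (hBm n)).diff (Finset.measurableSet_biUnion _ fun j _ => hBm j)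
  have hΓB : ∀ n, μ.real (Γ n ∩ B n) = μ.real (Γ n) * G (x + d n) := fun n => by
    have hq : Measurable[past τ Y n] fun ω =>
        (epoch τ (n + 1) ω, ∑ i ∈ Finset.range n, Y i ω + c * epoch τ (n + 1) ω) := by
      have h1 : Measurable[past τ Y n] (epoch τ (n + 1)) := measurable_past_epoch le_rfl
      have h2 : Measurable[past τ Y n] fun ω => ∑ i ∈ Finset.range n, Y i ω :=
        Finset.measurable_sum _ fun i hi => measurable_past_jump (by simpa using hi)
      exact h1.prodMk (h2.add (h1.const_mul c))
    have := h.measureReal_past_inter hq (S := {p | p.1 ≤ t ∧ -d n ≤ p.2})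
      ((measurableSet_le measurable_fst measurable_const).inter
        (measurableSet_le measurable_const measurable_snd)) (x + d n)
    rw [hYG _ (hd n)] at this
    exact this
  -- The factor `epochCdf` is kept instead of being bounded by one: for small `t` the main term is
  -- itself proportional to it.
  have hBB : ∀ n, ∀ j ∈ Finset.range n, μ.real (Γ n ∩ B n ∩ B j) ≤
      epochCdf μ τ (n + 1) t * G (x + d j) * G (x + d n) := fun n j hj => by
    have hj' : j < n := Finset.mem_range.1 hj
    have hq : Measurable[past τ Y n] fun ω => (epoch τ (n + 1) ω, Y j ω) := by
      have h1 : Measurable[past τ Y n] (epoch τ (n + 1)) := measurable_past_epoch le_rfl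
      exact h1.prodMk (measurable_past_jump hj')
    have h1 := h.measureReal_past_inter hq (S := {p | p.1 ≤ t ∧ x + d j < p.2})
      ((measurableSet_le measurable_fst measurable_const).inter
        (measurableSet_lt measurable_const measurable_snd)) (x + d n)
    have h2 := h.measureReal_epoch_inter (n := n + 1) (t := t) (f := fun y => y j)
      (measurable_pi_apply j) (S := Set.Ioi (x + d j)) measurableSet_Ioi
    have h3 : μ.real {ω | x + d j < Y j ω} = G (x + d j) := by
      rw [← hYG _ (hd j), measureReal_def, measureReal_def]
      congr 1
      exact (h.identDistrib_jump j).measure_mem_eq measurableSet_Ioi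
    calc μ.real (Γ n ∩ B n ∩ B j)
        ≤ μ.real ((fun ω => (epoch τ (n + 1) ω, Y j ω)) ⁻¹' {p | p.1 ≤ t ∧ x + d j < p.2} ∩
            {ω | x + d n < Y n ω}) :=
          measureReal_mono fun ω hω => ⟨⟨hω.1.1.1, hω.2⟩, hω.1.2⟩
      _ = epochCdf μ τ (n + 1) t * G (x + d j) * G (x + d n) := by
          rw [h1, hYG _ (hd n), ← h3]
          congr 1
  have hAge : ∀ n ∈ Finset.range J, (μ.real (Γ n) -
      epochCdf μ τ (n + 1) t * ∑ j ∈ Finset.range J, G (x + d j)) * G (x + d n) ≤ μ.real (A n) := by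
    intro n hn
    have hn' : n < J := Finset.mem_range.1 hn
    have h1 : μ.real (Γ n ∩ B n) ≤ μ.real (A n) +
        ∑ j ∈ Finset.range n, μ.real (Γ n ∩ B n ∩ B j) := by
      calc μ.real (Γ n ∩ B n)
          ≤ μ.real (A n ∪ ⋃ j ∈ Finset.range n, (Γ n ∩ B n ∩ B j)) := by
            refine measureReal_mono fun ω hω => ?_
            by_cases hj : ω ∈ ⋃ j ∈ Finset.range n, B j
            · right
              simp only [Set.mem_iUnion] at hj ⊢
              obtain ⟨j, hj1, hj2⟩ := hj
              exact ⟨j, hj1, hω, hj2⟩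
            · exact Or.inl ⟨hω, hj⟩
        _ ≤ _ := (measureReal_union_le _ _).trans
            (add_le_add_right (measureReal_biUnion_finset_le _ _) _)
    have h2 : ∑ j ∈ Finset.range n, μ.real (Γ n ∩ B n ∩ B j) ≤
        ∑ j ∈ Finset.range J, epochCdf μ τ (n + 1) t * G (x + d j) * G (x + d n) :=
      (Finset.sum_le_sum (hBB n)).trans (Finset.sum_le_sum_of_subset_of_nonneg
        (Finset.range_mono hn'.le) fun j _ _ =>
          mul_nonneg (mul_nonneg (epochCdf_nonneg _ _) (hGnn _)) (hGnn _))
    rw [← Finset.sum_mul, ← Finset.mul_sum] at h2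
    rw [hΓB] at h1
    linarith
  have hdisj : Set.PairwiseDisjoint (↑(Finset.range J)) A := by
    have hlt : ∀ i j : ℕ, i < j → Disjoint (A i) (A j) := fun i j hij => by
      rw [Set.disjoint_left]
      intro ω h1 h2
      exact h2.2 (Set.mem_biUnion (Finset.mem_coe.2 (Finset.mem_range.2 hij)) h1.1.2)
    intro i _ j _ hij
    rcases lt_or_gt_of_ne hij with hij | hij
    · exact hlt i j hij
    · exact (hlt j i hij).symm
  calc _ ≤ ∑ n ∈ Finset.range J, μ.real (A n) := Finset.sum_le_sum hAge
    _ = μ.real (⋃ n ∈ Finset.range J, A n) :=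
        (measureReal_biUnion_finset hdisj fun n _ => hAm n).symm
    _ ≤ μ.real {ω | x < runningMax τ Y c t ω} := by
        refine ENNReal.toReal_mono (measure_ne_top _ _) (measure_mono_ae ?_)
        filter_upwards [h.ae_tau_pos, h.ae_tendsto_epoch] with ω hpos htop hω
        obtain ⟨n, _, hn⟩ := Set.mem_iUnion₂.1 hω
        refine lt_runningMax hpos htop ht hn.1.1.1 ?_
        have h1 := hn.1.1.2
        have h2 : x + d n < Y n ω := hn.1.2
        rw [Finset.sum_range_succ]
        linarith

/-- The lower bound, uniformly on bounded time intervals. -/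
lemma exists_le_runningMax_of_le {G : ℝ → ℝ} (hG : IsStrongTail G) {c a ε : ℝ}
    (hYG : ∀ x, 0 ≤ x → μ.real {ω | x < Y 0 ω} = G x) (ha : 0 < a) (hε : 0 < ε) (t₁ : ℝ) :
    ∃ x₀, ∀ x, x₀ ≤ x → ∀ t, 0 < t → t ≤ t₁ →
      (1 - ε) * window G a (meanCount μ τ t) x ≤ μ.real {ω | x < runningMax τ Y c t ω} := by
  have hGnn : ∀ v, 0 ≤ G v := fun v => (hG.pos v).le
  set e := min ε 1 / 4 with he
  have he0 : 0 < e := by positivity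
  have he1 : e ≤ 1 / 4 := by rw [he]; linarith [min_le_right ε 1]
  have he2 : 4 * e ≤ ε := by rw [he]; linarith [min_le_left ε 1]
  -- By submultiplicativity, the terms beyond `K` form at most a fraction `e` of `meanCount`,
  -- uniformly for `t ≤ t₁`.
  obtain ⟨K, hK⟩ := h.exists_epochCdf_le_of_time t₁ he0
  obtain ⟨R, hR0, hR⟩ := exists_walk_ge h.measurable_jump h.indep_jump h.identDistrib_jump
    h.integrable_jump one_pos he0
  set b := ∫ ω, Y 0 ω ∂μ
  -- With high probability this bounds how far the path falls before any of the first `K` jumps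
  -- occurring by time `t₁`.
  set H := R + (|b| + 1) * K + |c| * |t₁| with hH
  have hH0 : 0 ≤ H := by positivity
  obtain ⟨x₁, hx₁⟩ := hG.long_tailed H e he0
  obtain ⟨x₂, hx₂⟩ := hG.tendsto_zero (e / (K + 1)) (by positivity)
  refine ⟨max (max x₁ x₂) 0, fun x hx t ht htt => ?_⟩
  simp only [max_le_iff] at hx
  obtain ⟨⟨hx1, hx2⟩, hx0⟩ := hx
  have hsum := h.sum_le_measureReal_runningMax (x := x) (c := c) hGnn hYG ht.le (d := fun _ => H)
    (fun _ => by positivity) K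
  refine le_trans ?_ hsum
  have hΓ : ∀ n ∈ Finset.range K, (1 - e) * epochCdf μ τ (n + 1) t ≤
      μ.real {ω | epoch τ (n + 1) ω ≤ t ∧
        -H ≤ ∑ i ∈ Finset.range n, Y i ω + c * epoch τ (n + 1) ω} := by
    intro n hn
    have hnK : (n : ℝ) ≤ K := by exact_mod_cast (Finset.mem_range.1 hn).le
    have hfm : Measurable fun y : ℕ → ℝ => ∑ i ∈ Finset.range n, y i :=
      Finset.measurable_sum _ fun i _ => measurable_pi_apply i
    have h1 := h.measureReal_epoch_inter (n := n + 1) (t := t) hfm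
      (S := Set.Ici ((b - 1) * n - R)) measurableSet_Ici
    have h2 : 1 - e ≤ μ.real
        ((fun ω => ∑ i ∈ Finset.range n, Y i ω) ⁻¹' Set.Ici ((b - 1) * n - R)) := by
      have hms : MeasurableSet
          ((fun ω => ∑ i ∈ Finset.range n, Y i ω) ⁻¹' Set.Ici ((b - 1) * n - R)) :=
        (Finset.measurable_sum _ fun i _ => h.measurable_jump i) measurableSet_Ici
      have h3 : μ.real ((fun ω => ∑ i ∈ Finset.range n, Y i ω) ⁻¹' Set.Ici ((b - 1) * n - R))ᶜ ≤
          e := by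
        refine le_trans (measureReal_mono ?_) hR
        exact fun ω hω => ⟨n, not_le.1 hω⟩
      rw [probReal_compl_eq_one_sub hms] at h3
      linarith
    calc (1 - e) * epochCdf μ τ (n + 1) t
        ≤ epochCdf μ τ (n + 1) t * μ.real
            ((fun ω => ∑ i ∈ Finset.range n, Y i ω) ⁻¹' Set.Ici ((b - 1) * n - R)) := by
          rw [mul_comm]
          exact mul_le_mul_of_nonneg_left h2 (epochCdf_nonneg _ _)
      _ = _ := h1.symm
      _ ≤ _ := by
          refine ENNReal.toReal_mono (measure_ne_top _ _) (measure_mono_ae ?_)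
          filter_upwards [h.ae_tau_pos] with ω hpos hω
          have h4 : epoch τ (n + 1) ω ≤ t := hω.1
          have h5 : (b - 1) * n - R ≤ ∑ i ∈ Finset.range n, Y i ω := hω.2
          refine ⟨h4, ?_⟩
          have h6 : -((|b| + 1) * K) ≤ (b - 1) * n := by
            have a1 : -(|b| + 1) ≤ b - 1 := by linarith [neg_abs_le b]
            have a2 : -(|b| + 1) * n ≤ (b - 1) * n :=
              mul_le_mul_of_nonneg_right a1 (Nat.cast_nonneg n)
            have a3 : (|b| + 1) * n ≤ (|b| + 1) * K :=
              mul_le_mul_of_nonneg_left hnK (by positivity)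
            linarith
          have h7 : -(|c| * |t₁|) ≤ c * epoch τ (n + 1) ω := by
            have a0 := epoch_nonneg hpos (n + 1)
            have a1 : -|c| * epoch τ (n + 1) ω ≤ c * epoch τ (n + 1) ω :=
              mul_le_mul_of_nonneg_right (neg_abs_le c) a0
            have a2 : |c| * epoch τ (n + 1) ω ≤ |c| * |t₁| :=
              mul_le_mul_of_nonneg_left (h4.trans (htt.trans (le_abs_self _))) (abs_nonneg c)
            linarith
          show -H ≤ ∑ i ∈ Finset.range n, Y i ω + c * epoch τ (n + 1) ω
          linarith
  have hβ : ∑ j ∈ Finset.range K, G (x + H) ≤ e := by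
    rw [Finset.sum_const, Finset.card_range, nsmul_eq_mul]
    have h1 : G (x + H) ≤ e / (K + 1) := (hG.antitone (by linarith)).trans (hx₂ x hx2)
    rw [le_div_iff₀ (by positivity)] at h1
    linarith [hGnn (x + H)]
  have hM0 := h.meanCount_nonneg t
  have hsumF : (1 - e) * meanCount μ τ t ≤ ∑ n ∈ Finset.range K, epochCdf μ τ (n + 1) t := by
    have h1 := h.meanCount_le_sum_add K t
    have h2 : epochCdf μ τ K t ≤ e := (epochCdf_mono K htt).trans hK
    have h3 := mul_le_mul_of_nonneg_right h2 hM0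
    linarith
  have hGx : (1 - e) * G x ≤ G (x + H) := by
    have h1 := hx₁ x hx1
    have h2 := mul_le_mul_of_nonneg_left h1 (show 0 ≤ 1 - e by linarith)
    nlinarith [hGnn (x + H), sq_nonneg e]
  calc (1 - ε) * window G a (meanCount μ τ t) x
      ≤ (1 - 2 * e) * ((1 - e) * meanCount μ τ t) * ((1 - e) * G x) := by
        have h1 := window_le_mul hG.antitone ha (meanCount μ τ t) x
        have h2 := window_nonneg (u := x) hGnn ha hM0
        have h3 : 0 ≤ meanCount μ τ t * G x := mul_nonneg hM0 (hGnn x)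
        have h4 : 1 - ε ≤ (1 - 2 * e) * (1 - e) * (1 - e) := by
          nlinarith [mul_nonneg (sq_nonneg e) (show 0 ≤ 5 - 2 * e by linarith)]
        have h5 : (1 - ε) * window G a (meanCount μ τ t) x ≤
            (1 - 2 * e) * (1 - e) * (1 - e) * window G a (meanCount μ τ t) x :=
          mul_le_mul_of_nonneg_right h4 h2
        have h6 : (1 - 2 * e) * (1 - e) * (1 - e) * window G a (meanCount μ τ t) x ≤
            (1 - 2 * e) * (1 - e) * (1 - e) * (meanCount μ τ t * G x) :=
          mul_le_mul_of_nonneg_left h1 (mul_nonneg (mul_nonneg (by linarith) (by linarith))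
            (by linarith))
        linarith
    _ ≤ (1 - 2 * e) * (∑ n ∈ Finset.range K, epochCdf μ τ (n + 1) t) * G (x + H) := by
        refine mul_le_mul (mul_le_mul_of_nonneg_left hsumF (by linarith)) hGx
          (mul_nonneg (by linarith) (hGnn x)) (mul_nonneg (by linarith)
            (Finset.sum_nonneg fun _ _ => epochCdf_nonneg _ _))
    _ = ∑ n ∈ Finset.range K, ((1 - e) * epochCdf μ τ (n + 1) t - epochCdf μ τ (n + 1) t * e) *
          G (x + H) := by
        rw [Finset.mul_sum, Finset.sum_mul]
        exact Finset.sum_congr rfl fun n _ => by ring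
    _ ≤ _ := by
        refine Finset.sum_le_sum fun n hn => mul_le_mul_of_nonneg_right ?_ (hGnn _)
        exact sub_le_sub (hΓ n hn) (mul_le_mul_of_nonneg_left hβ (epochCdf_nonneg _ _))

set_option maxHeartbeats 800000 in
/-- The lower bound for large times. -/
lemma exists_le_runningMax_of_ge {G : ℝ → ℝ} (hG : IsStrongTail G) {c a ε : ℝ}
    (hYG : ∀ x, 0 ≤ x → μ.real {ω | x < Y 0 ω} = G x) (ha : 0 < a)
    (hmean : ∫ ω, Y 0 ω ∂μ + c * ∫ ω, τ 0 ω ∂μ = -a) (hε : 0 < ε) :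
    ∃ x₀ t₁, ∀ x, x₀ ≤ x → ∀ t, t₁ ≤ t →
      (1 - ε) * window G a (meanCount μ τ t) x ≤ μ.real {ω | x < runningMax τ Y c t ω} := by
  have hGnn : ∀ v, 0 ≤ G v := fun v => (hG.pos v).le
  set e := min ε 1 / 8 with he
  have he0 : 0 < e := by positivity
  have he1 : e ≤ 1 / 8 := by rw [he]; linarith [min_le_right ε 1]
  have he2 : 8 * e ≤ ε := by rw [he]; linarith [min_le_left ε 1]
  have he3 : (1 + e) ^ 2 * (1 - 8 * e) ≤ (1 - 4 * e) * (1 - e) ^ 2 := by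
    linarith [pow_pos he0 2, pow_pos he0 3]
  have he4 : (1 - e) ^ 2 * (1 + e) ≤ 1 - e := by
    have : (1 - e) * (1 - e ^ 2) ≤ (1 - e) * 1 :=
      mul_le_mul_of_nonneg_left (by linarith [sq_nonneg e]) (by linarith)
    linarith
  have he5 : (1 - e) ^ 2 ≤ 1 := pow_le_one₀ (by linarith) (by linarith)
  set δ := e * a with hδ
  have hδ0 : 0 < δ := by positivity
  obtain ⟨R₁, hR₁0, hR₁⟩ := exists_walk_ge h.measurable_jump h.indep_jump h.identDistrib_jump
    h.integrable_jump (half_pos hδ0) he0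
  obtain ⟨R₂, hR₂0, hR₂⟩ := exists_walk_ge (μ := μ) (ζ := fun n ω => c * τ n ω)
    (fun n => (h.measurable_tau n).const_mul c)
    (h.indep_tau.comp (fun _ z => c * z) fun _ => measurable_const_mul c)
    (fun n => (h.identDistrib_tau n).comp (measurable_const_mul c)) (h.integrable_tau.const_mul c)
    (half_pos hδ0) he0
  obtain ⟨t₁, ht₁0, ht₁⟩ := h.exists_nat_le_epochCdf he0
  obtain ⟨t₂, ht₂0, ht₂⟩ := h.exists_meanCount_le he0
  rw [integral_const_mul] at hR₂
  set b := ∫ ω, Y 0 ω ∂μ with hb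
  set p := ∫ ω, τ 0 ω ∂μ with hp
  have hp0 : 0 < p := h.mean_tau_pos
  set A := a + δ with hA
  have hA0 : 0 < A := by positivity
  -- The jump of index `n` is preceded by `n` jumps but `n + 1` interarrival times; this mismatch
  -- costs `|b|`.
  set H := |b| + R₁ + R₂ with hH
  have hH0 : 0 ≤ H := by positivity
  obtain ⟨x₁, hx₁⟩ := hG.long_tailed (H + A) e he0
  obtain ⟨x₂, hx₂⟩ := hG.window_le hA0 e he0
  refine ⟨max (max x₁ x₂) 0, max t₁ t₂, fun x hx t ht => ?_⟩
  simp only [max_le_iff] at hx ht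
  obtain ⟨⟨hx1, hx2⟩, hx0⟩ := hx
  have ht0 : 0 < t := ht₁0.trans_le ht.1
  obtain ⟨J, hJ, hFJ⟩ := ht₁ t ht.1
  have hsum := h.sum_le_measureReal_runningMax (x := x) (c := c) hGnn hYG ht0.le
    (d := fun n : ℕ => H + A * (n + 1)) (fun n => by positivity) J
  refine le_trans ?_ hsum
  have hΓ : ∀ n ∈ Finset.range J, 1 - 3 * e ≤ μ.real {ω | epoch τ (n + 1) ω ≤ t ∧
      -(H + A * (n + 1)) ≤ ∑ i ∈ Finset.range n, Y i ω + c * epoch τ (n + 1) ω} := by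
    intro n hn
    have hnJ : n + 1 ≤ J := Finset.mem_range.1 hn
    have h1 : 1 - e ≤ epochCdf μ τ (n + 1) t := hFJ.trans (h.epochCdf_anti t hnJ)
    have h2 : {ω | epoch τ (n + 1) ω ≤ t} ⊆ {ω | epoch τ (n + 1) ω ≤ t ∧
        -(H + A * (n + 1)) ≤ ∑ i ∈ Finset.range n, Y i ω + c * epoch τ (n + 1) ω} ∪
        ({ω | ∃ n : ℕ, ∑ i ∈ Finset.range n, Y i ω < (b - δ / 2) * n - R₁} ∪
          {ω | ∃ n : ℕ, ∑ i ∈ Finset.range n, c * τ i ω < (c * p - δ / 2) * n - R₂}) := by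
      intro ω hω
      by_cases k1 : ∃ n : ℕ, ∑ i ∈ Finset.range n, Y i ω < (b - δ / 2) * n - R₁
      · exact Or.inr (Or.inl k1)
      by_cases k2 : ∃ n : ℕ, ∑ i ∈ Finset.range n, c * τ i ω < (c * p - δ / 2) * n - R₂
      · exact Or.inr (Or.inr k2)
      push Not at k1 k2
      refine Or.inl ⟨hω, ?_⟩
      have k3 := k1 n
      have k4 := k2 (n + 1)
      rw [← Finset.mul_sum] at k4
      have k5 : epoch τ (n + 1) ω = ∑ i ∈ Finset.range (n + 1), τ i ω := rfl
      rw [← k5] at k4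
      push_cast at k4
      have k6 : b ≤ |b| := le_abs_self b
      have k7 : (b + c * p) * ((n : ℝ) + 1) = -a * (n + 1) := by rw [hmean]
      have k8 : 0 ≤ δ * (n : ℝ) := by positivity
      show -(H + A * (n + 1)) ≤ ∑ i ∈ Finset.range n, Y i ω + c * epoch τ (n + 1) ω
      rw [hH, hA]
      linarith
    have h3 := (measureReal_mono h2 (measure_ne_top μ _)).trans ((measureReal_union_le _ _).trans
      (add_le_add_right (measureReal_union_le _ _) _))
    have h4 : epochCdf μ τ (n + 1) t = μ.real {ω | epoch τ (n + 1) ω ≤ t} := rfl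
    linarith
  have hβ : ∑ j ∈ Finset.range J, G (x + (H + A * (j + 1))) ≤ e := by
    refine le_trans ?_ (hx₂ x hx2 J (Nat.cast_nonneg J))
    refine le_trans (Finset.sum_le_sum fun j _ => hG.antitone ?_)
      (sum_le_window hG.antitone hA0 J x)
    linarith
  set S := ∑ n ∈ Finset.range J, G (x + (H + A * (n + 1))) with hS
  set M := meanCount μ τ t with hM
  have hM0 : 0 ≤ M := h.meanCount_nonneg t
  have hW0 : 0 ≤ window G a M x := window_nonneg hGnn ha hM0
  have hS1 : window G A J (x + (H + A)) ≤ S := by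
    refine (window_le_sum hG.antitone hA0 J _).trans (le_of_eq ?_)
    refine Finset.sum_congr rfl fun n _ => ?_
    congr 1; ring
  -- The barrier has slope `A = (1 + e) * a`. The integral over length `A * J` dominates the one
  -- over `a * J`, so only the ratio of the prefactors, `1 + e`, is lost.
  have hS2 : a * window G a J (x + (H + A)) ≤ A * window G A J (x + (H + A)) := by
    rw [mul_window ha, mul_window hA0]
    refine intervalIntegral.integral_mono_interval le_rfl ?_ ?_ (Eventually.of_forall hGnn)
      hG.antitone.intervalIntegrable
    · have : 0 ≤ a * (J : ℝ) := by positivity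
      linarith
    · have : 0 ≤ δ * (J : ℝ) := by positivity
      rw [hA]; linarith
  have hS3 : window G a J x ≤ (1 + e) * window G a J (x + (H + A)) := by
    rw [window_comp_add, ← window_const_mul]
    refine window_le_window hG.antitone (fun q r hqr => mul_le_mul_of_nonneg_left
      (hG.antitone (by linarith)) (by positivity)) ha (Nat.cast_nonneg J) fun v hv =>
        hx₁ v (hx1.trans hv)
  have hMJ : (1 - e) ^ 2 * M ≤ J := by
    have h1 := ht₂ t ht.2
    have h2 : 0 ≤ t / p := by positivity
    have h3 := mul_le_mul_of_nonneg_left h1 (sq_nonneg (1 - e))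
    have h5 := mul_le_mul_of_nonneg_right he4 h2
    linarith
  have hS4 : (1 - e) ^ 2 * window G a M x ≤ window G a J x :=
    (mul_window_le_window_mul hG.antitone ha (by positivity) he5).trans
      (window_mono hG.antitone hGnn ha hMJ)
  have hS5 : (1 - e) ^ 2 * window G a M x ≤ (1 + e) ^ 2 * S := by
    have h1 : a * window G a J (x + (H + A)) ≤ a * ((1 + e) * S) := by
      have := mul_le_mul_of_nonneg_left hS1 hA0.le
      rw [hA, hδ] at this hS2
      linarith
    have h2 := le_of_mul_le_mul_left h1 ha
    have h3 := mul_le_mul_of_nonneg_left h2 (show 0 ≤ 1 + e by positivity)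
    linarith
  calc (1 - ε) * window G a M x ≤ (1 - 8 * e) * window G a M x :=
        mul_le_mul_of_nonneg_right (by linarith) hW0
    _ ≤ (1 - 4 * e) * S := by
        have h2 := mul_le_mul_of_nonneg_right he3 hW0
        have h3 := mul_le_mul_of_nonneg_left hS5 (show 0 ≤ 1 - 4 * e by linarith)
        exact le_of_mul_le_mul_left (a := (1 + e) ^ 2) (by linarith) (by positivity)
    _ = ∑ n ∈ Finset.range J, (1 - 4 * e) * G (x + (H + A * (n + 1))) := by rw [hS, Finset.mul_sum]
    _ ≤ _ := by
        refine Finset.sum_le_sum fun n hn => mul_le_mul_of_nonneg_right ?_ (hGnn _)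
        have h1 := hΓ n hn
        have hS0 : 0 ≤ S := Finset.sum_nonneg fun _ _ => hGnn _
        have h2 := mul_le_mul (epochCdf_le_one (μ := μ) (τ := τ) (n + 1) t) hβ hS0 zero_le_one
        linarith

/-- The uniform lower bound for the tail of the running maximum. -/
theorem exists_le_runningMax {G : ℝ → ℝ} (hG : IsStrongTail G) {c a ε : ℝ}
    (hYG : ∀ x, 0 ≤ x → μ.real {ω | x < Y 0 ω} = G x) (ha : 0 < a)
    (hmean : ∫ ω, Y 0 ω ∂μ + c * ∫ ω, τ 0 ω ∂μ = -a) (hε : 0 < ε) :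
    ∃ x₀, ∀ x, x₀ ≤ x → ∀ t, 0 < t →
      (1 - ε) * window G a (meanCount μ τ t) x ≤ μ.real {ω | x < runningMax τ Y c t ω} := by
  obtain ⟨x₁, t₁, H₁⟩ := h.exists_le_runningMax_of_ge hG hYG ha hmean hε
  obtain ⟨x₂, H₂⟩ := h.exists_le_runningMax_of_le hG (c := c) hYG ha hε t₁
  refine ⟨max x₁ x₂, fun x hx t ht => ?_⟩
  rw [max_le_iff] at hx
  rcases le_total t t₁ with h1 | h1
  · exact H₂ x hx.2 t ht h1
  · exact H₁ x hx.1 t h1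

end CompoundRenewal.IsInput

/-! ### Assembling the two bounds. -/

lemma measureReal_lt_le_tail {Ω : Type*} [MeasurableSpace Ω] {μ : Measure Ω}
    [IsProbabilityMeasure μ] {Y : ℕ → Ω → ℝ} (hY : Measurable (Y 0)) (x : ℝ) :
    μ.real {ω | x < Y 0 ω} ≤ tail (CompoundRenewal.jumpLaw μ Y) x ∧
      (0 ≤ x → μ.real {ω | x < Y 0 ω} = tail (CompoundRenewal.jumpLaw μ Y) x) := by
  have h1 : tail (CompoundRenewal.jumpLaw μ Y) x = μ.real {ω | x < max (Y 0 ω) 0} := by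
    rw [tail, CompoundRenewal.jumpLaw, map_measureReal_apply (hY.max measurable_const)
      measurableSet_Ioi]
    rfl
  rw [h1]
  refine ⟨measureReal_mono fun ω (hω : x < Y 0 ω) =>
    (lt_max_of_lt_left hω : x < max (Y 0 ω) 0), fun hx => ?_⟩
  congr 1
  ext ω
  simp [hx.not_gt]

theorem theorem2 {Ω : Type*} [MeasurableSpace Ω] (μ : Measure Ω) [IsProbabilityMeasure μ]
    (τ Y : ℕ → Ω → ℝ) (hinput : CompoundRenewal.IsInput μ τ Y)
    (c lam b a : ℝ)
    (hlam : ∫ ω, τ 0 ω ∂μ = 1 / lam)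
    (hb : ∫ ω, Y 0 ω ∂μ = b)
    (ha : a = c / lam + b) (ha_neg : a < 0)
    (hB : StrongSubexponential (CompoundRenewal.jumpLaw μ Y))
    (hc : c ≤ 0 ∨
      (0 < c ∧ (fun x : ℝ => μ.real {ω | x < c * τ 0 ω}) =o[atTop]
        (fun x : ℝ => tail (CompoundRenewal.jumpLaw μ Y) x))) :
    (∀ ε : ℝ, 0 < ε → ∃ x₀ : ℝ, ∀ x : ℝ, x₀ ≤ x → ∀ t : ℝ, 0 < t →
      |μ.real {ω | x < CompoundRenewal.runningMax τ Y c t ω} -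
          1 / |a| * ∫ v in x..(x + |a| * ∫ ω, (CompoundRenewal.count τ t ω : ℝ) ∂μ),
            tail (CompoundRenewal.jumpLaw μ Y) v| ≤
        ε * (1 / |a| * ∫ v in x..(x + |a| * ∫ ω, (CompoundRenewal.count τ t ω : ℝ) ∂μ),
            tail (CompoundRenewal.jumpLaw μ Y) v)) ∧
    (fun p : ℝ × ℝ => μ.real {ω | p.1 < CompoundRenewal.runningMax τ Y c p.2 ω})
      ~[atTop ×ˢ atTop]
    (fun p : ℝ × ℝ => 1 / |a| * ∫ v in p.1..(p.1 + |a| * (lam * p.2)),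
      tail (CompoundRenewal.jumpLaw μ Y) v) := by
  have hG := hB.isStrongTail
  set G := tail (CompoundRenewal.jumpLaw μ Y) with hGdef
  have hGnn : ∀ v, 0 ≤ G v := fun v => (hG.pos v).le
  have hYG := fun x => measureReal_lt_le_tail (μ := μ) (hinput.measurable_jump 0) x
  have hA : 0 < |a| := abs_pos.2 ha_neg.ne
  have hmean : ∫ ω, Y 0 ω ∂μ + c * ∫ ω, τ 0 ω ∂μ = -|a| := by
    rw [hb, hlam, abs_of_neg ha_neg, ha]; ring
  have hmean' : ∫ ω, (Y 0 ω + c * τ 0 ω) ∂μ = -|a| := by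
    rw [integral_add hinput.integrable_jump (hinput.integrable_tau.const_mul c),
      integral_const_mul, hmean]
  have hτG : ∀ e : ℝ, 0 < e → ∃ x₀, ∀ x, x₀ ≤ x → μ.real {ω | x < c * τ 0 ω} ≤ e * G x := by
    intro e he
    rcases hc with hc | ⟨_, hc⟩
    · refine ⟨0, fun x hx => ?_⟩
      have : μ.real {ω | x < c * τ 0 ω} = 0 := by
        rw [measureReal_eq_zero_iff, measure_eq_zero_iff_ae_notMem]
        filter_upwards [hinput.tau_pos 0] with ω hω hmem
        have h1 : x < c * τ 0 ω := hmem
        nlinarith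
      rw [this]
      exact mul_nonneg he.le (hGnn x)
    · obtain ⟨x₀, hx₀⟩ := eventually_atTop.1 (hc.def he)
      refine ⟨x₀, fun x hx => ?_⟩
      have := hx₀ x hx
      rwa [Real.norm_of_nonneg measureReal_nonneg, Real.norm_of_nonneg (hGnn x)] at this
  have main : ∀ ε : ℝ, 0 < ε → ∃ x₀ : ℝ, ∀ x : ℝ, x₀ ≤ x → ∀ t : ℝ, 0 < t →
      |μ.real {ω | x < CompoundRenewal.runningMax τ Y c t ω} -
        window G |a| (CompoundRenewal.meanCount μ τ t) x| ≤
        ε * window G |a| (CompoundRenewal.meanCount μ τ t) x := by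
    intro ε hε
    obtain ⟨x₁, h₁⟩ := hinput.exists_runningMax_le hG (fun x => (hYG x).1) hτG hA hmean' hε
    obtain ⟨x₂, h₂⟩ := hinput.exists_le_runningMax hG (c := c) (fun x => (hYG x).2) hA hmean hε
    refine ⟨max x₁ x₂, fun x hx t ht => ?_⟩
    rw [max_le_iff] at hx
    have k1 := h₁ x hx.1 t ht
    have k2 := h₂ x hx.2 t ht
    rw [abs_le]
    constructor <;> linarith
  refine ⟨fun ε hε => ?_, ?_⟩
  · obtain ⟨x₀, hx₀⟩ := main ε hε
    refine ⟨x₀, fun x hx t ht => ?_⟩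
    rw [hinput.integral_count ht.le]
    exact hx₀ x hx t ht
  · refine isLittleO_iff.2 fun ε hε => ?_
    set e := min ε 1 / 4 with he
    have he0 : 0 < e := by positivity
    have he1 : e ≤ 1 / 4 := by rw [he]; linarith [min_le_right ε 1]
    have he2 : 4 * e ≤ ε := by rw [he]; linarith [min_le_left ε 1]
    have hp := hinput.mean_tau_pos
    obtain ⟨x₀, hx₀⟩ := main e he0
    obtain ⟨t₁, ht₁0, ht₁⟩ := hinput.exists_meanCount_le he0
    obtain ⟨t₂, _, ht₂⟩ := hinput.exists_le_meanCount he0 (by linarith)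
    filter_upwards [(eventually_ge_atTop x₀).prod_mk (eventually_ge_atTop (max t₁ t₂))]
      with q hq
    obtain ⟨hx, ht⟩ := hq
    rw [max_le_iff] at ht
    have ht0 : 0 < q.2 := ht₁0.trans_le ht.1
    have k := hx₀ q.1 hx q.2 ht0
    have hlamt : q.2 / ∫ ω, τ 0 ω ∂μ = lam * q.2 := by rw [hlam]; field_simp
    have k1 := ht₁ q.2 ht.1
    have k2 := ht₂ q.2 ht.2
    rw [hlamt] at k1 k2
    have hr : 0 ≤ lam * q.2 := by rw [← hlamt]; positivity
    have hW0 : 0 ≤ window G |a| (lam * q.2) q.1 := window_nonneg hGnn hA hr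
    have hlow : (1 - e) * window G |a| (lam * q.2) q.1 ≤
        window G |a| (CompoundRenewal.meanCount μ τ q.2) q.1 :=
      (mul_window_le_window_mul hG.antitone hA (by linarith) (by linarith)).trans
        (window_mono hG.antitone hGnn hA k2)
    -- Concavity in the length: stretching the window by the factor `1 + e` increases it by at most
    -- that factor.
    have hup : window G |a| (CompoundRenewal.meanCount μ τ q.2) q.1 ≤
        (1 + e) * window G |a| (lam * q.2) q.1 := by
      have h1 := mul_window_le_window_mul (r := (1 + e) * (lam * q.2)) (u := q.1) hG.antitone hA
        (θ := 1 / (1 + e)) (by positivity) (by rw [div_le_one (by positivity)]; linarith)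
      rw [show 1 / (1 + e) * ((1 + e) * (lam * q.2)) = lam * q.2 by field_simp,
        one_div_mul_eq_div, div_le_iff₀ (by positivity)] at h1
      have h2 := window_mono (u := q.1) hG.antitone hGnn hA k1
      linarith
    show ‖_ - window G |a| (lam * q.2) q.1‖ ≤ ε * ‖window G |a| (lam * q.2) q.1‖
    rw [Real.norm_eq_abs, Real.norm_of_nonneg hW0]
    set W := window G |a| (lam * q.2) q.1
    set V := window G |a| (CompoundRenewal.meanCount μ τ q.2) q.1
    rw [abs_le] at k ⊢
    have h3 : e * V ≤ e * ((1 + e) * W) := mul_le_mul_of_nonneg_left hup he0.le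
    have h4 : e * (e * W) ≤ 1 / 4 * (e * W) := mul_le_mul_of_nonneg_right he1 (by positivity)
    have h5 : 4 * e * W ≤ ε * W := mul_le_mul_of_nonneg_right he2 hW0
    have h6 : 0 ≤ e * W := by positivity
    constructor <;> linarith [k.1, k.2]
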